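/- Let $k$ be a field of characteristic zero and let $n\ge 3$. Let $A=k_{-1}[x_1,\dots,x_n]$ be the algebra generated by $x_1,\dots,x_n$ subject to $x_ix_j=-x_jx_i$ for $i\neq j$, graded by $\deg x_i=1$; the alternating group $\mathfrak A_n$ acts on it by permuting the $x_i$. Then the fixed subring $A^{\mathfrak A_n}$ is a classical complete intersection (cci): it is a connected graded noetherian algebra that is isomorphic, as a graded algebra, to $R/(\Omega_1,\dots,\Omega_m)$ for some connected graded noetherian Artin–Schelter regular algebra $R$ and some regular normal sequence $\Omega_1,\dots,\Omega_m$ of homogeneous elements of $R$ of positive degree. Explicitly, let $f_{2m}\in k[p_1,\dots,p_n]$ be the polynomial with $\sum_i t_i^m=f_{2m}(e_1(t),\dots,e_n(t))$, where $e_i$ is the $i$-th elementary symmetric polynomial in $t_1,\dots,t_n$ (so $f_0=n$), and let $C$ be the algebra generated over the central polynomial subring $k[p_1,\dots,p_n]$ by $y_1,\dots,y_{n-1},u,v$ subject to $$y_jy_i=-y_iy_j+2f_{2i+2j-2}\ (i<j),\quad uy_i=(-1)^{n-1}y_iu,\quad vy_i=(-1)^ny_iv+2f_{2i-2}\,u,\quad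 vu=(-1)^{n+1}uv .$$ Then: 1. $C$ is the iterated Ore extension obtained from the polynomial ring $k[p_1,\dots,p_n]$ by adjoining $y_1,\dots,y_{n-1},u,v$ in this order, with automorphisms and skew derivations that act on the earlier generators as these relations prescribe and act on $k[p_1,\dots,p_n]$ as the identity and as zero, respectively. 2. With $\deg p_i=2i$, $\deg y_i=2i-1$, $\deg u=n$, $\deg v=n-1$, the algebra $C$ is connected graded, noetherian, and Artin–Schelter regular of dimension $2n+1$. 3. The $n+1$ elements $$y_i^2-f_{4i-2}\ (1\le i\le n-1),\qquad u^2-(-1)^{n(n-1)/2}p_n,\qquad v^2-(-1)^{(n-1)(n-2)/2}p_{n-1}$$ are homogeneous, of degrees $4i-2$, $2n$, $2n-2$, and central in $C$, and they form, in this order, a regular sequence. 4. There is a surjective homomorphism of graded algebras $\varphi:C\to A^{\mathfrak A_n}$ whose kernel is the ideal generated by these $n+1$ elements, with $\varphi(p_i)=e_i(x_1^2,\dots,x_n^2)$, $\varphi(y_i)=\sum_j x_j^{2i-1}$, $\varphi(u)=x_1x_2\cdots x_n$, and $\varphi(v)$ the $\mathfrak A_n$-orbit sum of $x_1x_2\cdots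 x_{n-1}$. -/

import Mathlib

open CategoryTheory

universe u

noncomputable section

/-! ### Connected graded algebras, Ext, AS regularity -/

section General

variable (k : Type u) [Field k]

/-- A family `𝒜` of subspaces makes `A` a connected graded algebra
`A = k ⊕ A₁ ⊕ A₂ ⊕ ⋯`, with `A_i A_j ⊆ A_{i+j}`. -/
structure IsConnectedGraded {A : Type u} [Ring A] [Algebra k A]
    (𝒜 : ℕ → Submodule k A) : Prop where
  nontrivial : Nontrivial A
  gradedMonoid : SetLike.GradedMonoid 𝒜
  isInternal : DirectSum.IsInternal 𝒜
  zero_eq : 𝒜 0 = 1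

/-- Noetherian on both sides. -/
def IsTwoSidedNoetherian (A : Type u) [Ring A] : Prop :=
  IsNoetherianRing A ∧ IsNoetherianRing Aᵐᵒᵖ

/-- The same grading, on the opposite algebra. -/
def opGrading {A : Type u} [Ring A] [Algebra k A] (𝒜 : ℕ → Submodule k A) :
    ℕ → Submodule k Aᵐᵒᵖ :=
  fun i => (𝒜 i).map (MulOpposite.opLinearEquiv k : A ≃ₗ[k] Aᵐᵒᵖ).toLinearMap

/-- The left ideal generated by the elements of positive degree (for a connected graded
algebra this is the augmentation ideal `A₁ ⊕ A₂ ⊕ ⋯`). -/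
def positivePart {A : Type u} [Ring A] [Algebra k A] (𝒜 : ℕ → Submodule k A) : Ideal A :=
  Ideal.span {a | ∃ i, 0 < i ∧ a ∈ 𝒜 i}

/-- The trivial left module `k = A / A_{>0}`. -/
abbrev trivialModule {A : Type u} [Ring A] [Algebra k A] (𝒜 : ℕ → Submodule k A) :
    ModuleCat.{u} A :=
  ModuleCat.of A (A ⧸ positivePart k 𝒜)

/-- `Ext^i_A(k, A)`, for left modules. -/
abbrev ExtTrivial {A : Type u} [Ring A] [Algebra k A] (𝒜 : ℕ → Submodule k A) (i : ℕ) :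
    Type u :=
  Abelian.Ext.{u} (trivialModule k 𝒜) (ModuleCat.of A A) i

/-- The right `A`-module structure of `Ext^i_A(k, A)`: the element `a` acts through the
endomorphism `b ↦ b a` of the left module `A`. -/
def ExtTrivial.act {A : Type u} [Ring A] [Algebra k A] {𝒜 : ℕ → Submodule k A} {i : ℕ}
    (x : ExtTrivial k 𝒜 i) (a : A) : ExtTrivial k 𝒜 i :=
  Abelian.Ext.comp x
    (Abelian.Ext.mk₀ (ModuleCat.ofHom (LinearMap.toSpanSingleton A A a))) (add_zero i)

/-- One side of the Artin-Schelter Gorenstein condition in dimension `d`: the left module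
`A` has injective dimension `d`, `Ext^i_A(k, A) = 0` for `i ≠ d`, and `Ext^d_A(k, A)` is
isomorphic to `k` as a right module. (For the noetherian algebras considered here the graded
`Ext` has this `Ext` as its underlying module, and a graded module whose underlying module
is the trivial module `k` is a shift `k(ℓ)`.) -/
structure IsLeftASGorenstein {A : Type u} [Ring A] [Algebra k A]
    (𝒜 : ℕ → Submodule k A) (d : ℕ) : Prop where
  injectiveDimension_eq : injectiveDimension (ModuleCat.of A A) = d
  ext_eq_zero : ∀ i, i ≠ d → Subsingleton (ExtTrivial k 𝒜 i)
  ext_top : ∃ e : ExtTrivial k 𝒜 d ≃+ k,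
    (∀ x (c : k), e (ExtTrivial.act k x (algebraMap k A c)) = e x * c) ∧
    ∀ x (i : ℕ) (a : A), 0 < i → a ∈ 𝒜 i → e (ExtTrivial.act k x a) = 0

/-- Artin-Schelter Gorenstein of injective dimension `d`; right modules over `A` are left
modules over the opposite algebra. -/
def IsASGorenstein {A : Type u} [Ring A] [Algebra k A]
    (𝒜 : ℕ → Submodule k A) (d : ℕ) : Prop :=
  IsLeftASGorenstein k 𝒜 d ∧ IsLeftASGorenstein k (opGrading k 𝒜) d

/-- Finite (left) global dimension. -/
def HasFiniteGlobalDimension (A : Type u) [Ring A] : Prop :=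
  ∃ m : ℕ, ∀ M : ModuleCat.{u} A, HasProjectiveDimensionLE M m

/-- The Gelfand-Kirillov dimension: the supremum, over finite-dimensional subspaces `V`
containing `1`, of `limsup log (dim V^m) / log m`. -/
def gelfandKirillovDim (A : Type u) [Ring A] [Algebra k A] : ENNReal :=
  ⨆ (V : Submodule k A) (_ : V.FG) (_ : (1 : A) ∈ V),
    Filter.limsup (fun m : ℕ =>
      ENNReal.ofReal (Real.log (Module.finrank k ↥(V ^ m)) / Real.log m)) Filter.atTop

/-- Artin-Schelter regular of dimension `d`. -/
structure IsASRegular {A : Type u} [Ring A] [Algebra k A]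
    (𝒜 : ℕ → Submodule k A) (d : ℕ) : Prop where
  isConnectedGraded : IsConnectedGraded k 𝒜
  isASGorenstein : IsASGorenstein k 𝒜 d
  globalDimension_left : HasFiniteGlobalDimension A
  globalDimension_right : HasFiniteGlobalDimension Aᵐᵒᵖ
  gelfandKirillovDim_ne_top : gelfandKirillovDim k A ≠ ⊤

/-! ### Regular sequences and classical complete intersections -/

/-- The two-sided ideal generated by the terms of a sequence before the `i`-th. -/
def previousIdeal {R : Type u} [Ring R] {m : ℕ} (Ω : Fin m → R) (i : Fin m) :
    TwoSidedIdeal R :=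
  TwoSidedIdeal.span {a | ∃ j < i, a = Ω j}

/-- For each `i` the image of `Ω i` modulo the previous terms is regular, i.e. neither a left
nor a right zero divisor. -/
def IsRegularSequence {R : Type u} [Ring R] {m : ℕ} (Ω : Fin m → R) : Prop :=
  ∀ i r, (Ω i * r ∈ previousIdeal Ω i → r ∈ previousIdeal Ω i) ∧
    (r * Ω i ∈ previousIdeal Ω i → r ∈ previousIdeal Ω i)

/-- For each `i` the image `ω` of `Ω i` in the quotient `S` of `R` by the previous terms is
normal, i.e. `ω S = S ω`. -/
def IsNormalSequence {R : Type u} [Ring R] {m : ℕ} (Ω : Fin m → R) : Prop :=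
  ∀ i r, (∃ s, Ω i * r - s * Ω i ∈ previousIdeal Ω i) ∧
    (∃ s, r * Ω i - Ω i * s ∈ previousIdeal Ω i)

/-- `φ` induces an isomorphism of graded algebras `R / (Ω₁, …, Ω_m) ≅ A`: it is a graded
surjective homomorphism whose kernel is the two-sided ideal generated by the `Ω i`. -/
structure InducesGradedIso {R A : Type u} [Ring R] [Algebra k R] [Ring A] [Algebra k A]
    (𝓡 : ℕ → Submodule k R) (𝒜 : ℕ → Submodule k A) {m : ℕ} (Ω : Fin m → R)
    (φ : R →ₐ[k] A) : Prop where
  map_mem : ∀ d, ∀ c ∈ 𝓡 d, φ c ∈ 𝒜 d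
  surjective : Function.Surjective φ
  ker_eq : ∀ c, φ c = 0 ↔ c ∈ TwoSidedIdeal.span (Set.range Ω)

/-- Classical complete intersection: a connected graded noetherian algebra isomorphic to
`R / (Ω₁, …, Ω_m)` for a connected graded noetherian AS regular algebra `R` and a regular
normal sequence of homogeneous elements of positive degree. -/
def IsCCI {A : Type u} [Ring A] [Algebra k A] (𝒜 : ℕ → Submodule k A) : Prop :=
  IsConnectedGraded k 𝒜 ∧ IsTwoSidedNoetherian A ∧
  ∃ (R : Type u) (_ : Ring R) (_ : Algebra k R) (𝓡 : ℕ → Submodule k R)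
    (m : ℕ) (Ω : Fin m → R),
    IsConnectedGraded k 𝓡 ∧ IsTwoSidedNoetherian R ∧ (∃ d, IsASRegular k 𝓡 d) ∧
    (∀ i, ∃ e, 0 < e ∧ Ω i ∈ 𝓡 e) ∧ IsRegularSequence Ω ∧ IsNormalSequence Ω ∧
    ∃ φ : R →ₐ[k] A, InducesGradedIso k 𝓡 𝒜 Ω φ

/-- Inside an algebra `C`, the subalgebra `T` is the Ore extension `S[y; τ, δ]`: `τ` is an
automorphism of `S`, `δ` a `τ`-derivation, `y s = τ(s) y + δ(s)`, and `T` is a free left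
`S`-module on the powers of `y`. -/
structure IsOreExtension {k : Type u} [Field k] {C : Type u} [Ring C] [Algebra k C]
    (S T : Subalgebra k C) (y : C) (τ : S ≃ₐ[k] S) (δ : S →ₗ[k] S) : Prop where
  le : S ≤ T
  mem : y ∈ T
  leibniz : ∀ a b, δ (a * b) = δ a * b + τ a * δ b
  rel : ∀ s : S, y * (s : C) = (τ s : C) * y + (δ s : C)
  basis : ∀ t ∈ T, ∃! f : ℕ →₀ S, t = f.sum fun i s => (s : C) * y ^ i

end General

/-! ### The `(-1)`-skew polynomial ring and its invariants -/

/-- The relations `x_i x_j = - x_j x_i`, `i ≠ j`. -/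
inductive SkewRel (k : Type u) [Field k] (n : ℕ) :
    FreeAlgebra k (Fin n) → FreeAlgebra k (Fin n) → Prop
  | anticomm (i j : Fin n) (h : i ≠ j) :
      SkewRel k n (FreeAlgebra.ι k i * FreeAlgebra.ι k j)
        (-(FreeAlgebra.ι k j * FreeAlgebra.ι k i))

/-- `k_{-1}[x_1, …, x_n]`. -/
def SkewPoly (k : Type u) [Field k] (n : ℕ) : Type u := RingQuot (SkewRel k n)

namespace SkewPoly

variable (k : Type u) [Field k] (n : ℕ)

instance : Ring (SkewPoly k n) := inferInstanceAs (Ring (RingQuot (SkewRel k n)))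

instance : Algebra k (SkewPoly k n) := inferInstanceAs (Algebra k (RingQuot (SkewRel k n)))

/-- The generators. -/
def x (i : Fin n) : SkewPoly k n := RingQuot.mkAlgHom k (SkewRel k n) (FreeAlgebra.ι k i)

theorem x_mul_x {i j : Fin n} (h : i ≠ j) : x k n i * x k n j = -(x k n j * x k n i) := by
  have := RingQuot.mkAlgHom_rel k (SkewRel.anticomm (k := k) i j h)
  rw [map_neg, map_mul, map_mul] at this
  exact this

/-- The grading with all `x_i` in degree one: degree `d` is spanned by the words of length
`d` in the generators. -/
def grading (d : ℕ) : Submodule k (SkewPoly k n) :=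
  Submodule.span k (Set.range (x k n)) ^ d

variable {n}

/-- The endomorphism `x_i ↦ x_{σ(i)}`. -/
def perm (σ : Equiv.Perm (Fin n)) : SkewPoly k n →ₐ[k] SkewPoly k n :=
  RingQuot.liftAlgHom k ⟨FreeAlgebra.lift k fun i => x k n (σ i), by
    rintro _ _ ⟨i, j, h⟩
    simp only [map_neg, map_mul, FreeAlgebra.lift_ι_apply]
    exact x_mul_x k n (fun e => h (σ.injective e))⟩

/-- The fixed subring of a group of permutations. -/
def invariants (G : Subgroup (Equiv.Perm (Fin n))) : Subalgebra k (SkewPoly k n) where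
  carrier := {a | ∀ σ ∈ G, perm k σ a = a}
  mul_mem' ha hb σ hσ := by rw [map_mul, ha σ hσ, hb σ hσ]
  add_mem' ha hb σ hσ := by rw [map_add, ha σ hσ, hb σ hσ]
  algebraMap_mem' c σ _ := (perm k σ).commutes c

/-- The induced grading of the fixed subring. -/
def invariantsGrading (G : Subgroup (Equiv.Perm (Fin n))) (d : ℕ) :
    Submodule k (invariants k G) :=
  (grading k n d).comap (invariants k G).val.toLinearMap

/-- The orbit sum of a monomial: `1 / |stab(m)|` times the sum of all `g(m)`, `g ∈ G`. -/
def orbitSum (G : Subgroup (Equiv.Perm (Fin n))) [Fintype G] (m : SkewPoly k n) :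
    SkewPoly k n :=
  ((Nat.card {g : G // perm k (g : Equiv.Perm (Fin n)) m = m} : k))⁻¹ •
    ∑ g : G, perm k (g : Equiv.Perm (Fin n)) m

variable (n)

/-- The power sum `P_m = ∑ x_i ^ m`. -/
def powerSum (m : ℕ) : SkewPoly k n := ∑ i, x k n i ^ m

/-- `ρ_m`, the `m`-th elementary symmetric polynomial in the (commuting) squares. -/
def squareEsymm (m : ℕ) : SkewPoly k n :=
  ∑ s ∈ (Finset.univ : Finset (Fin n)).powersetCard m,
    ((s.sort (· ≤ ·)).map fun i => x k n i ^ 2).prod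

/-- The product `x_1 x_2 ⋯ x_m`, `m ≤ n`. -/
def initialProd (m : ℕ) : SkewPoly k n := ((List.ofFn (x k n)).take m).prod

end SkewPoly

/-! ### The iterated Ore extension `C` -/

/-- The polynomial `f` with `∑ t_i ^ m = f(e_1(t), …, e_n(t))`, where `e_{i+1}` is the variable
`X i`. For `m = 0` it is the constant `n`. -/
def powerSumPoly (k : Type u) [Field k] (n m : ℕ) : MvPolynomial (Fin n) k :=
  (MvPolynomial.esymmAlgEquiv (Fin n) k (Fintype.card_fin n)).symm
    ⟨MvPolynomial.psum (Fin n) k m, MvPolynomial.psum_isSymmetric (Fin n) k m⟩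

/-! The generators of `C` over `k[p_1, …, p_n]` are indexed by `0, …, n`: the indices
`i < n - 1` stand for `y_{i+1}`, then come `u` (index `n - 1`) and `v` (index `n`). -/

/-- The sign in `y_j y_i = ± y_i y_j + ⋯`, for `i < j`. -/
def oreSign (n j i : ℕ) : ℤ :=
  if j + 1 < n then -1
  else if j + 1 = n then (-1) ^ (n - 1)
  else if i + 1 < n then (-1) ^ n
  else (-1) ^ (n + 1)

/-- The correction term in `y_j y_i = ± y_i y_j + ⋯`, for `i < j`. -/
def oreCorrection (k : Type u) [Field k] (n j i : ℕ) :
    FreeAlgebra (MvPolynomial (Fin n) k) (Fin (n + 1)) :=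
  if j + 1 < n then algebraMap _ _ (2 * powerSumPoly k n (i + j + 1))
  else if j = n ∧ i + 1 < n then
    algebraMap _ _ (2 * powerSumPoly k n i) * FreeAlgebra.ι _ ⟨n - 1, by omega⟩
  else 0

/-- The defining relations of `C` over the commutative ring `k[p_1, …, p_n]`. -/
inductive OreRel (k : Type u) [Field k] (n : ℕ) :
    FreeAlgebra (MvPolynomial (Fin n) k) (Fin (n + 1)) →
      FreeAlgebra (MvPolynomial (Fin n) k) (Fin (n + 1)) → Prop
  | swap (i j : Fin (n + 1)) (h : i < j) :
      OreRel k n (FreeAlgebra.ι _ j * FreeAlgebra.ι _ i)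
        (oreSign n j i • (FreeAlgebra.ι _ i * FreeAlgebra.ι _ j) + oreCorrection k n j i)

/-- The algebra `C`. -/
def OreAlg (k : Type u) [Field k] (n : ℕ) : Type u := RingQuot (OreRel k n)

namespace OreAlg

variable (k : Type u) [Field k] (n : ℕ)

instance : Ring (OreAlg k n) := inferInstanceAs (Ring (RingQuot (OreRel k n)))

instance : Algebra (MvPolynomial (Fin n) k) (OreAlg k n) :=
  inferInstanceAs (Algebra (MvPolynomial (Fin n) k) (RingQuot (OreRel k n)))

instance : Algebra k (OreAlg k n) := inferInstanceAs (Algebra k (RingQuot (OreRel k n)))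

/-- The quotient map from the free algebra. -/
def mk : FreeAlgebra (MvPolynomial (Fin n) k) (Fin (n + 1)) →ₐ[MvPolynomial (Fin n) k]
    OreAlg k n :=
  RingQuot.mkAlgHom (MvPolynomial (Fin n) k) (OreRel k n)

/-- The structure map `k[p_1, …, p_n] → C`. -/
def coeff : MvPolynomial (Fin n) k →+* OreAlg k n :=
  algebraMap (MvPolynomial (Fin n) k) (OreAlg k n)

/-- The generators `y_1, …, y_{n-1}, u, v`. -/
def y (i : Fin (n + 1)) : OreAlg k n := mk k n (FreeAlgebra.ι _ i)

/-- The degree of `y i`: the degree of `y_{i+1}` is `2i + 1`, that of `u` is `n`, that of `v`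
is `n - 1`. -/
def weight (i : ℕ) : ℕ := if i + 1 < n then 2 * i + 1 else if i + 1 = n then n else n - 1

/-- The grading of `C`, with `p_i` in degree `2i`: the subspace spanned by the products of a
monomial in the `p_i` and a word in the `y i` of total degree `d`. -/
def grading (d : ℕ) : Submodule k (OreAlg k n) :=
  Submodule.span k {c | ∃ (m : Fin n →₀ ℕ) (l : List (Fin (n + 1))),
    (m.sum fun i e => e * (2 * ((i : ℕ) + 1))) + (l.map fun i => weight n i).sum = d ∧
      c = coeff k n (MvPolynomial.monomial m 1) * (l.map (y k n)).prod}

/-- The subalgebra generated by `k[p_1, …, p_n]` and the first `j` of the generators. -/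
def tower (j : ℕ) : Subalgebra k (OreAlg k n) :=
  Algebra.adjoin k (Set.range (coeff k n) ∪ y k n '' {i | (i : ℕ) < j})

/-- The polynomials in `p_1, …, p_n` to which the squares of the generators are set equal:
`f(4i+2)` for `y_{i+1}`, `(-1)^(n(n-1)/2) p_n` for `u`, `(-1)^((n-1)(n-2)/2) p_{n-1}` for `v`.
The variable with index `i` is `p_{i+1}`; the default `0` does not occur for `n ≥ 2`. -/
def squareValue (i : ℕ) : MvPolynomial (Fin n) k :=
  if i + 1 < n then powerSumPoly k n (2 * i + 1)
  else if i + 1 = n then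
    if h : n - 1 < n then (-1) ^ (n * (n - 1) / 2) * MvPolynomial.X ⟨n - 1, h⟩ else 0
  else
    if h : n - 2 < n then (-1) ^ ((n - 1) * (n - 2) / 2) * MvPolynomial.X ⟨n - 2, h⟩ else 0

/-- The `n + 1` elements `y_i ^ 2 - f`, `u ^ 2 - b₂`, `v ^ 2 - b₁`. -/
def r (i : Fin (n + 1)) : OreAlg k n := y k n i ^ 2 - coeff k n (squareValue k n i)

/-- `C` is the iterated Ore extension `k[p_1, …, p_n][y_1; τ_1, δ_1] ⋯ [v; τ, δ]` with the
prescribed automorphisms and skew derivations. -/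
structure IsIteratedOreExtension : Prop where
  coeff_injective : Function.Injective (coeff k n)
  tower_zero : (tower k n 0 : Set (OreAlg k n)) = Set.range (coeff k n)
  tower_top : tower k n (n + 1) = ⊤
  step : ∀ j : Fin (n + 1), ∃ (τ : tower k n j ≃ₐ[k] tower k n j)
    (δ : tower k n j →ₗ[k] tower k n j),
    IsOreExtension (tower k n j) (tower k n (j + 1)) (y k n j) τ δ ∧
    (∀ (s : tower k n j) f, (s : OreAlg k n) = coeff k n f → τ s = s ∧ δ s = 0) ∧
    ∀ s : tower k n j, ∀ i < j, (s : OreAlg k n) = y k n i →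
      (τ s : OreAlg k n) = oreSign n j i • y k n i ∧
      (δ s : OreAlg k n) = mk k n (oreCorrection k n j i)

end OreAlg

end

/-!
# Invariants of the alternating group on a `(-1)`-skew polynomial ring

**The algebra `C`.** The generators `y_1, …, y_{n-1}, u, v` act on a polynomial ring in `n + (n + 1)`
variables by operators made of sign-twisted multiplications: each generator acts through its image in
the skew polynomial ring, modified by an extra variable of its own (`SkewPoly.model`). The
operator of the `j`-th generator raises the degree in the `j`-th extra variable, and comparing leading
terms (`SkewPoly.model_coeff_eq_zero`) shows that the powers of each generator are independent over the
subalgebra generated by the previous ones. This is the iterated Ore extension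
(`OreAlg.isIteratedOreExtension`).

**Regularity of `C`.** In an Ore extension the injective dimension of modules grows by at most one,
because a module embeds in the coextension of its restriction with a cokernel of the same kind
(`OreData.injectiveDimensionsLE`); hence all `C`-modules have injective dimension at most `2 n + 1`.
The elements `p_i` and the squares of the generators form a central regular sequence of length `2 n + 1`
whose quotient is finite-dimensional with a one-dimensional socle. A central element of positive degree
acts on `Ext(k, -)` by zero, so dimension shifting along this sequence computes `Ext(k, C)`
(`IsGorensteinSequence.isLeftASGorenstein`). Since `C` is finite over the polynomial ring generated by the
sequence, it is noetherian and of finite Gelfand-Kirillov dimension. The right-handed statements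
follow from an isomorphism of `C` with its opposite algebra (`OreAlg.exists_antiautomorphism`).

**The regular sequence.** The elements `r i` are central and of the form `y_i ^ 2 - g` with `g` among the
coefficients, so multiplication by `r i` shifts degrees in `y_i`
(`IsOreExtension.isCentralRegularOn_succ`).

**Surjectivity.** An invariant `a` of the alternating group is a multiple of the sum of its symmetrization
and its antisymmetrization. Symmetrizations are polynomials in the power sums
(`SkewPoly.symmetrize_mem_range`); antisymmetrizations are obtained from symmetrizations by multiplication
with the product `u` of all variables and the sum `v` of the products of all but one of them
(`SkewPoly.antisymmetrize_mem_range`). All power sums lie in the image of `C`: those of even degree are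
symmetric in the central squares, and the product `u v` supplies the one of degree `2 n - 1`.

**The kernel.** Modulo the `r i`, the algebra `C` is spanned over the coefficients by products of distinct
generators. The Vandermonde matrix provides, for each power sum, a combination of the variables which
anticommutes with the other odd power sums among the generators, but not with this one (`SkewPoly.dualElement`);
with it the coefficients of a relation are shown to vanish one generator at a time
(`OreAlg.relMk_eq_zero_of_toSkewPoly`).
-/

noncomputable section

/-! ### Injective dimension in Ore extensions -/

/-- Every left module over `A` has injective dimension at most `m`. -/
def InjectiveDimensionsLE (A : Type u) [Ring A] (m : ℕ) : Prop :=
  ∀ N : ModuleCat.{u} A, HasInjectiveDimensionLE N m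

open Abelian in
theorem InjectiveDimensionsLE.hasProjectiveDimensionLE {A : Type u} [Ring A] {m : ℕ}
    (h : InjectiveDimensionsLE A m) (M : ModuleCat.{u} A) : HasProjectiveDimensionLE M m := by
  refine HasProjectiveDimensionLT.mk fun i hi Y e => ?_
  have := h Y
  exact e.eq_zero_of_hasInjectiveDimensionLT (m + 1) hi

theorem InjectiveDimensionsLE.hasFiniteGlobalDimension {A : Type u} [Ring A] {m : ℕ}
    (h : InjectiveDimensionsLE A m) : HasFiniteGlobalDimension A :=
  ⟨m, h.hasProjectiveDimensionLE⟩

section Coextension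

variable {B A : Type u} [Ring B] [Ring A] (f : B →+* A)

/-- Coextension of scalars to `A` is exact if `A` is projective over `B`. -/
theorem coextendScalars_shortExact
    (hf : Module.Projective B ((ModuleCat.restrictScalars f).obj (ModuleCat.of A A)))
    (S : ShortComplex (ModuleCat.{u} B)) (hS : S.ShortExact) :
    (S.map (ModuleCat.coextendScalars f)).ShortExact := by
  have hex := (ShortComplex.ShortExact.moduleCat_exact_iff_function_exact S).1 hS.exact
  have hinj := hS.moduleCat_injective_f
  have hsurj := hS.moduleCat_surjective_g
  apply ModuleCat.shortComplex_shortExact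
  · intro g
    constructor
    · intro hg
      let g₀ : (ModuleCat.restrictScalars f).obj (ModuleCat.of A A) →ₗ[B] S.X₂ :=
        ModuleCat.CoextendScalars.equiv f _ g
      have hg' : ∀ a, g₀ a ∈ LinearMap.range S.f.hom := fun a =>
        (hex _).1 (LinearMap.congr_fun hg a)
      let e := LinearEquiv.ofInjective S.f.hom hinj
      refine ⟨(ModuleCat.CoextendScalars.equiv f _).symm
        (e.symm.toLinearMap ∘ₗ g₀.codRestrict _ hg'), ?_⟩
      refine LinearMap.ext fun a => ?_
      have := e.apply_symm_apply (g₀.codRestrict _ hg' a)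
      exact congrArg Subtype.val this
    · rintro ⟨g', rfl⟩
      refine LinearMap.ext fun a => ?_
      exact (hex _).2 ⟨_, rfl⟩
  · intro g g' h
    refine LinearMap.ext fun a => hinj ?_
    exact LinearMap.congr_fun h a
  · intro g
    obtain ⟨g', hg'⟩ := Module.projective_lifting_property S.g.hom
      (ModuleCat.CoextendScalars.equiv f _ g) hsurj
    exact ⟨(ModuleCat.CoextendScalars.equiv f _).symm g', hg'⟩

/-- Coextension of scalars preserves injective objects, being right adjoint to an exact functor; if it is
itself exact, then it does not raise injective dimensions. -/
theorem coextendScalars_hasInjectiveDimensionLE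
    (hf : Module.Projective B ((ModuleCat.restrictScalars f).obj (ModuleCat.of A A)))
    (m : ℕ) (N : ModuleCat.{u} B) (hN : HasInjectiveDimensionLE N m) :
    HasInjectiveDimensionLE ((ModuleCat.coextendScalars f).obj N) m := by
  induction m generalizing N with
  | zero =>
    rw [HasInjectiveDimensionLE, zero_add] at hN
    have : Injective N := injective_iff_hasInjectiveDimensionLT_one.2 hN
    have := Injective.injective_of_adjoint (ModuleCat.restrictCoextendScalarsAdj.{u} f) N
    exact inferInstance
  | succ m ih =>
    let S : ShortComplex (ModuleCat.{u} B) :=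
      ShortComplex.mk (Injective.ι N) (Limits.cokernel.π (Injective.ι N))
        (Limits.cokernel.condition _)
    have hS : S.ShortExact := { exact := ShortComplex.exact_cokernel _ }
    have h₃ : HasInjectiveDimensionLT S.X₃ (m + 1) :=
      (hS.hasInjectiveDimensionLT_X₃_iff m (inferInstanceAs (Injective (Injective.under N)))).2 hN
    have h₂ : Injective (S.map (ModuleCat.coextendScalars f)).X₂ :=
      Injective.injective_of_adjoint (ModuleCat.restrictCoextendScalarsAdj.{u} f)
        (Injective.under N)
    exact ((coextendScalars_shortExact f hf S hS).hasInjectiveDimensionLT_X₃_iff m h₂).1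
      (ih S.X₃ h₃)

end Coextension

section Evaluation

variable {B A : Type u} [Ring B] [Ring A] {f : B →+* A} {M : ModuleCat.{u} A}

/-- The value at `a : A` of an element of the coextension `Hom_B(A, M)` of an `A`-module `M`. -/
def coextendScalarsEval
    (φ : (ModuleCat.coextendScalars f).obj ((ModuleCat.restrictScalars f).obj M)) (a : A) : M :=
  ModuleCat.CoextendScalars.equiv f _ φ a

theorem coextendScalarsEval_add
    (φ : (ModuleCat.coextendScalars f).obj ((ModuleCat.restrictScalars f).obj M)) (a b : A) :
    coextendScalarsEval φ (a + b) = coextendScalarsEval φ a + coextendScalarsEval φ b :=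
  map_add (ModuleCat.CoextendScalars.equiv f _ φ) a b

theorem coextendScalarsEval_smul
    (φ : (ModuleCat.coextendScalars f).obj ((ModuleCat.restrictScalars f).obj M)) (b : B) (a : A) :
    coextendScalarsEval φ (f b * a) = f b • coextendScalarsEval φ a :=
  map_smul (ModuleCat.CoextendScalars.equiv f _ φ) b
    (show (ModuleCat.restrictScalars f).obj (ModuleCat.of A A) from a)

end Evaluation

/-- The ring `A` is generated over the image of `f : B →+* A` by `y`, with
`y f(b) = f(τ b) y + f(δ b)`, and is free over `B` on the powers of `y`. -/
structure OreData {B A : Type u} [Ring B] [Ring A] (f : B →+* A) (y : A) (τ : B →+* B)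
    (δ : B → B) : Prop where
  rel : ∀ b, y * f b = f (τ b) * y + f (δ b)
  basis : ∀ a : A, ∃! c : ℕ →₀ B, a = c.sum fun i b => f b * y ^ i

namespace OreData

variable {B A : Type u} [Ring B] [Ring A] {f : B →+* A} {y : A} {τ : B →+* B} {δ : B → B}

/-- The powers of `y`, as a basis of the left `B`-module `A`. -/
def powerBasis (h : OreData f y τ δ) :
    Module.Basis ℕ B ((ModuleCat.restrictScalars f).obj (ModuleCat.of A A)) := by
  let Φ : (ℕ →₀ B) →ₗ[B] ((ModuleCat.restrictScalars f).obj (ModuleCat.of A A)) :=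
    Finsupp.linearCombination B (fun i => (y ^ i : A))
  have hΦ : ∀ c, Φ c = (c.sum fun i b => f b * y ^ i : A) := fun c => rfl
  refine ⟨(LinearEquiv.ofBijective Φ ⟨?_, ?_⟩).symm⟩
  · intro c c' hcc
    exact (h.basis (Φ c)).unique (hΦ c) (hcc.trans (hΦ c'))
  · intro a
    obtain ⟨c, hc, -⟩ := h.basis a
    exact ⟨c, hc.symm⟩

theorem powerBasis_apply (h : OreData f y τ δ) (i : ℕ) : h.powerBasis i = (y ^ i : A) := by
  let v : ℕ → (ModuleCat.restrictScalars f).obj (ModuleCat.of A A) := fun i => (y ^ i : A)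
  exact (Finsupp.linearCombination_single B (v := v) (1 : B) i).trans (one_smul B (v i))

section Sequence

variable (h : OreData f y τ δ) (M : ModuleCat.{u} A)

/-- For an `A`-module `M`, the `A`-linear map `Hom_B(A, M) → Hom_B(A, M^τ)` sending `φ` to
`a ↦ φ (y a) - y φ(a)`. Its kernel consists of the `A`-linear maps, i.e. it is a copy of `M`. -/
def twistedCommutator :
    (ModuleCat.coextendScalars f).obj ((ModuleCat.restrictScalars f).obj M) →ₗ[A]
      (ModuleCat.coextendScalars f).obj ((ModuleCat.restrictScalars τ).obj
        ((ModuleCat.restrictScalars f).obj M)) where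
  toFun φ := (ModuleCat.CoextendScalars.equiv f _).symm
    (show (ModuleCat.restrictScalars f).obj (ModuleCat.of A A) →ₗ[B]
        (ModuleCat.restrictScalars τ).obj ((ModuleCat.restrictScalars f).obj M) from
    { toFun := fun a : A => (coextendScalarsEval φ (y * a) - y • coextendScalarsEval φ a : M)
      map_add' := fun a b : A => by
        change coextendScalarsEval φ (y * (a + b)) - y • coextendScalarsEval φ (a + b) =
          (coextendScalarsEval φ (y * a) - y • coextendScalarsEval φ a) +
          (coextendScalarsEval φ (y * b) - y • coextendScalarsEval φ b)
        rw [mul_add, coextendScalarsEval_add, coextendScalarsEval_add, smul_add, add_sub_add_comm]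
      map_smul' := fun b (a : A) => by
        change coextendScalarsEval φ (y * (f b * a)) - y • coextendScalarsEval φ (f b * a) =
          f (τ b) • (coextendScalarsEval φ (y * a) - y • coextendScalarsEval φ a)
        rw [← mul_assoc, h.rel, add_mul, coextendScalarsEval_add, mul_assoc,
          coextendScalarsEval_smul, coextendScalarsEval_smul, coextendScalarsEval_smul, smul_smul,
          h.rel, add_smul, smul_sub, smul_smul]
        abel })
  map_add' φ ψ := LinearMap.ext fun a : A => by
    change (coextendScalarsEval φ (y * a) + coextendScalarsEval ψ (y * a)) -
      y • (coextendScalarsEval φ a + coextendScalarsEval ψ a) =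
      (coextendScalarsEval φ (y * a) - y • coextendScalarsEval φ a) +
      (coextendScalarsEval ψ (y * a) - y • coextendScalarsEval ψ a)
    rw [smul_add, add_sub_add_comm]
  map_smul' s φ := LinearMap.ext fun a : A => by
    change coextendScalarsEval φ (y * a * s) - y • coextendScalarsEval φ (a * s) =
      coextendScalarsEval φ (y * (a * s)) - y • coextendScalarsEval φ (a * s)
    rw [mul_assoc]

/-- A preimage may be prescribed on the basis of powers of `y`; its values there are found
recursively. -/
theorem twistedCommutator_surjective : Function.Surjective (h.twistedCommutator M) := by
  intro ψ
  let ψ₀ : A → M := fun a => ModuleCat.CoextendScalars.equiv f _ ψ a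
  let v : ℕ → M := fun i => Nat.rec 0 (fun i m => y • m + ψ₀ (y ^ i)) i
  let v' : ℕ → (ModuleCat.restrictScalars f).obj M := v
  let φ₀ : (ModuleCat.restrictScalars f).obj (ModuleCat.of A A) →ₗ[B]
    (ModuleCat.restrictScalars f).obj M := h.powerBasis.constr ℕ v'
  let φ : (ModuleCat.coextendScalars f).obj ((ModuleCat.restrictScalars f).obj M) :=
    (ModuleCat.CoextendScalars.equiv f _).symm φ₀
  have hφ : ∀ i, coextendScalarsEval φ (y ^ i : A) = v i := fun i => by
    change φ₀ (y ^ i : A) = v i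
    rw [← h.powerBasis_apply]
    exact h.powerBasis.constr_basis ℕ v' i
  refine ⟨φ, ?_⟩
  apply (ModuleCat.CoextendScalars.equiv f _).injective
  refine h.powerBasis.ext fun i => ?_
  rw [h.powerBasis_apply]
  change coextendScalarsEval φ (y * y ^ i) - y • coextendScalarsEval φ (y ^ i) = ψ₀ (y ^ i)
  rw [← pow_succ', hφ, hφ]
  change y • v i + ψ₀ (y ^ i) - y • v i = _
  abel

theorem twistedCommutator_exact :
    Function.Exact (ModuleCat.RestrictionCoextensionAdj.app' f M) (h.twistedCommutator M) := by
  intro (φ : (ModuleCat.coextendScalars f).obj ((ModuleCat.restrictScalars f).obj M))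
  constructor
  · intro hφ
    have hy : ∀ a : A, coextendScalarsEval φ (y * a) = y • coextendScalarsEval φ a := fun a =>
      sub_eq_zero.1 (LinearMap.congr_fun hφ a)
    refine ⟨coextendScalarsEval φ 1, ?_⟩
    apply (ModuleCat.CoextendScalars.equiv f _).injective
    refine h.powerBasis.ext fun i => ?_
    rw [h.powerBasis_apply]
    change (y ^ i : A) • coextendScalarsEval φ 1 = coextendScalarsEval φ (y ^ i : A)
    induction i with
    | zero => rw [pow_zero, one_smul]
    | succ i ih => rw [pow_succ', hy, ← ih, mul_smul]
  · rintro ⟨m, rfl⟩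
    refine LinearMap.ext fun a : A => ?_
    change (y * a) • m - y • a • m = 0
    rw [mul_smul, sub_self]

end Sequence

/-- The injective dimensions of modules grow by at most one in an Ore extension. -/
theorem injectiveDimensionsLE (h : OreData f y τ δ) {m : ℕ} (hB : InjectiveDimensionsLE B m) :
    InjectiveDimensionsLE A (m + 1) := by
  intro M
  have hf : Module.Projective B ((ModuleCat.restrictScalars f).obj (ModuleCat.of A A)) :=
    Module.Projective.of_basis h.powerBasis
  have hex := h.twistedCommutator_exact M
  let S : ShortComplex (ModuleCat.{u} A) :=
    ModuleCat.shortComplexOfCompEqZero (ModuleCat.RestrictionCoextensionAdj.app' f M)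
      (h.twistedCommutator M) (LinearMap.ext fun m => (hex _).2 ⟨m, rfl⟩)
  have hS : S.ShortExact := by
    refine ModuleCat.shortComplex_shortExact S hex ?_ (h.twistedCommutator_surjective M)
    intro m m' hmm
    have : (1 : A) • m = (1 : A) • m' := LinearMap.congr_fun hmm (1 : A)
    rwa [one_smul, one_smul] at this
  refine hS.hasInjectiveDimensionLT_X₁ (m + 1) ?_ ?_
  · exact coextendScalars_hasInjectiveDimensionLE f hf m _ (hB _)
  · have : HasInjectiveDimensionLT S.X₂ (m + 1) :=
      coextendScalars_hasInjectiveDimensionLE f hf m _ (hB ((ModuleCat.restrictScalars f).obj M))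
    exact hasInjectiveDimensionLT_of_ge S.X₂ (m + 1) _ (by omega)

end OreData

/-- Over a field every module is injective. -/
theorem InjectiveDimensionsLE.of_field (k : Type u) [Field k] : InjectiveDimensionsLE k 0 := by
  intro N
  have : Module.Injective k N := Module.injective_of_isSemisimpleRing k N
  have : Injective N := Module.injective_object_of_injective_module k N
  exact inferInstanceAs (HasInjectiveDimensionLT N 1)

theorem InjectiveDimensionsLE.of_ringEquiv {B A : Type u} [Ring B] [Ring A] (e : B ≃+* A) {m : ℕ}
    (h : InjectiveDimensionsLE B m) : InjectiveDimensionsLE A m := by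
  intro M
  let f : B →+* A := e
  have hf : Module.Projective B ((ModuleCat.restrictScalars f).obj (ModuleCat.of A A)) := by
    have e' : B ≃ₗ[B] (ModuleCat.restrictScalars f).obj (ModuleCat.of A A) :=
      { toFun := fun b => (f b : A)
        invFun := fun a : A => e.symm a
        left_inv := fun b => e.symm_apply_apply b
        right_inv := fun a => e.apply_symm_apply a
        map_add' := map_add f
        map_smul' := map_mul f }
    exact Module.Projective.of_equiv e'
  have := coextendScalars_hasInjectiveDimensionLE f hf m _
    (h ((ModuleCat.restrictScalars f).obj M))
  have hbij : Function.Bijective (ModuleCat.RestrictionCoextensionAdj.app' f M) := by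
    constructor
    · intro m m' hmm
      have : (1 : A) • m = (1 : A) • m' := LinearMap.congr_fun hmm (1 : A)
      rwa [one_smul, one_smul] at this
    · intro (φ : (ModuleCat.coextendScalars f).obj ((ModuleCat.restrictScalars f).obj M))
      refine ⟨coextendScalarsEval φ 1, LinearMap.ext fun a : A => ?_⟩
      have := coextendScalarsEval_smul φ (e.symm a) (1 : A)
      change coextendScalarsEval φ (e (e.symm a) * 1) = e (e.symm a) • coextendScalarsEval φ 1
        at this
      rw [e.apply_symm_apply, mul_one] at this
      exact this.symm
  let i : M ≅ (ModuleCat.coextendScalars f).obj ((ModuleCat.restrictScalars f).obj M) :=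
    LinearEquiv.toModuleIso (LinearEquiv.ofBijective
      (ModuleCat.RestrictionCoextensionAdj.app' f M) hbij)
  exact hasInjectiveDimensionLT_of_iso i.symm (m + 1)

/-! ### Ext groups along a central regular sequence -/

section CentralAction

variable {A : Type u} [Ring A]

/-- Multiplication by a central element, as an endomorphism of a module. -/
def centralSMul (z : A) (hz : ∀ a, a * z = z * a) (M : ModuleCat.{u} A) : M ⟶ M :=
  ModuleCat.ofHom
    { toFun := fun m => z • m
      map_add' := smul_add z
      map_smul' := fun a m => by
        rw [RingHom.id_apply, smul_smul, smul_smul, hz] }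

open Abelian in
/-- A central element acts in the same way on `Ext M N` through either argument. -/
theorem ext_comp_centralSMul (z : A) (hz : ∀ a, a * z = z * a) (i : ℕ) (M N : ModuleCat.{u} A)
    (x : Ext.{u} M N i) :
    x.comp (Ext.mk₀ (centralSMul z hz N)) (add_zero i) =
      (Ext.mk₀ (centralSMul z hz M)).comp x (zero_add i) := by
  induction i generalizing M with
  | zero =>
    obtain ⟨g, rfl⟩ := (Ext.mk₀_bijective M N).2 x
    rw [Ext.mk₀_comp_mk₀, Ext.mk₀_comp_mk₀]
    congr 1
    ext m
    exact (map_smul g.hom z m).symm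
  | succ i ih =>
    let ⟨p⟩ := EnoughProjectives.presentation M
    let S : ShortComplex (ModuleCat.{u} A) := ShortComplex.mk _ _ (Limits.kernel.condition p.f)
    have hS : S.ShortExact := { exact := ShortComplex.exact_kernel p.f }
    obtain ⟨y, rfl⟩ := Ext.contravariant_sequence_exact₃ hS N x
      (Ext.eq_zero_of_projective _) (add_comm 1 i)
    let φ : S ⟶ S :=
      { τ₁ := centralSMul z hz _
        τ₂ := centralSMul z hz _
        τ₃ := centralSMul z hz _
        comm₁₂ := by ext m; exact map_smul S.f.hom z m
        comm₂₃ := by ext m; exact map_smul S.g.hom z m }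
    have h := hS.extClass_naturality hS φ
    rw [Ext.comp_assoc_of_third_deg_zero, ih]
    rw [← Ext.comp_assoc_of_second_deg_zero]
    erw [h]
    rw [Ext.comp_assoc]
    omega

end CentralAction

section SequenceIdeal

variable {A : Type u} [Ring A]

/-- The left ideal generated by the first `j` terms of the sequence `z`. -/
def seqIdeal (z : ℕ → A) : ℕ → Ideal A
  | 0 => ⊥
  | j + 1 => seqIdeal z j ⊔ Ideal.span {z j}

theorem mem_seqIdeal_succ {z : ℕ → A} {j : ℕ} {a : A} :
    a ∈ seqIdeal z (j + 1) ↔ ∃ c, a - c * z j ∈ seqIdeal z j := by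
  rw [seqIdeal, Submodule.mem_sup]
  constructor
  · rintro ⟨b, hb, c, hc, rfl⟩
    obtain ⟨c, rfl⟩ := Ideal.mem_span_singleton'.1 hc
    exact ⟨c, by rwa [add_sub_cancel_right]⟩
  · rintro ⟨c, hc⟩
    exact ⟨_, hc, c * z j, Ideal.mem_span_singleton'.2 ⟨c, rfl⟩, sub_add_cancel _ _⟩

theorem seqIdeal_mul_mem {z : ℕ → A} {j : ℕ} (hz : ∀ i < j, ∀ a, a * z i = z i * a) {a : A}
    (ha : a ∈ seqIdeal z j) (b : A) : a * b ∈ seqIdeal z j := by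
  induction j generalizing a with
  | zero =>
    rw [seqIdeal, Submodule.mem_bot] at ha
    rw [ha, zero_mul]
    exact zero_mem _
  | succ j ih =>
    obtain ⟨c, hc⟩ := mem_seqIdeal_succ.1 ha
    refine mem_seqIdeal_succ.2 ⟨c * b, ?_⟩
    have := ih (fun i hi => hz i (by omega)) hc
    rwa [sub_mul, mul_assoc, ← hz j (by omega), ← mul_assoc] at this

/-- Right multiplication by `a` on the quotient by a two-sided ideal. -/
def quotRightMul (I : Ideal A) (hI : ∀ x ∈ I, ∀ a, x * a ∈ I) (a : A) :
    ModuleCat.of A (A ⧸ I) ⟶ ModuleCat.of A (A ⧸ I) :=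
  ModuleCat.ofHom (I.mapQ I (LinearMap.toSpanSingleton A A a) fun x hx => hI x hx a)

/-- A sequence of central elements `z 0, …, z (d - 1)` of `A` is regular, lies in the
augmentation ideal, and has a quotient whose left socle is one-dimensional, spanned by `top`. -/
structure IsGorensteinSequence (k : Type u) [Field k] [Algebra k A] (𝒜 : ℕ → Submodule k A)
    (z : ℕ → A) (d : ℕ) (top : A) : Prop where
  central : ∀ i < d, ∀ a, a * z i = z i * a
  mem_positivePart : ∀ i < d, z i ∈ positivePart k 𝒜
  regular : ∀ i < d, ∀ a, z i * a ∈ seqIdeal z i → a ∈ seqIdeal z i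
  top_notMem : top ∉ seqIdeal z d
  mul_top : ∀ i, 0 < i → ∀ a ∈ 𝒜 i, a * top ∈ seqIdeal z d
  top_mul : ∀ i, 0 < i → ∀ a ∈ 𝒜 i, top * a ∈ seqIdeal z d
  socle : ∀ s, (∀ i, 0 < i → ∀ a ∈ 𝒜 i, a * s ∈ seqIdeal z d) →
    ∃ c : k, s - c • top ∈ seqIdeal z d

end SequenceIdeal

namespace IsGorensteinSequence

open Abelian

variable {k : Type u} [Field k] {A : Type u} [Ring A] [Algebra k A] {𝒜 : ℕ → Submodule k A}
  {z : ℕ → A} {d : ℕ} {top : A} (h : IsGorensteinSequence k 𝒜 z d top)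

include h

theorem mul_mem {j : ℕ} (hj : j ≤ d) : ∀ x ∈ seqIdeal z j, ∀ a, x * a ∈ seqIdeal z j :=
  fun _ hx a => seqIdeal_mul_mem (fun i hi => h.central i (by omega)) hx a

/-- The short exact sequence `0 → A/I_j → A/I_j → A/I_{j+1} → 0` given by multiplication
with `z j`. -/
abbrev shortComplex {j : ℕ} (hj : j < d) : ShortComplex (ModuleCat.{u} A) :=
  ModuleCat.shortComplexOfCompEqZero
    ((seqIdeal z j).mapQ (seqIdeal z j) (LinearMap.toSpanSingleton A A (z j))
      fun x hx => h.mul_mem hj.le x hx (z j))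
    ((seqIdeal z j).mapQ (seqIdeal z (j + 1)) LinearMap.id le_sup_left)
    (by
      ext
      change Submodule.Quotient.mk _ = 0
      rw [Submodule.Quotient.mk_eq_zero]
      exact mem_seqIdeal_succ.2 ⟨1, by simp⟩)

theorem shortComplex_shortExact {j : ℕ} (hj : j < d) : (h.shortComplex hj).ShortExact := by
  refine ModuleCat.shortComplex_shortExact _ ?_ ?_ ?_
  · intro q
    obtain ⟨a, rfl⟩ := Submodule.Quotient.mk_surjective _ q
    change Submodule.Quotient.mk a = 0 ↔ _
    rw [Submodule.Quotient.mk_eq_zero, mem_seqIdeal_succ]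
    constructor
    · rintro ⟨c, hc⟩
      refine ⟨Submodule.Quotient.mk c, ?_⟩
      change Submodule.Quotient.mk (c * z j) = Submodule.Quotient.mk a
      rw [eq_comm, Submodule.Quotient.eq]
      exact hc
    · rintro ⟨q, hq⟩
      obtain ⟨c, rfl⟩ := Submodule.Quotient.mk_surjective _ q
      change Submodule.Quotient.mk (c * z j) = Submodule.Quotient.mk a at hq
      rw [eq_comm, Submodule.Quotient.eq] at hq
      exact ⟨c, hq⟩
  · refine (injective_iff_map_eq_zero
      ((seqIdeal z j).mapQ (seqIdeal z j) (LinearMap.toSpanSingleton A A (z j))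
      fun x hx => h.mul_mem hj.le x hx (z j))).2 ?_
    intro q hq
    obtain ⟨a, rfl⟩ := Submodule.Quotient.mk_surjective _ q
    change Submodule.Quotient.mk (a * z j) = 0 at hq
    rw [Submodule.Quotient.mk_eq_zero, h.central j hj] at hq
    rw [Submodule.Quotient.mk_eq_zero]
    exact h.regular j hj a hq
  · intro q
    obtain ⟨a, rfl⟩ := Submodule.Quotient.mk_surjective _ q
    exact ⟨Submodule.Quotient.mk a, rfl⟩

theorem centralSMul_trivialModule {j : ℕ} (hj : j < d) :
    centralSMul (z j) (h.central j hj) (trivialModule k 𝒜) = 0 := by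
  ext
  change Submodule.Quotient.mk (z j * 1) = 0
  rw [Submodule.Quotient.mk_eq_zero, mul_one]
  exact h.mem_positivePart j hj

theorem shortComplex_f {j : ℕ} (hj : j < d) :
    (h.shortComplex hj).f = centralSMul (z j) (h.central j hj) _ := by
  ext
  change (Submodule.Quotient.mk (1 * z j) : A ⧸ seqIdeal z j) =
    Submodule.Quotient.mk (z j * 1)
  rw [one_mul, mul_one]

/-- Multiplication by a central element of the augmentation ideal is zero on `Ext(k, -)`. -/
theorem comp_shortComplex_f {j : ℕ} (hj : j < d) {i : ℕ}
    (x : Ext.{u} (trivialModule k 𝒜) (h.shortComplex hj).X₁ i) :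
    x.comp (Ext.mk₀ (h.shortComplex hj).f) (add_zero i) = 0 := by
  rw [shortComplex_f]
  have := ext_comp_centralSMul (z j) (h.central j hj) i _ _ x
  rw [h.centralSMul_trivialModule hj, Ext.mk₀_zero, Ext.zero_comp] at this
  exact this

/-- `Ext^i(k, A/I_j) = 0` for `i < d - j`: in the long exact sequence of multiplication by `z j`, this
multiplication is zero on `Ext(k, -)`. -/
theorem subsingleton_ext_quotient (i j : ℕ) (hij : i + j < d) :
    Subsingleton (Ext.{u} (trivialModule k 𝒜) (ModuleCat.of A (A ⧸ seqIdeal z j)) i) := by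
  induction i generalizing j with
  | zero =>
    have hj : j < d := by omega
    suffices ∀ g : trivialModule k 𝒜 ⟶ ModuleCat.of A (A ⧸ seqIdeal z j), g = 0 by
      refine ⟨fun x y => ?_⟩
      obtain ⟨g, rfl⟩ := (Ext.mk₀_bijective _ _).2 x
      obtain ⟨g', rfl⟩ := (Ext.mk₀_bijective _ _).2 y
      rw [this g, this g']
    intro g
    obtain ⟨a, ha⟩ := Submodule.Quotient.mk_surjective _ (g.hom (Submodule.Quotient.mk 1))
    have h0 : z j • g.hom (Submodule.Quotient.mk 1) = 0 := by
      rw [← map_smul]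
      have : z j • (Submodule.Quotient.mk 1 : A ⧸ positivePart k 𝒜) = 0 := by
        change Submodule.Quotient.mk (z j * 1) = 0
        rw [Submodule.Quotient.mk_eq_zero, mul_one]
        exact h.mem_positivePart j hj
      erw [this]
      exact map_zero _
    rw [← ha] at h0
    change Submodule.Quotient.mk (z j * a) = 0 at h0
    rw [Submodule.Quotient.mk_eq_zero] at h0
    have h1 := h.regular j hj a h0
    rw [← Submodule.Quotient.mk_eq_zero, ha] at h1
    ext
    exact h1
  | succ i ih =>
    have hj : j < d := by omega
    refine ⟨fun x y => ?_⟩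
    have hS := h.shortComplex_shortExact hj
    have key : ∀ x : Ext.{u} (trivialModule k 𝒜) (ModuleCat.of A (A ⧸ seqIdeal z j)) (i + 1),
        x = 0 := by
      intro x
      obtain ⟨x₃, rfl⟩ := Ext.covariant_sequence_exact₁ _ hS x
        (h.comp_shortComplex_f hj x) rfl
      have := ih (j + 1) (by omega)
      have h0 : x₃ = 0 := this.elim _ _
      rw [h0]
      exact Ext.zero_comp (β := hS.extClass) ..
    rw [key x, key y]

/-- Right multiplication on the quotients `A/I_j`, as a map of short exact sequences. -/
def rightMulHom {j : ℕ} (hj : j < d) (a : A) : h.shortComplex hj ⟶ h.shortComplex hj where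
  τ₁ := quotRightMul (seqIdeal z j) (h.mul_mem hj.le) a
  τ₂ := quotRightMul (seqIdeal z j) (h.mul_mem hj.le) a
  τ₃ := quotRightMul (seqIdeal z (j + 1)) (h.mul_mem hj) a
  comm₁₂ := by
    ext
    change (Submodule.Quotient.mk (1 * a * z j) : A ⧸ seqIdeal z j) =
      Submodule.Quotient.mk (1 * z j * a)
    rw [mul_assoc, h.central j hj, mul_assoc]
  comm₂₃ := by
    ext
    exact rfl

/-- The isomorphism `Hom(k, A/I_d) ≅ k`, given by the socle of `A/I_d`. -/
theorem exists_homEquiv :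
    ∃ e : (trivialModule k 𝒜 ⟶ ModuleCat.of A (A ⧸ seqIdeal z d)) ≃+ k,
      (∀ x (c : k), e (x ≫ quotRightMul _ (h.mul_mem le_rfl) (algebraMap k A c)) = e x * c) ∧
      ∀ x (i : ℕ) (a : A), 0 < i → a ∈ 𝒜 i →
        e (x ≫ quotRightMul _ (h.mul_mem le_rfl) a) = 0 := by
  have hI : ∀ (c : k) x, x ∈ seqIdeal z d → c • x ∈ seqIdeal z d := fun c x hx => by
    rw [Algebra.smul_def]; exact Ideal.mul_mem_left _ _ hx
  have hle : ∀ c : k, positivePart k 𝒜 ≤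
      Submodule.comap (LinearMap.toSpanSingleton A A (c • top)) (seqIdeal z d) := by
    intro c
    refine Ideal.span_le.2 ?_
    rintro a ⟨i, hi, ha⟩
    change a * (c • top) ∈ seqIdeal z d
    rw [mul_smul_comm]
    exact hI c _ (h.mul_top i hi a ha)
  let F : k →+ (trivialModule k 𝒜 ⟶ ModuleCat.of A (A ⧸ seqIdeal z d)) :=
    AddMonoidHom.mk' (fun c => ModuleCat.ofHom ((positivePart k 𝒜).mapQ (seqIdeal z d)
      (LinearMap.toSpanSingleton A A (c • top)) (hle c))) fun c c' => by
        rw [← ModuleCat.ofHom_add]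
        congr 1
        ext
        change (Submodule.Quotient.mk (1 * ((c + c') • top)) : A ⧸ seqIdeal z d) =
          Submodule.Quotient.mk (1 * (c • top)) + Submodule.Quotient.mk (1 * (c' • top))
        rw [← Submodule.Quotient.mk_add, add_smul, mul_add]
  have hF : ∀ c, (F c).hom (Submodule.Quotient.mk 1) = Submodule.Quotient.mk (c • top) := by
    intro c
    change Submodule.Quotient.mk (1 * (c • top)) = _
    rw [one_mul]
  have hext : ∀ g g' : trivialModule k 𝒜 ⟶ ModuleCat.of A (A ⧸ seqIdeal z d),
      g.hom (Submodule.Quotient.mk 1) = g'.hom (Submodule.Quotient.mk 1) → g = g' := by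
    intro g g' hgg
    ext
    exact hgg
  have hbij : Function.Bijective F := by
    constructor
    · refine (injective_iff_map_eq_zero F).2 fun c hc => ?_
      by_contra hne
      apply h.top_notMem
      have := hF c
      rw [hc] at this
      change 0 = _ at this
      rw [eq_comm, Submodule.Quotient.mk_eq_zero] at this
      have := hI c⁻¹ _ this
      rwa [smul_smul, inv_mul_cancel₀ hne, one_smul] at this
    · intro g
      obtain ⟨s, hs⟩ := Submodule.Quotient.mk_surjective _ (g.hom (Submodule.Quotient.mk 1))
      obtain ⟨c, hc⟩ := h.socle s (by
        intro i hi a ha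
        have h0 : a • g.hom (Submodule.Quotient.mk 1) = 0 := by
          rw [← map_smul]
          have : a • (Submodule.Quotient.mk 1 : A ⧸ positivePart k 𝒜) = 0 := by
            change Submodule.Quotient.mk (a * 1) = 0
            rw [Submodule.Quotient.mk_eq_zero, mul_one]
            exact Ideal.subset_span ⟨i, hi, ha⟩
          erw [this]
          exact map_zero _
        rw [← hs] at h0
        change Submodule.Quotient.mk (a * s) = 0 at h0
        rwa [Submodule.Quotient.mk_eq_zero] at h0)
      refine ⟨c, hext _ _ ?_⟩
      rw [hF, ← hs, eq_comm, Submodule.Quotient.eq]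
      exact hc
  let e := AddEquiv.ofBijective F hbij
  refine ⟨e.symm, ?_, ?_⟩
  · intro x c
    obtain ⟨b, rfl⟩ := e.surjective x
    rw [e.symm_apply_apply, e.symm_apply_eq]
    refine hext _ _ ?_
    have h1 : (e (b * c)).hom (Submodule.Quotient.mk 1) = Submodule.Quotient.mk ((b * c) • top) :=
      hF _
    rw [h1]
    change Submodule.Quotient.mk (1 * (b • top) * algebraMap k A c) = _
    rw [one_mul, ← Algebra.commutes, ← Algebra.smul_def, smul_smul, mul_comm]
  · intro x i a hi ha
    obtain ⟨b, rfl⟩ := e.surjective x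
    rw [e.symm_apply_eq, map_zero]
    refine hext _ _ ?_
    change Submodule.Quotient.mk (1 * (b • top) * a) = 0
    rw [one_mul, smul_mul_assoc, Submodule.Quotient.mk_eq_zero]
    exact hI b _ (h.top_mul i hi a ha)

/-- `Ext^i(k, A/I_{d-i}) ≅ k`, by dimension shifting from `Hom(k, A/I_d)`. -/
theorem exists_extEquiv_quotient (i j : ℕ) (hij : i + j = d) :
    ∃ e : Ext.{u} (trivialModule k 𝒜) (ModuleCat.of A (A ⧸ seqIdeal z j)) i ≃+ k,
      (∀ x (c : k), e (x.comp (Ext.mk₀ (quotRightMul _ (h.mul_mem (by omega))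
        (algebraMap k A c))) (add_zero i)) = e x * c) ∧
      ∀ (x : Ext.{u} (trivialModule k 𝒜) (ModuleCat.of A (A ⧸ seqIdeal z j)) i) (l : ℕ) (a : A),
        0 < l → a ∈ 𝒜 l →
        e (x.comp (Ext.mk₀ (quotRightMul _ (h.mul_mem (by omega)) a)) (add_zero i)) = 0 := by
  induction i generalizing j with
  | zero =>
    obtain rfl : j = d := by omega
    obtain ⟨e, he, he'⟩ := h.exists_homEquiv
    have hsymm : ∀ g : trivialModule k 𝒜 ⟶ ModuleCat.of A (A ⧸ seqIdeal z j),
        Ext.addEquiv₀ (Ext.mk₀ g) = g := fun g => Ext.addEquiv₀.apply_symm_apply g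
    refine ⟨Ext.addEquiv₀.trans e, ?_, ?_⟩
    · intro x c
      obtain ⟨g, rfl⟩ := (Ext.mk₀_bijective _ _).2 x
      rw [Ext.mk₀_comp_mk₀, AddEquiv.trans_apply, AddEquiv.trans_apply, hsymm, hsymm, he]
    · intro x l a hl ha
      obtain ⟨g, rfl⟩ := (Ext.mk₀_bijective _ _).2 x
      rw [Ext.mk₀_comp_mk₀, AddEquiv.trans_apply, hsymm, he' _ _ _ hl ha]
  | succ i ih =>
    have hj : j < d := by omega
    obtain ⟨e, he, he'⟩ := ih (j + 1) (by omega)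
    have hS := h.shortComplex_shortExact hj
    let Δ : Ext.{u} (trivialModule k 𝒜) (ModuleCat.of A (A ⧸ seqIdeal z (j + 1))) i →+
        Ext.{u} (trivialModule k 𝒜) (ModuleCat.of A (A ⧸ seqIdeal z j)) (i + 1) :=
      hS.extClass.postcomp (trivialModule k 𝒜) rfl
    have hΔ : ∀ x, Δ x = x.comp hS.extClass rfl := fun x => rfl
    have hbij : Function.Bijective Δ := by
      constructor
      · refine (injective_iff_map_eq_zero Δ).2 fun x hx => ?_
        obtain ⟨x₂, rfl⟩ := Ext.covariant_sequence_exact₃ _ hS x rfl hx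
        have h0 : x₂ = 0 := (h.subsingleton_ext_quotient i j (by omega)).elim _ _
        rw [h0]
        exact Ext.zero_comp (β := Ext.mk₀ (h.shortComplex hj).g) ..
      · intro x
        exact Ext.covariant_sequence_exact₁ _ hS x (h.comp_shortComplex_f hj x) rfl
    have hnat : ∀ x a, (Δ x).comp (Ext.mk₀ (quotRightMul _ (h.mul_mem hj.le) a)) (add_zero _) =
        Δ (x.comp (Ext.mk₀ (quotRightMul _ (h.mul_mem (j := j + 1) (by omega)) a))
          (add_zero i)) := by
      intro x a
      have := hS.extClass_naturality hS (h.rightMulHom hj a)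
      rw [hΔ, hΔ, Ext.comp_assoc_of_third_deg_zero, Ext.comp_assoc_of_second_deg_zero]
      exact congrArg (fun t => x.comp t rfl) this
    let E := AddEquiv.ofBijective Δ hbij
    refine ⟨E.symm.trans e, ?_, ?_⟩
    · intro x c
      obtain ⟨x, rfl⟩ := E.surjective x
      rw [AddEquiv.trans_apply, AddEquiv.trans_apply, E.symm_apply_apply, ← he]
      congr 1
      rw [E.symm_apply_eq]
      exact hnat _ _
    · intro x l a hl ha
      obtain ⟨x, rfl⟩ := E.surjective x
      rw [AddEquiv.trans_apply, ← he' x l a hl ha]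
      congr 1
      rw [E.symm_apply_eq]
      exact hnat _ _

/-- A central regular sequence of length `d` whose quotient has a one-dimensional socle makes the
algebra Artin-Schelter Gorenstein of dimension `d`, once modules have injective dimension at most
`d`. -/
theorem isLeftASGorenstein (hd : InjectiveDimensionsLE A d) : IsLeftASGorenstein k 𝒜 d := by
  let ι : ModuleCat.of A (A ⧸ seqIdeal z 0) ≅ ModuleCat.of A A :=
    (Submodule.quotEquivOfEqBot (seqIdeal z 0) rfl).toModuleIso
  let act (a : A) : ModuleCat.of A A ⟶ ModuleCat.of A A :=
    ModuleCat.ofHom (LinearMap.toSpanSingleton A A a)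
  have hact : ∀ a, act a ≫ ι.inv = ι.inv ≫ quotRightMul _ (h.mul_mem (Nat.zero_le d)) a := by
    intro a
    ext
    exact rfl
  have hinv : ∀ {i : ℕ} (x : Ext.{u} (trivialModule k 𝒜) (ModuleCat.of A A) i),
      (x.comp (Ext.mk₀ ι.inv) (add_zero i)).comp (Ext.mk₀ ι.hom) (add_zero i) = x := by
    intro i x
    rw [Ext.comp_assoc_of_second_deg_zero, Ext.mk₀_comp_mk₀, ι.inv_hom_id, Ext.comp_mk₀_id]
  have hhom : ∀ {i : ℕ} (x : Ext.{u} (trivialModule k 𝒜) (ModuleCat.of A (A ⧸ seqIdeal z 0)) i),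
      (x.comp (Ext.mk₀ ι.hom) (add_zero i)).comp (Ext.mk₀ ι.inv) (add_zero i) = x := by
    intro i x
    rw [Ext.comp_assoc_of_second_deg_zero, Ext.mk₀_comp_mk₀, ι.hom_inv_id, Ext.comp_mk₀_id]
  obtain ⟨e, he, he'⟩ := h.exists_extEquiv_quotient d 0 (add_zero d)
  let E : Ext.{u} (trivialModule k 𝒜) (ModuleCat.of A A) d ≃+
      Ext.{u} (trivialModule k 𝒜) (ModuleCat.of A (A ⧸ seqIdeal z 0)) d :=
    { toFun := fun x => x.comp (Ext.mk₀ ι.inv) (add_zero d)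
      invFun := fun x => x.comp (Ext.mk₀ ι.hom) (add_zero d)
      left_inv := hinv
      right_inv := hhom
      map_add' := fun x y => Ext.add_comp _ _ _ _ }
  have hE : ∀ x a, E (ExtTrivial.act k x a) =
      (E x).comp (Ext.mk₀ (quotRightMul _ (h.mul_mem (Nat.zero_le d)) a)) (add_zero d) := by
    intro x a
    change (x.comp (Ext.mk₀ (act a)) (add_zero d)).comp (Ext.mk₀ ι.inv) (add_zero d) =
      (x.comp (Ext.mk₀ ι.inv) (add_zero d)).comp _ (add_zero d)
    rw [Ext.comp_assoc_of_second_deg_zero, Ext.comp_assoc_of_second_deg_zero, Ext.mk₀_comp_mk₀,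
      Ext.mk₀_comp_mk₀, hact]
  have hLE : HasInjectiveDimensionLT (ModuleCat.of A A) (d + 1) := hd _
  refine ⟨le_antisymm ?_ ?_, ?_, E.trans e, ?_, ?_⟩
  · exact (injectiveDimension_le_iff _ _).2 hLE
  · rw [injectiveDimension_ge_iff]
    intro hLT
    have hs := HasInjectiveDimensionLT.subsingleton (ModuleCat.of A A) d d le_rfl
      (trivialModule k 𝒜)
    have hk : Subsingleton k := (E.trans e).symm.toEquiv.subsingleton
    exact not_subsingleton k hk
  · intro i hi
    rcases lt_or_gt_of_ne hi with hlt | hgt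
    · have hs := h.subsingleton_ext_quotient i 0 (by omega)
      refine ⟨fun x y => ?_⟩
      rw [← hinv x, ← hinv y, hs.elim (x.comp (Ext.mk₀ ι.inv) (add_zero i))
        (y.comp (Ext.mk₀ ι.inv) (add_zero i))]
    · exact HasInjectiveDimensionLT.subsingleton (ModuleCat.of A A) (d + 1) i hgt _
  · intro x c
    rw [AddEquiv.trans_apply, AddEquiv.trans_apply, hE, he]
  · intro x i a hi ha
    rw [AddEquiv.trans_apply, hE, he' _ _ _ hi ha]

end IsGorensteinSequence

/-! ### Algebras finite over a central polynomial ring -/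

section FiniteOverCentre

theorem isTwoSidedNoetherian_of_finite (Z A : Type u) [CommRing Z] [IsNoetherianRing Z] [Ring A]
    [Algebra Z A] [Module.Finite Z A] : IsTwoSidedNoetherian A := by
  have h : IsNoetherian Z A := isNoetherian_of_isNoetherianRing_of_finite Z A
  have h' : IsNoetherian Z Aᵐᵒᵖ := isNoetherian_of_linearEquiv (MulOpposite.opLinearEquiv Z)
  exact ⟨isNoetherian_of_tower Z h, isNoetherian_of_tower Z h'⟩

variable {k : Type u} [Field k] {A : Type u} [Ring A] [Algebra k A] {σ : Type} [Fintype σ]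
  [Algebra (MvPolynomial σ k) A] [IsScalarTower k (MvPolynomial σ k) A]

/-- The span of the products of a generator `e l` with a monomial all of whose exponents are at
most `N`. -/
def boxSpan {q : ℕ} (e : Fin q → A) (N : ℕ) : Submodule k A :=
  Submodule.span k {a | ∃ (s : σ →₀ ℕ) (l : Fin q), (∀ i, s i ≤ N) ∧
    a = MvPolynomial.monomial s (1 : k) • e l}

omit [Fintype σ] [IsScalarTower k (MvPolynomial σ k) A] in
theorem boxSpan_mono {q : ℕ} (e : Fin q → A) :
    Monotone (boxSpan (k := k) (σ := σ) e) := by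
  intro N M h
  refine Submodule.span_mono ?_
  rintro _ ⟨s, l, hs, rfl⟩
  exact ⟨s, l, fun i => (hs i).trans h, rfl⟩

omit [Fintype σ] in
theorem monomial_smul_mem_boxSpan {q : ℕ} {e : Fin q → A} {N M : ℕ} {s : σ →₀ ℕ}
    (hs : ∀ i, s i ≤ M) {a : A} (ha : a ∈ boxSpan (k := k) (σ := σ) e N) :
    MvPolynomial.monomial s (1 : k) • a ∈ boxSpan (k := k) (σ := σ) e (M + N) := by
  induction ha using Submodule.span_induction with
  | mem x hx =>
    obtain ⟨t, l, ht, rfl⟩ := hx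
    refine Submodule.subset_span ⟨s + t, l, fun i => add_le_add (hs i) (ht i), ?_⟩
    rw [smul_smul, MvPolynomial.monomial_mul, one_mul]
  | zero => rw [smul_zero]; exact zero_mem _
  | add x y _ _ hx hy => rw [smul_add]; exact add_mem hx hy
  | smul c x _ hx => rw [smul_comm]; exact Submodule.smul_mem _ _ hx

theorem exists_mem_boxSpan {q : ℕ} {e : Fin q → A}
    (he : Submodule.span (MvPolynomial σ k) (Set.range e) = ⊤) (a : A) :
    ∃ N, a ∈ boxSpan (k := k) (σ := σ) e N := by
  have hadd : ∀ {x y : A}, (∃ N, x ∈ boxSpan (k := k) (σ := σ) e N) →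
      (∃ N, y ∈ boxSpan (k := k) (σ := σ) e N) → ∃ N, x + y ∈ boxSpan (k := k) (σ := σ) e N := by
    rintro x y ⟨N, hN⟩ ⟨M, hM⟩
    exact ⟨max N M, add_mem (boxSpan_mono e (le_max_left _ _) hN)
      (boxSpan_mono e (le_max_right _ _) hM)⟩
  have ha : a ∈ Submodule.span (MvPolynomial σ k) (Set.range e) := he ▸ Submodule.mem_top
  induction ha using Submodule.span_induction with
  | mem x hx =>
    obtain ⟨l, rfl⟩ := hx
    refine ⟨0, Submodule.subset_span ⟨0, l, fun i => le_rfl, ?_⟩⟩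
    exact (one_smul _ _).symm
  | zero => exact ⟨0, zero_mem _⟩
  | add x y _ _ hx hy => exact hadd hx hy
  | smul z x _ hx =>
    induction z using MvPolynomial.induction_on' with
    | monomial s c =>
      obtain ⟨N, hN⟩ := hx
      obtain ⟨M, hM⟩ : ∃ M, ∀ i, s i ≤ M :=
        ⟨∑ i, s i, fun i => Finset.single_le_sum (fun _ _ => Nat.zero_le _) (Finset.mem_univ i)⟩
      refine ⟨M + N, ?_⟩
      have : MvPolynomial.monomial s c = c • MvPolynomial.monomial s (1 : k) := by
        rw [MvPolynomial.smul_monomial, smul_eq_mul, mul_one]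
      rw [this, smul_assoc]
      exact Submodule.smul_mem _ _ (monomial_smul_mem_boxSpan hM hN)
    | add p p' hp hp' => rw [add_smul]; exact hadd hp hp'

/-- The bounds on exponents add up under multiplication, except for a constant that depends only on
the products of the generators. -/
theorem exists_boxSpan_mul_le {q : ℕ} {e : Fin q → A}
    (he : Submodule.span (MvPolynomial σ k) (Set.range e) = ⊤) :
    ∃ D, ∀ N M, boxSpan (k := k) (σ := σ) e N * boxSpan (k := k) (σ := σ) e M ≤
      boxSpan (k := k) (σ := σ) e (N + M + D) := by
  choose d hd using fun p : Fin q × Fin q => exists_mem_boxSpan (k := k) he (e p.1 * e p.2)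
  refine ⟨∑ p, d p, fun N M => ?_⟩
  rw [boxSpan, boxSpan, Submodule.span_mul_span]
  refine Submodule.span_le.2 ?_
  rintro _ ⟨_, ⟨s, l, hs, rfl⟩, _, ⟨t, l', ht, rfl⟩, rfl⟩
  have h1 : e l * e l' ∈ boxSpan (k := k) (σ := σ) e (∑ p, d p) :=
    boxSpan_mono e (Finset.single_le_sum (f := d) (fun _ _ => Nat.zero_le _)
      (Finset.mem_univ (l, l'))) (hd (l, l'))
  have h2 := monomial_smul_mem_boxSpan (s := s + t) (M := N + M)
    (fun i => add_le_add (hs i) (ht i)) h1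
  have h3 : MvPolynomial.monomial s (1 : k) • e l * MvPolynomial.monomial t (1 : k) • e l' =
      MvPolynomial.monomial (s + t) (1 : k) • (e l * e l') := by
    rw [smul_mul_smul_comm, MvPolynomial.monomial_mul, one_mul]
  change MvPolynomial.monomial s (1 : k) • e l * MvPolynomial.monomial t (1 : k) • e l' ∈ _
  rw [h3]
  exact h2

omit [IsScalarTower k (MvPolynomial σ k) A] in
theorem finrank_boxSpan_le {q : ℕ} (e : Fin q → A) (N : ℕ) :
    FiniteDimensional k (boxSpan (k := k) (σ := σ) e N) ∧
    Module.finrank k (boxSpan (k := k) (σ := σ) e N) ≤ q * (N + 1) ^ Fintype.card σ := by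
  classical
  let S : Finset A := (Finset.univ : Finset (Fin q × (σ → Fin (N + 1)))).image fun p =>
    MvPolynomial.monomial (Finsupp.equivFunOnFinite.symm fun i => (p.2 i : ℕ)) (1 : k) • e p.1
  have hS : boxSpan (k := k) (σ := σ) e N = Submodule.span k (S : Set A) := by
    apply le_antisymm
    · refine Submodule.span_mono ?_
      rintro _ ⟨s, l, hs, rfl⟩
      refine Finset.mem_coe.2 (Finset.mem_image.2
        ⟨(l, fun i => ⟨s i, Nat.lt_succ_of_le (hs i)⟩), Finset.mem_univ _, ?_⟩)
      congr 3
      exact Finsupp.equivFunOnFinite_symm_coe s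
    · refine Submodule.span_mono ?_
      intro a ha
      obtain ⟨p, -, rfl⟩ := Finset.mem_image.1 (Finset.mem_coe.1 ha)
      exact ⟨_, p.1, fun i => Nat.le_of_lt_succ (p.2 i).2, rfl⟩
  rw [hS]
  refine ⟨FiniteDimensional.span_finset k S, (finrank_span_finset_le_card S).trans ?_⟩
  refine Finset.card_image_le.trans ?_
  rw [Finset.card_univ, Fintype.card_prod, Fintype.card_fin, Fintype.card_fun, Fintype.card_fin]

variable (k A σ) in
/-- An algebra which is a finite module over a central polynomial ring has finite
Gelfand-Kirillov dimension. -/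
theorem gelfandKirillovDim_ne_top_of_finite [Module.Finite (MvPolynomial σ k) A] :
    gelfandKirillovDim k A ≠ ⊤ := by
  obtain ⟨q, e, he⟩ := Module.Finite.exists_fin (R := MvPolynomial σ k) (M := A)
  obtain ⟨D, hD⟩ := exists_boxSpan_mul_le (k := k) he
  set s := Fintype.card σ
  suffices gelfandKirillovDim k A ≤ ENNReal.ofReal (s + 1) from
    ne_top_of_le_ne_top ENNReal.ofReal_ne_top this
  refine iSup₂_le fun V hV => iSup_le fun _ => ?_
  obtain ⟨N, hN, hN1⟩ : ∃ N, V ≤ boxSpan (k := k) (σ := σ) e N ∧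
      (1 : A) ∈ boxSpan (k := k) (σ := σ) e N := by
    obtain ⟨S, rfl⟩ := hV
    choose d hd using fun a : A => exists_mem_boxSpan (k := k) he a
    refine ⟨(∑ a ∈ S, d a) + d 1, Submodule.span_le.2 fun a ha => ?_, ?_⟩
    · exact boxSpan_mono e ((Finset.single_le_sum (f := d) (fun _ _ => Nat.zero_le _)
        (Finset.mem_coe.1 ha)).trans (Nat.le_add_right _ _)) (hd a)
    · exact boxSpan_mono e (Nat.le_add_left _ _) (hd 1)
  have hpow : ∀ m, V ^ m ≤ boxSpan (k := k) (σ := σ) e (N + m * (N + D)) := by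
    intro m
    induction m with
    | zero =>
      rw [pow_zero, zero_mul, add_zero, Submodule.one_le]
      exact hN1
    | succ m ih =>
      rw [pow_succ]
      refine (mul_le_mul' ih hN).trans ((hD _ _).trans (boxSpan_mono e (le_of_eq ?_)))
      ring
  have hfin : ∀ m, 1 ≤ m → Module.finrank k ↥(V ^ m) ≤ q * (2 * N + D + 1) ^ s * m ^ s := by
    intro m hm
    obtain ⟨hfd, hle⟩ := finrank_boxSpan_le (k := k) (σ := σ) e (N + m * (N + D))
    refine (Submodule.finrank_mono (hpow m)).trans (hle.trans ?_)
    rw [mul_assoc, ← mul_pow]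
    gcongr
    nlinarith
  refine Filter.limsup_le_of_le (h := ?_)
  filter_upwards [Filter.eventually_ge_atTop (q * (2 * N + D + 1) ^ s + 2)] with m hm
  refine ENNReal.ofReal_le_ofReal ?_
  have hlog : 0 < Real.log m := Real.log_pos (by exact_mod_cast (by omega : 1 < m))
  rw [div_le_iff₀ hlog]
  rcases Nat.eq_zero_or_pos (Module.finrank k ↥(V ^ m)) with h0 | h0
  · rw [h0, Nat.cast_zero, Real.log_zero]
    positivity
  · have h1 : (Module.finrank k ↥(V ^ m) : ℝ) ≤ (m : ℝ) ^ (s + 1) := by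
      have : Module.finrank k ↥(V ^ m) ≤ m ^ (s + 1) := by
        refine (hfin m (by omega)).trans ?_
        rw [pow_succ']
        gcongr
        omega
      exact_mod_cast this
    refine (Real.log_le_log (by exact_mod_cast h0) h1).trans (le_of_eq ?_)
    rw [Real.log_pow]
    push_cast
    ring

end FiniteOverCentre

/-! ### Gradings and coactions -/

section Coaction

variable {k : Type u} [Field k] {A : Type u} [Ring A] [Algebra k A]

open Polynomial in
/-- A family of subspaces spanning `A` is a grading as soon as there is a map `A → A[t]` which
multiplies the elements of the `d`-th subspace by `t ^ d`. -/
theorem isInternal_of_coaction (𝒜 : ℕ → Submodule k A) (ρ : A →+ A[X])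
    (hρ : ∀ d, ∀ a ∈ 𝒜 d, ρ a = monomial d a) (htop : ∀ a, a ∈ iSup 𝒜) :
    DirectSum.IsInternal 𝒜 := by
  have key : ∀ x : DirectSum ℕ fun d => 𝒜 d, ∀ d,
      (ρ (DirectSum.coeAddMonoidHom 𝒜 x)).coeff d = x d := by
    intro x d
    induction x using DirectSum.induction_on with
    | zero => simp
    | of i a =>
      rw [DirectSum.coeAddMonoidHom_of, hρ i a a.2, coeff_monomial, DirectSum.coe_of_apply]
      split_ifs <;> rfl
    | add x y hx hy => rw [map_add, map_add, coeff_add, hx, hy]; rfl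
  constructor
  · refine (injective_iff_map_eq_zero _).2 fun x hx => ?_
    ext d
    rw [← key x d, hx, map_zero]
    rfl
  · intro a
    change a ∈ AddMonoidHom.mrange (DirectSum.coeAddMonoidHom 𝒜)
    induction htop a using Submodule.iSup_induction' with
    | mem i x hx => exact ⟨DirectSum.of (fun d => 𝒜 d) i ⟨x, hx⟩, DirectSum.coeAddMonoidHom_of _ _ _⟩
    | zero => exact zero_mem _
    | add x y _ _ hx hy => exact add_mem hx hy

end Coaction

/-! ### Central regular sequences in Ore extensions -/

section SubalgebraIdeal

variable {k : Type u} [Field k] {C : Type u} [Ring C] [Algebra k C]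

/-- For central elements `z 0, z 1, …` of `C`, the subspace `z 0 T + ⋯ + z (m - 1) T`. -/
def subalgebraIdeal (T : Subalgebra k C) (z : ℕ → C) : ℕ → Submodule k C
  | 0 => ⊥
  | m + 1 => subalgebraIdeal T z m ⊔ (Subalgebra.toSubmodule T).map (LinearMap.mulLeft k (z m))

theorem mem_subalgebraIdeal_succ {T : Subalgebra k C} {z : ℕ → C} {m : ℕ} {a : C} :
    a ∈ subalgebraIdeal T z (m + 1) ↔ ∃ t ∈ T, a - z m * t ∈ subalgebraIdeal T z m := by
  rw [subalgebraIdeal, Submodule.mem_sup]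
  constructor
  · rintro ⟨b, hb, _, ⟨t, ht, rfl⟩, rfl⟩
    exact ⟨t, ht, by rwa [LinearMap.mulLeft_apply, add_sub_cancel_right]⟩
  · rintro ⟨t, ht, h⟩
    exact ⟨_, h, z m * t, ⟨t, ht, rfl⟩, sub_add_cancel _ _⟩

theorem subalgebraIdeal_mono_right (T : Subalgebra k C) (z : ℕ → C) :
    Monotone (subalgebraIdeal T z) :=
  monotone_nat_of_le_succ fun _ => le_sup_left

theorem subalgebraIdeal_mono_left {S T : Subalgebra k C} (h : S ≤ T) (z : ℕ → C) (m : ℕ) :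
    subalgebraIdeal S z m ≤ subalgebraIdeal T z m := by
  induction m with
  | zero => exact le_rfl
  | succ m ih => exact sup_le_sup ih (Submodule.map_mono h)

theorem mul_mem_subalgebraIdeal {T : Subalgebra k C} {z : ℕ → C} {m : ℕ} {i : ℕ} (hi : i < m)
    {t : C} (ht : t ∈ T) : z i * t ∈ subalgebraIdeal T z m :=
  subalgebraIdeal_mono_right T z (Nat.succ_le_of_lt hi)
    (mem_subalgebraIdeal_succ.2 ⟨t, ht, by rw [sub_self]; exact zero_mem _⟩)

theorem subalgebraIdeal_mul_mem {T : Subalgebra k C} {z : ℕ → C} {m : ℕ} {a : C}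
    (ha : a ∈ subalgebraIdeal T z m) {t : C} (ht : t ∈ T) : a * t ∈ subalgebraIdeal T z m := by
  induction m generalizing a with
  | zero =>
    rw [subalgebraIdeal, Submodule.mem_bot] at ha ⊢
    rw [ha, zero_mul]
  | succ m ih =>
    obtain ⟨b, hb, h⟩ := mem_subalgebraIdeal_succ.1 ha
    refine mem_subalgebraIdeal_succ.2 ⟨b * t, mul_mem hb ht, ?_⟩
    rw [← mul_assoc, ← sub_mul]
    exact ih h

theorem mul_subalgebraIdeal_mem {T : Subalgebra k C} {z : ℕ → C} {m : ℕ}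
    (hz : ∀ i < m, ∀ a, a * z i = z i * a) {a : C}
    (ha : a ∈ subalgebraIdeal T z m) {t : C} (ht : t ∈ T) : t * a ∈ subalgebraIdeal T z m := by
  induction m generalizing a with
  | zero =>
    rw [subalgebraIdeal, Submodule.mem_bot] at ha ⊢
    rw [ha, mul_zero]
  | succ m ih =>
    obtain ⟨b, hb, h⟩ := mem_subalgebraIdeal_succ.1 ha
    refine mem_subalgebraIdeal_succ.2 ⟨t * b, mul_mem ht hb, ?_⟩
    rw [← mul_assoc, ← hz m (by omega), mul_assoc, ← mul_sub]
    exact ih (fun i hi => hz i (by omega)) h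

/-- The central elements `z 0, …, z (m - 1)` form a regular sequence on `T`. -/
def IsCentralRegularOn (T : Subalgebra k C) (z : ℕ → C) (m : ℕ) : Prop :=
  ∀ i < m, ∀ t ∈ T, z i * t ∈ subalgebraIdeal T z i → t ∈ subalgebraIdeal T z i

end SubalgebraIdeal

namespace IsOreExtension

variable {k : Type u} [Field k] {C : Type u} [Ring C] [Algebra k C]

/-- The element `∑ s_i y ^ i` with coefficients `s_i` in `S`. -/
def evalPowers (S : Subalgebra k C) (y : C) : (ℕ →₀ S) →+ C :=
  Finsupp.liftAddHom fun i => (AddMonoidHom.mulRight (y ^ i)).comp S.val.toRingHom.toAddMonoidHom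

theorem evalPowers_eq (S : Subalgebra k C) (y : C) (f : ℕ →₀ S) :
    evalPowers S y f = f.sum fun i s => (s : C) * y ^ i := rfl

theorem evalPowers_single (S : Subalgebra k C) (y : C) (i : ℕ) (s : S) :
    evalPowers S y (Finsupp.single i s) = s * y ^ i := by
  rw [evalPowers_eq, Finsupp.sum_single_index]
  rw [ZeroMemClass.coe_zero, zero_mul]

theorem evalPowers_smul (S : Subalgebra k C) (y : C) (s : S) (f : ℕ →₀ S) :
    evalPowers S y (s • f) = s * evalPowers S y f := by
  induction f using Finsupp.induction_linear with
  | zero => simp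
  | add f g hf hg => rw [smul_add, map_add, map_add, hf, hg, mul_add]
  | single i a =>
    rw [Finsupp.smul_single, evalPowers_single, evalPowers_single, ← mul_assoc]
    rfl

theorem evalPowers_shift (S : Subalgebra k C) (y : C) (d : ℕ) (f : ℕ →₀ S) :
    evalPowers S y (f.mapDomain (· + d)) = evalPowers S y f * y ^ d := by
  induction f using Finsupp.induction_linear with
  | zero => simp
  | add f g hf hg => rw [Finsupp.mapDomain_add, map_add, map_add, hf, hg, add_mul]
  | single i a =>
    rw [Finsupp.mapDomain_single, evalPowers_single, evalPowers_single, pow_add, mul_assoc]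

variable {S T : Subalgebra k C} {y : C} {τ : S ≃ₐ[k] S} {δ : S →ₗ[k] S}

theorem exists_evalPowers (h : IsOreExtension S T y τ δ) {t : C} (ht : t ∈ T) :
    ∃ f, t = evalPowers S y f := by
  obtain ⟨f, hf, -⟩ := h.basis t ht
  exact ⟨f, hf⟩

theorem evalPowers_mem (h : IsOreExtension S T y τ δ) (f : ℕ →₀ S) : evalPowers S y f ∈ T :=
  sum_mem fun i _ => mul_mem (h.le (f i).2) (pow_mem h.mem i)

theorem evalPowers_injective (h : IsOreExtension S T y τ δ) :
    Function.Injective (evalPowers S y) := fun f _ hfg =>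
  (h.basis _ (h.evalPowers_mem f)).unique rfl hfg

theorem evalPowers_mem_subalgebraIdeal (h : IsOreExtension S T y τ δ) {z : ℕ → C} {m : ℕ}
    (hS : ∀ i < m, z i ∈ S) (f : ℕ →₀ S) :
    evalPowers S y f ∈ subalgebraIdeal T z m ↔ ∀ i, (f i : C) ∈ subalgebraIdeal S z m := by
  constructor
  · induction m generalizing f with
    | zero =>
      intro hf i
      rw [subalgebraIdeal, Submodule.mem_bot] at hf ⊢
      rw [h.evalPowers_injective (hf.trans (map_zero _).symm)]
      rfl
    | succ m ih =>
      intro hf i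
      obtain ⟨t, ht, hft⟩ := mem_subalgebraIdeal_succ.1 hf
      obtain ⟨g, rfl⟩ := h.exists_evalPowers ht
      refine mem_subalgebraIdeal_succ.2 ⟨g i, (g i).2, ?_⟩
      have := evalPowers_smul S y ⟨z m, hS m (by omega)⟩ g
      rw [← this, ← map_sub] at hft
      exact ih (fun i hi => hS i (by omega)) _ hft i
  · intro hf
    exact sum_mem fun i _ => subalgebraIdeal_mul_mem (subalgebraIdeal_mono_left h.le z m (hf i))
      (pow_mem h.mem i)

theorem isCentralRegularOn (h : IsOreExtension S T y τ δ) {z : ℕ → C} {m : ℕ}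
    (hS : ∀ i < m, z i ∈ S) (hreg : IsCentralRegularOn S z m) : IsCentralRegularOn T z m := by
  intro i hi t ht hzt
  obtain ⟨f, rfl⟩ := h.exists_evalPowers ht
  have hS' : ∀ j < i, z j ∈ S := fun j hj => hS j (by omega)
  rw [h.evalPowers_mem_subalgebraIdeal hS']
  intro l
  have := evalPowers_smul S y ⟨z i, hS i hi⟩ f
  rw [← this, h.evalPowers_mem_subalgebraIdeal hS'] at hzt
  exact hreg i hi _ (f l).2 (hzt l)

theorem shift_apply (f : ℕ →₀ S) (l : ℕ) : f.mapDomain (· + 2) (l + 2) = f l :=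
  Finsupp.mapDomain_apply (add_left_injective 2) f l

theorem shift_apply_of_lt (f : ℕ →₀ S) {l : ℕ} (hl : l < 2) : f.mapDomain (· + 2) l = 0 :=
  Finsupp.mapDomain_of_notMem_range f l (by rintro ⟨i, hi⟩; change i + 2 = l at hi; omega)

/-- A regular sequence on `S` can be continued on `T = S[y; τ, δ]` by a central element of the
form `y² - g`: multiplication by it raises the degree in `y`. -/
theorem isCentralRegularOn_succ (h : IsOreExtension S T y τ δ) {z : ℕ → C} {m : ℕ} {g : C}
    (hS : ∀ i < m, z i ∈ S) (hreg : IsCentralRegularOn S z m) (hg : g ∈ S)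
    (hgc : ∀ a, a * g = g * a) (hz : ∀ i < m + 1, ∀ a, a * z i = z i * a)
    (hzm : z m = y ^ 2 - g) : IsCentralRegularOn T z (m + 1) := by
  intro i hi t ht hzt
  rcases Nat.lt_succ_iff_lt_or_eq.1 hi with hlt | rfl
  · exact h.isCentralRegularOn hS hreg i hlt t ht hzt
  obtain ⟨f, rfl⟩ := h.exists_evalPowers ht
  rw [← hz i (by omega), hzm, mul_sub, hgc, ← evalPowers_shift, ← evalPowers_smul S y ⟨g, hg⟩,
    ← map_sub, h.evalPowers_mem_subalgebraIdeal hS] at hzt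
  rw [h.evalPowers_mem_subalgebraIdeal hS]
  -- Descending induction on the degree, from the vanishing of the coefficients of large degree.
  obtain ⟨N, hN⟩ : ∃ N, ∀ l, N ≤ l → f l = 0 := by
    refine ⟨f.support.sup id + 1, fun l hl => Finsupp.notMem_support_iff.1 fun hmem => ?_⟩
    have := Finset.le_sup (f := id) hmem
    simp only [id] at this
    omega
  suffices ∀ j l, N ≤ l + j → (f l : C) ∈ subalgebraIdeal S z i from
    fun l => this N l (by omega)
  intro j
  induction j with
  | zero => intro l hl; rw [hN l (by omega)]; exact zero_mem _
  | succ j ih =>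
    intro l hl
    have h1 := hzt (l + 2)
    rw [Finsupp.sub_apply, shift_apply] at h1
    have h2 : (g * (f (l + 2) : C)) ∈ subalgebraIdeal S z i :=
      mul_subalgebraIdeal_mem (fun i hi => hz i (by omega)) (ih (l + 2) (by omega)) hg
    have h3 := add_mem h1 h2
    change ((f l : C) - g * (f (l + 2) : C)) + g * (f (l + 2) : C) ∈ _ at h3
    rwa [sub_add_cancel] at h3

/-- Modulo the ideal generated by `z 0, …, z (m - 1)` and `y²`, the elements `1, y` are a basis
of `T = S[y; τ, δ]` over `S`. -/
theorem mem_of_add_mul_mem (h : IsOreExtension S T y τ δ) {z : ℕ → C} {m : ℕ}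
    (hS : ∀ i < m, z i ∈ S) (hz : ∀ i < m + 1, ∀ a, a * z i = z i * a) (hzm : z m = y ^ 2)
    {s₀ s₁ : C} (h₀ : s₀ ∈ S) (h₁ : s₁ ∈ S)
    (hs : s₀ + s₁ * y ∈ subalgebraIdeal T z (m + 1)) :
    s₀ ∈ subalgebraIdeal S z m ∧ s₁ ∈ subalgebraIdeal S z m := by
  obtain ⟨t, ht, hst⟩ := mem_subalgebraIdeal_succ.1 hs
  obtain ⟨f, rfl⟩ := h.exists_evalPowers ht
  have e : s₀ + s₁ * y = evalPowers S y
      (Finsupp.single 0 ⟨s₀, h₀⟩ + Finsupp.single 1 ⟨s₁, h₁⟩) := by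
    rw [map_add, evalPowers_single, evalPowers_single, pow_zero, pow_one, mul_one]
  rw [← hz m (by omega), hzm, ← evalPowers_shift, e, ← map_sub,
    h.evalPowers_mem_subalgebraIdeal hS] at hst
  have h0 := hst 0
  have h1 := hst 1
  rw [Finsupp.sub_apply, shift_apply_of_lt f (by omega), sub_zero, Finsupp.add_apply] at h0 h1
  simpa using And.intro h0 h1

end IsOreExtension

theorem mem_subalgebraIdeal_top_iff {k : Type u} [Field k] {C : Type u} [Ring C] [Algebra k C]
    {z : ℕ → C} {m : ℕ} (hz : ∀ i < m, ∀ a, a * z i = z i * a) {a : C} :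
    a ∈ subalgebraIdeal (⊤ : Subalgebra k C) z m ↔ a ∈ seqIdeal z m := by
  induction m generalizing a with
  | zero => rfl
  | succ m ih =>
    rw [mem_subalgebraIdeal_succ, mem_seqIdeal_succ]
    simp only [Algebra.mem_top, true_and, hz m (Nat.lt_succ_self m),
      ih fun i hi => hz i (Nat.lt_succ_of_lt hi)]

section Coaction

variable {k : Type u} [Field k] {A : Type u} [Ring A] [Algebra k A]

open Polynomial in
theorem mem_of_coaction_eq (𝒜 : ℕ → Submodule k A) (ρ : A →+ A[X])
    (hρ : ∀ d, ∀ a ∈ 𝒜 d, ρ a = monomial d a) (htop : ∀ a, a ∈ iSup 𝒜) {d : ℕ} {a : A}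
    (ha : ρ a = monomial d a) : a ∈ 𝒜 d := by
  have key : ∀ b, b ∈ iSup 𝒜 → (ρ b).coeff d ∈ 𝒜 d := by
    intro b hb
    induction hb using Submodule.iSup_induction' with
    | mem i x hx =>
      rw [hρ i x hx, coeff_monomial]
      split_ifs with h
      · exact h ▸ hx
      · exact zero_mem _
    | zero => rw [map_zero]; exact zero_mem _
    | add x y _ _ hx hy => rw [map_add, coeff_add]; exact add_mem hx hy
  have := key a (htop a)
  rwa [ha, coeff_monomial_same] at this

theorem mul_mem_iSup (𝒜 : ℕ → Submodule k A) [SetLike.GradedMonoid 𝒜] {a b : A}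
    (ha : a ∈ iSup 𝒜) (hb : b ∈ iSup 𝒜) : a * b ∈ iSup 𝒜 := by
  induction ha using Submodule.iSup_induction' with
  | mem i x hx =>
    induction hb using Submodule.iSup_induction' with
    | mem j y hy => exact Submodule.mem_iSup_of_mem (i + j) (SetLike.mul_mem_graded hx hy)
    | zero => rw [mul_zero]; exact zero_mem _
    | add y z _ _ hy hz => rw [mul_add]; exact add_mem hy hz
  | zero => rw [zero_mul]; exact zero_mem _
  | add x y _ _ hx hy => rw [add_mul]; exact add_mem hx hy

end Coaction

/-! ### Power sums and elementary symmetric polynomials -/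

section PowerSums

open MvPolynomial

variable (k : Type u) [Field k] (n : ℕ)

/-- The map `k[p_1, …, p_n] → k[t_1, …, t_n]` sending `p_i` to the `i`-th elementary symmetric
polynomial. -/
def esymmMap : MvPolynomial (Fin n) k →ₐ[k] MvPolynomial (Fin n) k :=
  (symmetricSubalgebra (Fin n) k).val.comp
    (esymmAlgEquiv (Fin n) k (Fintype.card_fin n)).toAlgHom

theorem esymmMap_injective : Function.Injective (esymmMap k n) :=
  Subtype.val_injective.comp (esymmAlgEquiv (Fin n) k (Fintype.card_fin n)).injective

theorem esymmMap_X (i : Fin n) : esymmMap k n (X i) = esymm (Fin n) k (i + 1) := by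
  change ((esymmAlgEquiv (Fin n) k (Fintype.card_fin n)) (X i) : MvPolynomial (Fin n) k) = _
  change ((esymmAlgHom (Fin n) k n (X i)) : MvPolynomial (Fin n) k) = _
  simp [esymmAlgHom]

theorem esymmMap_powerSumPoly (m : ℕ) : esymmMap k n (powerSumPoly k n m) = psum (Fin n) k m := by
  change ((esymmAlgEquiv (Fin n) k (Fintype.card_fin n)) (powerSumPoly k n m) :
    MvPolynomial (Fin n) k) = _
  rw [powerSumPoly, AlgEquiv.apply_symm_apply]

theorem constantCoeff_powerSumPoly {m : ℕ} (hm : 0 < m) :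
    constantCoeff (powerSumPoly k n m) = 0 := by
  have h : ∀ f, constantCoeff (esymmMap k n f) = constantCoeff f := by
    intro f
    have : (constantCoeff.comp (esymmMap k n).toRingHom) = constantCoeff (σ := Fin n) (R := k) := by
      ext i
      · simp
      · simp only [RingHom.comp_apply]
        change constantCoeff (esymmMap k n (X i)) = constantCoeff (X i)
        rw [esymmMap_X, constantCoeff_X, esymm, map_sum]
        refine Finset.sum_eq_zero fun s hs => ?_
        rw [map_prod]
        have hs' := (Finset.mem_powersetCard.1 hs).2
        obtain ⟨j, hj⟩ : s.Nonempty := Finset.card_pos.1 (by omega)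
        exact Finset.prod_eq_zero hj (constantCoeff_X k j)
    exact RingHom.congr_fun this f
  rw [← h, esymmMap_powerSumPoly, psum, map_sum]
  refine Finset.sum_eq_zero fun i _ => ?_
  rw [map_pow, constantCoeff_X, zero_pow hm.ne']

/-- The coaction `p_i ↦ p_i t ^ (2 i)` describing the grading of `k[p_1, …, p_n]`. -/
def weightCoaction : MvPolynomial (Fin n) k →ₐ[k] Polynomial (MvPolynomial (Fin n) k) :=
  aeval fun i => Polynomial.monomial (2 * ((i : ℕ) + 1)) (X i)

theorem weightCoaction_X (i : Fin n) :
    weightCoaction k n (X i) = Polynomial.monomial (2 * ((i : ℕ) + 1)) (X i) :=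
  aeval_X _ _

theorem prod_polynomial_monomial {R ι : Type*} [CommSemiring R] (s : Finset ι) (d : ℕ)
    (a : ι → R) : ∏ i ∈ s, Polynomial.monomial d (a i) =
      Polynomial.monomial (s.card * d) (∏ i ∈ s, a i) := by
  classical
  induction s using Finset.induction_on with
  | empty => simp
  | insert i s hi ih =>
    rw [Finset.prod_insert hi, Finset.prod_insert hi, ih, Polynomial.monomial_mul_monomial,
      Finset.card_insert_of_notMem hi, add_mul, one_mul, add_comm d]

theorem weightCoaction_powerSumPoly (m : ℕ) :
    weightCoaction k n (powerSumPoly k n m) = Polynomial.monomial (2 * m) (powerSumPoly k n m) := by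
  let ω : MvPolynomial (Fin n) k →ₐ[k] Polynomial (MvPolynomial (Fin n) k) :=
    aeval fun i => Polynomial.monomial 2 (X i)
  have hω : ∀ i, ω (X i) = Polynomial.monomial 2 (X i) := fun i => aeval_X _ _
  let E := Polynomial.mapAlgHom (esymmMap k n)
  have hE : ∀ d f, E (Polynomial.monomial d f) = Polynomial.monomial d (esymmMap k n f) :=
    fun d f => Polynomial.map_monomial _
  have hcomm : E.comp (weightCoaction k n) = ω.comp (esymmMap k n) := by
    ext i : 1
    rw [AlgHom.comp_apply, AlgHom.comp_apply, weightCoaction_X, hE, esymmMap_X, esymm, map_sum,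
      map_sum]
    refine Finset.sum_congr rfl fun s hs => ?_
    rw [map_prod ω, Finset.prod_congr rfl fun i _ => hω i, prod_polynomial_monomial,
      (Finset.mem_powersetCard.1 hs).2, mul_comm]
  have hinj : Function.Injective E :=
    Polynomial.map_injective _ (esymmMap_injective k n)
  apply hinj
  rw [hE, esymmMap_powerSumPoly, ← AlgHom.comp_apply, hcomm, AlgHom.comp_apply,
    esymmMap_powerSumPoly, psum, map_sum, map_sum]
  refine Finset.sum_congr rfl fun i _ => ?_
  rw [map_pow, hω, Polynomial.monomial_pow, mul_comm]

end PowerSums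

/-! ### The universal property of `C` -/

namespace OreAlg

open MvPolynomial

variable (k : Type u) [Field k] (n : ℕ)

theorem algebraMap_eq (c : k) : algebraMap k (OreAlg k n) c = coeff k n (C c) := rfl

/-- The structure map as a homomorphism of `k`-algebras. -/
def coeffAlgHom : MvPolynomial (Fin n) k →ₐ[k] OreAlg k n :=
  { coeff k n with commutes' := fun _ => rfl }

theorem coeff_commutes (f : MvPolynomial (Fin n) k) (c : OreAlg k n) :
    coeff k n f * c = c * coeff k n f :=
  Algebra.commutes f c

theorem mk_surjective : Function.Surjective (mk k n) := RingQuot.mkAlgHom_surjective _ _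

theorem mk_algebraMap (f : MvPolynomial (Fin n) k) : mk k n (algebraMap _ _ f) = coeff k n f :=
  (mk k n).commutes f

variable {k n} in
@[elab_as_elim]
theorem induction {P : OreAlg k n → Prop} (hc : ∀ f, P (coeff k n f)) (hy : ∀ i, P (y k n i))
    (hmul : ∀ a b, P a → P b → P (a * b)) (hadd : ∀ a b, P a → P b → P (a + b))
    (c : OreAlg k n) : P c := by
  obtain ⟨a, rfl⟩ := mk_surjective k n c
  induction a using FreeAlgebra.induction with
  | grade0 f => rw [mk_algebraMap]; exact hc f
  | grade1 i => exact hy i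
  | mul a b ha hb => rw [map_mul]; exact hmul _ _ ha hb
  | add a b ha hb => rw [map_add]; exact hadd _ _ ha hb

variable {k n}

theorem y_mul_y {i j : Fin (n + 1)} (h : i < j) :
    y k n j * y k n i = oreSign n j i • (y k n i * y k n j) + mk k n (oreCorrection k n j i) := by
  have := RingQuot.mkAlgHom_rel (MvPolynomial (Fin n) k) (OreRel.swap (k := k) i j h)
  rw [map_mul, map_add, map_zsmul, map_mul] at this
  exact this

theorem mk_oreCorrection (i j : Fin (n + 1)) :
    mk k n (oreCorrection k n j i) =
      if (j : ℕ) + 1 < n then coeff k n (2 * powerSumPoly k n (i + j + 1))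
      else if (j : ℕ) = n ∧ (i : ℕ) + 1 < n then
        coeff k n (2 * powerSumPoly k n i) * y k n ⟨n - 1, by omega⟩
      else 0 := by
  rw [oreCorrection]
  split_ifs
  · rw [mk_algebraMap]
  · rw [map_mul, mk_algebraMap]; rfl
  · rw [map_zero]

theorem algHom_ext {D : Type*} [Ring D] [Algebra k D] {F F' : OreAlg k n →ₐ[k] D}
    (hc : ∀ f, F (coeff k n f) = F' (coeff k n f)) (hy : ∀ i, F (y k n i) = F' (y k n i)) :
    F = F' := by
  ext c
  induction c using OreAlg.induction with
  | hc f => exact hc f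
  | hy i => exact hy i
  | hmul a b ha hb => rw [map_mul, map_mul, ha, hb]
  | hadd a b ha hb => rw [map_add, map_add, ha, hb]

/-- The universal property of `C`. The coefficients need not map to central elements: it is enough
that they commute with the images of the generators. -/
theorem exists_lift {D : Type u} [Ring D] [Algebra k D] (c : MvPolynomial (Fin n) k →ₐ[k] D)
    (Y : Fin (n + 1) → D) (hcY : ∀ f i, c f * Y i = Y i * c f)
    (hrel : ∀ i j : Fin (n + 1), i < j → Y j * Y i = oreSign n j i • (Y i * Y j) +
      if (j : ℕ) + 1 < n then c (2 * powerSumPoly k n (i + j + 1))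
      else if (j : ℕ) = n ∧ (i : ℕ) + 1 < n then
        c (2 * powerSumPoly k n i) * Y ⟨n - 1, by omega⟩
      else 0) :
    ∃ F : OreAlg k n →ₐ[k] D, (∀ f, F (coeff k n f) = c f) ∧ ∀ i, F (y k n i) = Y i := by
  let S : Subalgebra k D := Subalgebra.centralizer k (Set.range c)
  let c' : MvPolynomial (Fin n) k →+* S := (c.codRestrict S fun f => by
    rintro _ ⟨g, rfl⟩
    rw [← map_mul, ← map_mul, mul_comm]).toRingHom
  let Y' : Fin (n + 1) → S := fun i => ⟨Y i, by
    rintro _ ⟨g, rfl⟩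
    exact hcY g i⟩
  let _ : Algebra (MvPolynomial (Fin n) k) S := c'.toAlgebra' fun f s => by
    ext
    exact s.2 _ ⟨f, rfl⟩
  have hc' : ∀ f, (algebraMap (MvPolynomial (Fin n) k) S f : D) = c f := fun f => rfl
  let G : FreeAlgebra (MvPolynomial (Fin n) k) (Fin (n + 1)) →ₐ[MvPolynomial (Fin n) k] S :=
    FreeAlgebra.lift _ Y'
  have hG : ∀ i, G (FreeAlgebra.ι _ i) = Y' i := fun i => FreeAlgebra.lift_ι_apply _ _
  let F : OreAlg k n →ₐ[MvPolynomial (Fin n) k] S :=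
    RingQuot.liftAlgHom (MvPolynomial (Fin n) k) ⟨G, by
      rintro _ _ ⟨i, j, h⟩
      rw [map_mul, map_add, map_zsmul, map_mul, hG, hG]
      ext
      refine (hrel i j h).trans ?_
      rw [oreCorrection]
      change _ = oreSign n j i • (Y i * Y j) + _
      congr 1
      split_ifs
      · rw [AlgHom.commutes, hc']
      · rw [map_mul G, AlgHom.commutes, hG]
        rfl
      · rw [map_zero]; rfl⟩
  have hFc : ∀ f, F (coeff k n f) = algebraMap (MvPolynomial (Fin n) k) S f := F.commutes
  refine ⟨S.val.comp { F.toRingHom with commutes' := fun r => ?_ }, fun f => ?_, fun i => ?_⟩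
  · ext
    change (F (coeff k n (C r)) : D) = _
    rw [hFc, hc']
    exact c.commutes r
  · change (F (coeff k n f) : D) = _
    rw [hFc, hc']
  · have : F (y k n i) = Y' i :=
      (RingQuot.liftAlgHom_mkAlgHom_apply _ _ _ _).trans (hG i)
    change (F (y k n i) : D) = _
    rw [this]

end OreAlg

/-! ### Central elements of `C` -/

namespace OreAlg

open MvPolynomial

variable {k : Type u} [Field k] {n : ℕ}

theorem oreSign_mul_self (n j i : ℕ) : oreSign n j i * oreSign n j i = 1 := by
  unfold oreSign
  split_ifs <;> simp [← mul_pow]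

theorem oreSign_smul_smul {M : Type*} [AddCommGroup M] (j i : ℕ) (a : M) :
    oreSign n j i • oreSign n j i • a = a := by
  rw [smul_smul, oreSign_mul_self, one_smul]

theorem neg_one_pow_smul_smul {M : Type*} [AddCommGroup M] (m : ℕ) (a : M) :
    (-1 : ℤ) ^ m • (-1 : ℤ) ^ m • a = a := by
  rw [smul_smul, ← mul_pow]
  simp

/-- `u y_i = ± y_i u`. -/
theorem u_mul_y {i : Fin (n + 1)} (hi : (i : ℕ) + 1 < n) :
    y k n ⟨n - 1, by omega⟩ * y k n i =
      (-1 : ℤ) ^ (n - 1) • (y k n i * y k n ⟨n - 1, by omega⟩) := by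
  rw [y_mul_y (show i < ⟨n - 1, by omega⟩ from Fin.lt_def.2 (by simp; omega)), mk_oreCorrection,
    if_neg (by simp; omega), if_neg (by simp; omega), add_zero]
  congr 1
  unfold oreSign
  rw [if_neg (by simp; omega), if_pos (by simp; omega)]

/-- `v u = ± u v`. -/
theorem v_mul_u (hn : 1 ≤ n) :
    y k n (Fin.last n) * y k n ⟨n - 1, by omega⟩ =
      (-1 : ℤ) ^ (n + 1) • (y k n ⟨n - 1, by omega⟩ * y k n (Fin.last n)) := by
  rw [y_mul_y (show (⟨n - 1, by omega⟩ : Fin (n + 1)) < Fin.last n from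
    Fin.lt_def.2 (by simp; omega)), mk_oreCorrection,
    if_neg (by simp), if_neg (by simp; omega), add_zero]
  congr 1
  unfold oreSign
  rw [if_neg (by simp), if_neg (by simp), if_neg (by simp; omega)]

/-- The correction terms skew commute with the lower generator. -/
theorem oreSign_smul_y_mul_correction {i j : Fin (n + 1)} :
    oreSign n j i • (y k n i * mk k n (oreCorrection k n j i)) +
      mk k n (oreCorrection k n j i) * y k n i = 0 := by
  rw [mk_oreCorrection]
  split_ifs with h1 h2
  · unfold oreSign
    rw [if_pos h1, ← coeff_commutes]
    simp
  · unfold oreSign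
    rw [if_neg h1, if_neg (by omega), if_pos h2.2, ← mul_assoc, ← coeff_commutes, mul_assoc,
      mul_assoc, u_mul_y h2.2, mul_smul_comm, ← add_smul]
    have : (-1 : ℤ) ^ n + (-1) ^ (n - 1) = 0 := by
      obtain ⟨m, rfl⟩ : ∃ m, n = m + 1 := ⟨n - 1, by omega⟩
      rw [Nat.add_sub_cancel, pow_succ]; ring
    rw [this, zero_smul]
  · simp

/-- The correction terms skew commute with the upper generator. -/
theorem oreSign_smul_correction_mul_y {i j : Fin (n + 1)} :
    oreSign n j i • (mk k n (oreCorrection k n j i) * y k n j) +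
      y k n j * mk k n (oreCorrection k n j i) = 0 := by
  rw [mk_oreCorrection]
  split_ifs with h1 h2
  · unfold oreSign
    rw [if_pos h1, ← coeff_commutes]
    simp
  · obtain rfl : j = Fin.last n := Fin.ext h2.1
    unfold oreSign
    rw [if_neg h1, if_neg (by simp), if_pos h2.2, ← mul_assoc (y k n _), ← coeff_commutes,
      mul_assoc, mul_assoc, v_mul_u (by omega), mul_smul_comm, ← add_smul]
    rw [pow_succ]; simp
  · simp

theorem y_sq_mem_center (i : Fin (n + 1)) : y k n i ^ 2 ∈ Subring.center (OreAlg k n) := by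
  rw [Subring.mem_center_iff]
  intro c
  induction c using OreAlg.induction with
  | hc f => exact coeff_commutes k n f _
  | hmul a b ha hb => rw [mul_assoc, hb, ← mul_assoc, ha, mul_assoc]
  | hadd a b ha hb => rw [add_mul, mul_add, ha, hb]
  | hy j =>
    rcases lt_trichotomy i j with h | rfl | h
    · have h1 := y_mul_y (k := k) h
      have h2 := oreSign_smul_y_mul_correction (k := k) (i := i) (j := j)
      set c := mk k n (oreCorrection k n j i)
      rw [pow_two, ← mul_assoc, h1, add_mul, smul_mul_assoc, mul_assoc, h1, mul_add, smul_add,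
        mul_smul_comm, oreSign_smul_smul, add_assoc, h2, add_zero, mul_assoc]
    · rw [← pow_succ, ← pow_succ']
    · have h1 := y_mul_y (k := k) h
      have h2 := oreSign_smul_correction_mul_y (k := k) (i := j) (j := i)
      set c := mk k n (oreCorrection k n i j)
      rw [pow_two, mul_assoc, h1, mul_add, mul_smul_comm, ← mul_assoc (y k n i), h1, add_mul,
        smul_add, smul_mul_assoc, oreSign_smul_smul, add_assoc, h2, add_zero, mul_assoc]

theorem coeff_mem_center (f : MvPolynomial (Fin n) k) :
    coeff k n f ∈ Subring.center (OreAlg k n) :=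
  Subring.mem_center_iff.2 fun c => (coeff_commutes k n f c).symm

theorem r_mem_center (i : Fin (n + 1)) : r k n i ∈ Subring.center (OreAlg k n) :=
  sub_mem (y_sq_mem_center i) (coeff_mem_center _)

/-! ### The grading of `C` -/

variable (k n) in
/-- The augmentation of `C`. -/
theorem exists_augmentation : ∃ F : OreAlg k n →ₐ[k] k,
    (∀ f, F (coeff k n f) = constantCoeff f) ∧ ∀ i, F (y k n i) = 0 := by
  have h0 : ∀ f : MvPolynomial (Fin n) k, aeval (0 : Fin n → k) f = constantCoeff f := by
    intro f
    rw [aeval_zero]; rfl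
  obtain ⟨F, h1, h2⟩ := exists_lift (k := k) (n := n) (aeval (0 : Fin n → k)) (fun _ => 0)
    (fun _ _ => by simp) (fun i j _ => by
      simp only [h0, map_mul, constantCoeff_powerSumPoly k n (Nat.succ_pos _)]
      simp)
  exact ⟨F, fun f => (h1 f).trans (h0 f), h2⟩

instance : Nontrivial (OreAlg k n) := by
  obtain ⟨F, -⟩ := exists_augmentation k n
  exact F.toRingHom.domain_nontrivial

theorem weight_of_lt {i : ℕ} (h : i + 1 < n) : weight n i = 2 * i + 1 := if_pos h

theorem weight_pred (hn : 1 ≤ n) : weight n (n - 1) = n := by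
  unfold weight; rw [if_neg (by omega), if_pos (by omega)]

theorem weight_last : weight n n = n - 1 := by
  unfold weight; rw [if_neg (by omega), if_neg (by omega)]

theorem weight_pos (hn : 2 ≤ n) (i : ℕ) : 0 < weight n i := by
  unfold weight; split_ifs <;> omega

variable (k n) in
theorem exists_coaction : ∃ ρ : OreAlg k n →ₐ[k] Polynomial (OreAlg k n),
    (∀ f, ρ (coeff k n f) = Polynomial.map (coeff k n) (weightCoaction k n f)) ∧
      ∀ i : Fin (n + 1), ρ (y k n i) = Polynomial.monomial (weight n i) (y k n i) := by
  let c : MvPolynomial (Fin n) k →ₐ[k] Polynomial (OreAlg k n) :=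
    (Polynomial.mapAlgHom (coeffAlgHom k n)).comp (weightCoaction k n)
  have hc : ∀ f, c f = Polynomial.map (coeff k n) (weightCoaction k n f) := fun f => rfl
  have hp : ∀ m, c (2 * powerSumPoly k n m) =
      Polynomial.monomial (2 * m) (coeff k n (2 * powerSumPoly k n m)) := by
    intro m
    have h2 : (2 : MvPolynomial (Fin n) k) = ((2 : ℕ) : MvPolynomial (Fin n) k) := by norm_num
    rw [h2, ← nsmul_eq_mul, map_nsmul, hc, weightCoaction_powerSumPoly, Polynomial.map_monomial,
      map_nsmul, map_nsmul]
  refine exists_lift c _ (fun f i => ?_) fun i j h => ?_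
  · rw [hc]
    ext m
    rw [← Polynomial.C_mul_X_pow_eq_monomial, ← mul_assoc, mul_assoc (Polynomial.C _),
      Polynomial.X_pow_mul, ← mul_assoc, Polynomial.coeff_mul_X_pow', Polynomial.coeff_mul_X_pow']
    split_ifs
    · rw [Polynomial.coeff_mul_C, Polynomial.coeff_C_mul, Polynomial.coeff_map, coeff_commutes]
    · rfl
  · rw [Polynomial.monomial_mul_monomial, Polynomial.monomial_mul_monomial, y_mul_y h, map_add,
      map_zsmul, add_comm (weight n j), mk_oreCorrection]
    congr 1
    split_ifs with h1 h2
    · rw [hp, weight_of_lt h1, weight_of_lt (by have := Fin.lt_def.1 h; omega)]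
      congr 2
      omega
    · rw [hp, Polynomial.monomial_mul_monomial, h2.1, weight_last, weight_of_lt h2.2]
      simp only [weight_pred (show 1 ≤ n by omega)]
      congr 1
      have := h2.2
      congr 1
      omega
    · rw [map_zero]

theorem grading_eq_span (d : ℕ) : grading k n d = Submodule.span k {c | ∃ (m : Fin n →₀ ℕ)
    (l : List (Fin (n + 1))), (m.sum fun i e => e * (2 * ((i : ℕ) + 1))) +
      (l.map fun i : Fin (n + 1) => weight n (i : ℕ)).sum = d ∧
        c = coeff k n (MvPolynomial.monomial m 1) * (l.map (y k n)).prod} := by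
  unfold grading
  simp only [bind_pure_comp, List.map_eq_map, List.map_map, Function.comp_def]

theorem monomial_mem_grading (m : Fin n →₀ ℕ) (l : List (Fin (n + 1))) :
    coeff k n (MvPolynomial.monomial m 1) * (l.map (y k n)).prod ∈
      grading k n ((m.sum fun i e => e * (2 * ((i : ℕ) + 1))) +
        (l.map fun i : Fin (n + 1) => weight n (i : ℕ)).sum) := by
  rw [grading_eq_span]
  exact Submodule.subset_span ⟨m, l, rfl, rfl⟩

theorem y_mem_grading (i : Fin (n + 1)) : y k n i ∈ grading k n (weight n i) := by
  simpa using monomial_mem_grading (k := k) (n := n) 0 [i]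

instance : SetLike.GradedMonoid (grading k n) where
  one_mem := by simpa using monomial_mem_grading (k := k) (n := n) 0 []
  mul_mem i j a b ha hb := by
    have h : grading k n i * grading k n j ≤ grading k n (i + j) := by
      rw [grading_eq_span, grading_eq_span, Submodule.span_mul_span, Submodule.span_le]
      rintro _ ⟨_, ⟨m, l, rfl, rfl⟩, _, ⟨m', l', rfl, rfl⟩, rfl⟩
      have hm : (monomial (m + m') 1 : MvPolynomial (Fin n) k) = monomial m 1 * monomial m' 1 := by
        rw [monomial_mul, mul_one]
      have hp : coeff k n (monomial m 1) * (l.map (y k n)).prod *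
          (coeff k n (monomial m' 1) * (l'.map (y k n)).prod) =
          coeff k n (monomial (m + m') 1) * ((l ++ l').map (y k n)).prod := by
        rw [List.map_append, List.prod_append, hm, map_mul, mul_assoc, mul_assoc,
          ← mul_assoc _ (coeff k n (monomial m' 1)), ← coeff_commutes, mul_assoc]
      have := monomial_mem_grading (k := k) (m + m') (l ++ l')
      rw [← hp, Finsupp.sum_add_index' (by simp) (by intros; ring), List.map_append,
        List.sum_append, add_add_add_comm] at this
      exact this
    exact h (Submodule.mul_mem_mul ha hb)

theorem mem_iSup_grading (c : OreAlg k n) : c ∈ iSup (grading k n) := by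
  induction c using OreAlg.induction with
  | hc f =>
    rw [MvPolynomial.as_sum f, map_sum]
    refine sum_mem fun m _ => ?_
    rw [← mul_one (MvPolynomial.coeff m f), ← smul_eq_mul, ← smul_monomial]
    change coeffAlgHom k n _ ∈ _
    rw [map_smul]
    refine Submodule.smul_mem _ _ 
      (Submodule.mem_iSup_of_mem ((m.sum fun i e => e * (2 * ((i : ℕ) + 1))) + 0) ?_)
    have := monomial_mem_grading (k := k) m []
    rw [List.map_nil, List.map_nil, List.prod_nil, mul_one, List.sum_nil] at this
    exact this

  | hy i => exact Submodule.mem_iSup_of_mem _ (y_mem_grading i)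
  | hmul a b ha hb => exact mul_mem_iSup _ ha hb
  | hadd a b ha hb => exact add_mem ha hb

theorem weightCoaction_monomial (m : Fin n →₀ ℕ) :
    weightCoaction k n (monomial m 1) = Polynomial.monomial
      (m.sum fun i e => e * (2 * ((i : ℕ) + 1))) (monomial m 1) := by
  induction m using Finsupp.induction_linear with
  | zero => simp
  | add f g hf hg =>
    rw [Finsupp.sum_add_index' (by simp) (by intros; ring), show (monomial (f + g) 1 :
      MvPolynomial (Fin n) k) = monomial f 1 * monomial g 1 by rw [monomial_mul, mul_one],
      map_mul, hf, hg, Polynomial.monomial_mul_monomial]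
  | single i e =>
    rw [Finsupp.sum_single_index (by simp), ← X_pow_eq_monomial, map_pow, weightCoaction_X,
      Polynomial.monomial_pow, mul_comm]

theorem coaction_of_mem {ρ : OreAlg k n →ₐ[k] Polynomial (OreAlg k n)}
    (h1 : ∀ f, ρ (coeff k n f) = Polynomial.map (coeff k n) (weightCoaction k n f))
    (h2 : ∀ i : Fin (n + 1), ρ (y k n i) = Polynomial.monomial (weight n i) (y k n i))
    {d : ℕ} {c : OreAlg k n} (hc : c ∈ grading k n d) : ρ c = Polynomial.monomial d c := by
  rw [grading_eq_span] at hc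
  induction hc using Submodule.span_induction with
  | mem _ h =>
    obtain ⟨m, l, rfl, rfl⟩ := h
    have hl : ρ (l.map (y k n)).prod =
        Polynomial.monomial (l.map fun i : Fin (n + 1) => weight n i).sum
          (l.map (y k n)).prod := by
      induction l with
      | nil => simp
      | cons i l ih => simp [h2, ih, Polynomial.monomial_mul_monomial]
    rw [map_mul, hl, h1, weightCoaction_monomial, Polynomial.map_monomial,
      Polynomial.monomial_mul_monomial]
  | zero => simp
  | add a b _ _ ha hb => rw [map_add, map_add, ha, hb]
  | smul r a _ ha => rw [map_smul, ha, Polynomial.smul_monomial]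

theorem isConnectedGraded (hn : 2 ≤ n) : IsConnectedGraded k (grading k n) where
  nontrivial := inferInstance
  gradedMonoid := inferInstance
  isInternal := by
    obtain ⟨ρ, h1, h2⟩ := exists_coaction k n
    exact isInternal_of_coaction _ (ρ : OreAlg k n →+ _) (fun d a ha => coaction_of_mem h1 h2 ha)
      mem_iSup_grading
  zero_eq := by
    rw [grading_eq_span]
    refine le_antisymm (Submodule.span_le.2 ?_) ?_
    · rintro _ ⟨m, l, h, rfl⟩
      obtain ⟨hm, hl⟩ := Nat.add_eq_zero_iff.1 h
      have hm0 : m = 0 := by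
        ext i
        by_contra hi
        have : ∑ j ∈ m.support, m j * (2 * ((j : ℕ) + 1)) = 0 := hm
        rw [Finset.sum_eq_zero_iff] at this
        have := this i (Finsupp.mem_support_iff.2 hi)
        have hi' : m i ≠ 0 := hi
        simp [hi'] at this
      have hl0 : l = [] := by
        cases l with
        | nil => rfl
        | cons i l =>
          have := weight_pos hn i
          simp at hl
          omega
      subst hm0 hl0
      simp
    · rw [Submodule.one_le, ← grading_eq_span]
      exact SetLike.GradedOne.one_mem

theorem coeff_mem_grading {d : ℕ} {f : MvPolynomial (Fin n) k}
    (hf : weightCoaction k n f = Polynomial.monomial d f) : coeff k n f ∈ grading k n d := by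
  obtain ⟨ρ, h1, h2⟩ := exists_coaction k n
  refine mem_of_coaction_eq _ (ρ : OreAlg k n →+ _) (fun d a ha => coaction_of_mem h1 h2 ha)
    mem_iSup_grading ?_
  change ρ _ = _
  rw [h1, hf, Polynomial.map_monomial]

theorem squareValue_pred (hn : 1 ≤ n) :
    squareValue k n (n - 1) = (-1) ^ (n * (n - 1) / 2) * X ⟨n - 1, by omega⟩ := by
  unfold squareValue
  rw [if_neg (by omega), if_pos (by omega), dif_pos]

theorem squareValue_last (hn : 2 ≤ n) :
    squareValue k n n = (-1) ^ ((n - 1) * (n - 2) / 2) * X ⟨n - 2, by omega⟩ := by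
  unfold squareValue
  rw [if_neg (by omega), if_neg (by omega), dif_pos]

theorem squareValue_of_lt {i : ℕ} (h : i + 1 < n) :
    squareValue k n i = powerSumPoly k n (2 * i + 1) := if_pos h

theorem weightCoaction_neg_one_pow_mul_X (m : ℕ) (i : Fin n) :
    weightCoaction k n ((-1) ^ m * X i) =
      Polynomial.monomial (2 * ((i : ℕ) + 1)) ((-1) ^ m * X i) := by
  rcases neg_one_pow_eq_or (MvPolynomial (Fin n) k) m with h | h <;>
    simp [h, weightCoaction_X]

theorem eq_pred_or_last {i : Fin (n + 1)} (h : ¬ (i : ℕ) + 1 < n) :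
    (i : ℕ) = n - 1 ∨ i = Fin.last n := by
  have := i.2
  by_cases h' : (i : ℕ) = n
  · exact Or.inr (Fin.ext h')
  · exact Or.inl (by omega)

theorem coeff_squareValue_mem_grading (hn : 2 ≤ n) (i : Fin (n + 1)) :
    coeff k n (squareValue k n i) ∈ grading k n (2 * weight n i) := by
  apply coeff_mem_grading
  by_cases h : (i : ℕ) + 1 < n
  · rw [squareValue_of_lt h, weight_of_lt h, weightCoaction_powerSumPoly]
  · rcases eq_pred_or_last h with h | rfl
    · rw [h, squareValue_pred (by omega), weight_pred (by omega), weightCoaction_neg_one_pow_mul_X]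
      congr 1
      congr 1
      simp only
      omega
    · rw [Fin.val_last, squareValue_last hn, weight_last, weightCoaction_neg_one_pow_mul_X]
      congr 1
      congr 1
      simp only
      omega

theorem y_sq_mem_grading (i : Fin (n + 1)) : y k n i ^ 2 ∈ grading k n (2 * weight n i) :=
  SetLike.pow_mem_graded 2 (y_mem_grading i)

theorem r_mem_grading (hn : 2 ≤ n) (i : Fin (n + 1)) :
    r k n i ∈ grading k n (2 * weight n i) :=
  sub_mem (y_sq_mem_grading i) (coeff_squareValue_mem_grading hn i)

end OreAlg

/-! ### Sign automorphisms and the opposite algebra -/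

namespace OreAlg

open MvPolynomial

variable {k : Type u} [Field k] {n : ℕ}

/-- The scalars by which the sign automorphism of `C` with parameters `ε`, `ε'` acts: `ε` on
`y_1, …, y_{n-1}`, `ε ε'` on `u`, and `ε'` on `v`. -/
def twistSign (n : ℕ) (ε ε' : ℤ) (i : ℕ) : ℤ :=
  if i + 1 < n then ε else if i + 1 = n then ε * ε' else ε'

variable (k n) in
theorem exists_twist_algHom {ε ε' : ℤ} (h : ε * ε = 1) :
    ∃ θ : OreAlg k n →ₐ[k] OreAlg k n, (∀ f, θ (coeff k n f) = coeff k n f) ∧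
      ∀ i : Fin (n + 1), θ (y k n i) = twistSign n ε ε' i • y k n i := by
  refine exists_lift (coeffAlgHom k n) (fun i => twistSign n ε ε' i • y k n i)
    (fun f i => ?_) fun i j hij => ?_
  · rw [mul_smul_comm, smul_mul_assoc]
    exact congrArg _ (coeff_commutes k n f _)
  · have hij' := Fin.lt_def.1 hij
    dsimp only
    rw [smul_mul_smul_comm, smul_mul_smul_comm, y_mul_y hij, smul_add, smul_comm,
      mul_comm (twistSign n ε ε' j), mk_oreCorrection]
    congr 1
    split_ifs with h1 h2
    · unfold twistSign
      rw [if_pos h1, if_pos (by omega), h, one_smul]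
      rfl
    · unfold twistSign
      rw [if_neg h1, if_pos h2.2, if_neg (by omega), if_neg (by omega),
        if_pos (by omega), mul_smul_comm]
      rfl
    · rw [smul_zero]

variable (k n) in
/-- The automorphism of `C` that multiplies the generators by signs. -/
theorem exists_twist {ε ε' : ℤ} (h : ε * ε = 1) (h' : ε' * ε' = 1) :
    ∃ θ : OreAlg k n ≃ₐ[k] OreAlg k n, (∀ f, θ (coeff k n f) = coeff k n f) ∧
      (∀ i : Fin (n + 1), θ (y k n i) = twistSign n ε ε' i • y k n i) ∧ ∀ c, θ (θ c) = c := by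
  obtain ⟨θ, h1, h2⟩ := exists_twist_algHom (ε' := ε') k n h
  have hθ : θ.comp θ = AlgHom.id k _ := by
    refine algHom_ext (fun f => ?_) fun i => ?_
    · rw [AlgHom.comp_apply, h1, h1]; rfl
    · rw [AlgHom.comp_apply, h2, map_zsmul, h2, smul_smul]
      have : twistSign n ε ε' i * twistSign n ε ε' i = 1 := by
        unfold twistSign
        split_ifs
        · exact h
        · rw [mul_mul_mul_comm, h, h', one_mul]
        · exact h'
      rw [this, one_smul]; rfl
  exact ⟨AlgEquiv.ofAlgHom θ θ hθ hθ, h1, h2, AlgHom.congr_fun hθ⟩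

/-- `C` is isomorphic to its opposite algebra, by an isomorphism that changes the generators at
most by a sign. -/
theorem exists_antiautomorphism (hn : 1 ≤ n) : ∃ e : OreAlg k n ≃ₐ[k] (OreAlg k n)ᵐᵒᵖ,
    (∀ f, e (coeff k n f) = MulOpposite.op (coeff k n f)) ∧
      (∀ i : Fin (n + 1), e (y k n i) =
        MulOpposite.op ((if (i : ℕ) + 1 = n then (-1 : ℤ) ^ (n + 1) else 1) • y k n i)) ∧
      ∀ a, (e (e a).unop).unop = a := by
  let η : Fin (n + 1) → ℤ := fun i => if (i : ℕ) + 1 = n then (-1 : ℤ) ^ (n + 1) else 1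
  have hη : ∀ i, η i * η i = 1 := by
    intro i
    dsimp only [η]
    split_ifs
    · rw [← mul_pow]; simp
    · simp
  let c : MvPolynomial (Fin n) k →ₐ[k] (OreAlg k n)ᵐᵒᵖ :=
    { (coeff k n).toOpposite fun f g => coeff_commutes k n f _ with commutes' := fun _ => rfl }
  have hc : ∀ f, c f = MulOpposite.op (coeff k n f) := fun f => rfl
  obtain ⟨F, h1, h2⟩ := exists_lift c (fun i => MulOpposite.op (η i • y k n i))
    (fun f i => by
      rw [hc, ← MulOpposite.op_mul, ← MulOpposite.op_mul, coeff_commutes]) (fun i j hij => by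
    have hij' := Fin.lt_def.1 hij
    have key : y k n i * y k n j = oreSign n j i • (y k n j * y k n i) -
        oreSign n j i • mk k n (oreCorrection k n j i) := by
      rw [y_mul_y hij, smul_add, oreSign_smul_smul, add_sub_cancel_right]
    rw [← MulOpposite.op_mul, ← MulOpposite.op_mul, smul_mul_smul_comm, smul_mul_smul_comm, key,
      smul_sub, sub_eq_add_neg, MulOpposite.op_add, smul_comm, mul_comm (η i), MulOpposite.op_smul]
    congr 1
    rw [mk_oreCorrection]
    split_ifs with h1 h2
    · have e1 : η j * η i = 1 := by
        dsimp only [η]; rw [if_neg (by omega), if_neg (by omega), one_mul]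
      rw [e1, one_smul, hc, oreSign, if_pos h1, neg_smul, one_smul, neg_neg]
    · have e1 : η j * η i = 1 := by
        dsimp only [η]; rw [if_neg (by omega), if_neg (by omega), one_mul]
      rw [e1, one_smul, hc, oreSign, if_neg h1, if_neg (by omega), if_pos h2.2,
        ← MulOpposite.op_mul, ← neg_smul]
      dsimp only [η]
      rw [if_pos (by omega), smul_mul_assoc, ← coeff_commutes]
      congr 2
      rw [pow_succ]; ring
    · simp)
  have hFF : ∀ a, (F (F a).unop).unop = a := by
    intro a
    induction a using OreAlg.induction with
    | hc f => rw [h1, hc, MulOpposite.unop_op, h1, hc, MulOpposite.unop_op]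
    | hy i =>
      rw [h2, MulOpposite.unop_op, map_zsmul, h2, ← MulOpposite.op_smul, MulOpposite.unop_op,
        smul_smul, hη, one_smul]
    | hmul a b ha hb =>
      rw [map_mul, MulOpposite.unop_mul, map_mul, MulOpposite.unop_mul, ha, hb]
    | hadd a b ha hb =>
      rw [map_add, MulOpposite.unop_add, map_add, MulOpposite.unop_add, ha, hb]
  refine ⟨AlgEquiv.ofBijective F ⟨fun a b hab => ?_, fun b => ⟨(F b.unop).unop, ?_⟩⟩, h1, h2, hFF⟩
  · rw [← hFF a, hab, hFF]
  · exact MulOpposite.unop_injective (hFF _)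

theorem mem_opGrading {A : Type u} [Ring A] [Algebra k A] {𝒜 : ℕ → Submodule k A} {d : ℕ}
    {b : Aᵐᵒᵖ} : b ∈ opGrading k 𝒜 d ↔ b.unop ∈ 𝒜 d := by
  constructor
  · rintro ⟨a, ha, rfl⟩
    exact ha
  · intro hb
    exact ⟨_, hb, rfl⟩

theorem coeff_monomial_mem_grading (m : Fin n →₀ ℕ) :
    coeff k n (monomial m 1) ∈ grading k n (m.sum fun i e => e * (2 * ((i : ℕ) + 1))) :=
  coeff_mem_grading (weightCoaction_monomial m)

theorem mem_grading_iff_of_antiautomorphism {e : OreAlg k n ≃ₐ[k] (OreAlg k n)ᵐᵒᵖ}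
    (h1 : ∀ f, e (coeff k n f) = MulOpposite.op (coeff k n f))
    (h2 : ∀ i : Fin (n + 1), e (y k n i) =
        MulOpposite.op ((if (i : ℕ) + 1 = n then (-1 : ℤ) ^ (n + 1) else 1) • y k n i))
    (hee : ∀ a, (e (e a).unop).unop = a) (d : ℕ) (a : OreAlg k n) :
    a ∈ grading k n d ↔ e a ∈ opGrading k (grading k n) d := by
  let G : OreAlg k n →ₗ[k] OreAlg k n :=
    (MulOpposite.opLinearEquiv k).symm.toLinearMap ∘ₗ e.toLinearMap
  have hmem : ∀ d a, a ∈ grading k n d → (e a).unop ∈ grading k n d := by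
    intro d a ha
    have hle : grading k n d ≤ (grading k n d).comap G := by
      nth_rw 1 [grading_eq_span]
      rw [Submodule.span_le]
      rintro _ ⟨m, l, rfl, rfl⟩
      change (e _).unop ∈ grading k n _
      rw [map_mul, MulOpposite.unop_mul, h1, MulOpposite.unop_op, add_comm]
      refine SetLike.mul_mem_graded ?_ (coeff_monomial_mem_grading m)
      clear ha
      induction l with
      | nil => simpa using SetLike.GradedOne.one_mem (A := grading k n)
      | cons i l ih =>
        rw [List.map_cons, List.map_cons, List.prod_cons, List.sum_cons, map_mul,
          MulOpposite.unop_mul, add_comm, h2]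
        exact SetLike.mul_mem_graded ih (zsmul_mem (y_mem_grading i) _)
    exact hle ha
  rw [mem_opGrading]
  refine ⟨hmem d a, fun h => ?_⟩
  rw [← hee a]
  exact hmem d _ h

end OreAlg

section Transport

variable {k : Type u} [Field k] {A B : Type u} [Ring A] [Algebra k A] [Ring B] [Algebra k B]

theorem map_mem_seqIdeal_iff (e : A ≃ₐ[k] B) (z : ℕ → A) (i : ℕ) (a : A) :
    e a ∈ seqIdeal (fun i => e (z i)) i ↔ a ∈ seqIdeal z i := by
  induction i generalizing a with
  | zero => simp [seqIdeal]
  | succ i ih =>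
    rw [mem_seqIdeal_succ, mem_seqIdeal_succ]
    constructor
    · rintro ⟨c, hc⟩
      refine ⟨e.symm c, ?_⟩
      rwa [← ih, map_sub, map_mul, AlgEquiv.apply_symm_apply]
    · rintro ⟨c, hc⟩
      refine ⟨e c, ?_⟩
      rwa [← map_mul, ← map_sub, ih]

theorem IsGorensteinSequence.map {𝒜 : ℕ → Submodule k A} {ℬ : ℕ → Submodule k B} {z : ℕ → A}
    {d : ℕ} {top : A} (h : IsGorensteinSequence k 𝒜 z d top) (e : A ≃ₐ[k] B)
    (he : ∀ i a, a ∈ 𝒜 i ↔ e a ∈ ℬ i) :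
    IsGorensteinSequence k ℬ (fun i => e (z i)) d (e top) where
  central i hi a := by
    obtain ⟨a, rfl⟩ := e.surjective a
    rw [← map_mul, h.central i hi, map_mul]
  mem_positivePart i hi := by
    have hle : positivePart k 𝒜 ≤ (positivePart k ℬ).comap (e : A →+* B) :=
      Ideal.span_le.2 fun a ⟨j, hj, ha⟩ => Ideal.subset_span ⟨j, hj, (he j a).1 ha⟩
    exact hle (h.mem_positivePart i hi)
  regular i hi a ha := by
    obtain ⟨a, rfl⟩ := e.surjective a
    rw [← map_mul, map_mem_seqIdeal_iff] at ha
    exact (map_mem_seqIdeal_iff ..).2 (h.regular i hi a ha)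
  top_notMem := by
    rw [map_mem_seqIdeal_iff]
    exact h.top_notMem
  mul_top i hi a ha := by
    obtain ⟨a, rfl⟩ := e.surjective a
    rw [← map_mul, map_mem_seqIdeal_iff]
    exact h.mul_top i hi a ((he i a).2 ha)
  top_mul i hi a ha := by
    obtain ⟨a, rfl⟩ := e.surjective a
    rw [← map_mul, map_mem_seqIdeal_iff]
    exact h.top_mul i hi a ((he i a).2 ha)
  socle s hs := by
    obtain ⟨s, rfl⟩ := e.surjective s
    obtain ⟨c, hc⟩ := h.socle s fun i hi a ha => by
      have := hs i hi (e a) ((he i a).1 ha)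
      rwa [← map_mul, map_mem_seqIdeal_iff] at this
    refine ⟨c, ?_⟩
    rwa [← map_smul, ← map_sub, map_mem_seqIdeal_iff]

end Transport

namespace SkewPoly

open MvPolynomial

variable {k : Type u} [Field k] {n : ℕ}

@[elab_as_elim]
theorem induction {P : SkewPoly k n → Prop} (hc : ∀ c : k, P (algebraMap k _ c))
    (hx : ∀ i, P (x k n i)) (hmul : ∀ a b, P a → P b → P (a * b))
    (hadd : ∀ a b, P a → P b → P (a + b)) (a : SkewPoly k n) : P a := by
  obtain ⟨a, rfl⟩ := RingQuot.mkAlgHom_surjective k (SkewRel k n) a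
  induction a using FreeAlgebra.induction with
  | grade0 c => rw [AlgHom.commutes]; exact hc c
  | grade1 i => exact hx i
  | mul a b ha hb => rw [map_mul]; exact hmul _ _ ha hb
  | add a b ha hb => rw [map_add]; exact hadd _ _ ha hb

theorem algHom_ext {D : Type*} [Ring D] [Algebra k D] {F F' : SkewPoly k n →ₐ[k] D}
    (h : ∀ i, F (x k n i) = F' (x k n i)) : F = F' := by
  ext a
  induction a using SkewPoly.induction with
  | hc c => rw [AlgHom.commutes, AlgHom.commutes]
  | hx i => exact h i
  | hmul a b ha hb => rw [map_mul, map_mul, ha, hb]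
  | hadd a b ha hb => rw [map_add, map_add, ha, hb]

theorem exists_lift {D : Type u} [Ring D] [Algebra k D] (X : Fin n → D)
    (h : ∀ i j, i ≠ j → X i * X j = -(X j * X i)) :
    ∃ F : SkewPoly k n →ₐ[k] D, ∀ i, F (x k n i) = X i := by
  refine ⟨RingQuot.liftAlgHom k ⟨FreeAlgebra.lift k X, ?_⟩, fun i => ?_⟩
  · rintro _ _ ⟨i, j, hij⟩
    rw [map_neg, map_mul, map_mul, FreeAlgebra.lift_ι_apply, FreeAlgebra.lift_ι_apply, h i j hij]
  · exact (RingQuot.liftAlgHom_mkAlgHom_apply _ _ _ _).trans (FreeAlgebra.lift_ι_apply _ _)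

theorem perm_x (σ : Equiv.Perm (Fin n)) (i : Fin n) : perm k σ (x k n i) = x k n (σ i) :=
  (RingQuot.liftAlgHom_mkAlgHom_apply _ _ _ _).trans (FreeAlgebra.lift_ι_apply _ _)

theorem perm_mul (σ τ : Equiv.Perm (Fin n)) (a : SkewPoly k n) :
    perm k (σ * τ) a = perm k σ (perm k τ a) := by
  have : perm k (σ * τ) = (perm k σ).comp (perm k τ) :=
    algHom_ext fun i => by rw [AlgHom.comp_apply, perm_x, perm_x, perm_x]; rfl
  rw [this]; rfl

theorem perm_one (a : SkewPoly k n) : perm k (1 : Equiv.Perm (Fin n)) a = a := by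
  have : perm k (1 : Equiv.Perm (Fin n)) = AlgHom.id k _ :=
    algHom_ext fun i => by rw [perm_x]; rfl
  rw [this]; rfl

/-! ### Scaling and grading of the skew polynomial ring -/

/-- The endomorphism multiplying every generator by `ε`. -/
def scale (ε : ℤ) : SkewPoly k n →ₐ[k] SkewPoly k n :=
  (exists_lift (fun i => ε • x k n i) fun i j h => by
    rw [smul_mul_smul_comm, smul_mul_smul_comm, x_mul_x k n h, smul_neg]).choose

theorem scale_x (ε : ℤ) (i : Fin n) : scale ε (x k n i) = ε • x k n i :=
  (exists_lift (fun i => ε • x k n i) fun i j h => by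
    rw [smul_mul_smul_comm, smul_mul_smul_comm, x_mul_x k n h, smul_neg]).choose_spec i

theorem x_mem_grading (i : Fin n) : x k n i ∈ grading k n 1 := by
  rw [grading, pow_one]
  exact Submodule.subset_span ⟨i, rfl⟩

instance : SetLike.GradedMonoid (grading k n) where
  one_mem := by rw [grading, pow_zero]; exact Submodule.one_le.1 le_rfl
  mul_mem i j a b ha hb := by
    rw [grading, pow_add]
    exact Submodule.mul_mem_mul ha hb

/-- Induction on the degree for homogeneous elements. -/
theorem pow_induction {P : ℕ → SkewPoly k n → Prop} (h1 : P 0 1)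
    (hx : ∀ d a i, P d a → P (d + 1) (a * x k n i)) (h0 : ∀ d, P d 0)
    (hadd : ∀ d a b, P d a → P d b → P d (a + b)) (hsmul : ∀ d (c : k) a, P d a → P d (c • a))
    {d : ℕ} {a : SkewPoly k n} (ha : a ∈ grading k n d) : P d a := by
  induction d generalizing a with
  | zero =>
    rw [grading, pow_zero, Submodule.one_eq_span, Submodule.mem_span_singleton] at ha
    obtain ⟨c, rfl⟩ := ha
    exact hsmul _ _ _ h1
  | succ d ih =>
    rw [grading, pow_succ] at ha
    induction ha using Submodule.mul_induction_on' with
    | mem_mul_mem a ha b hb =>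
      induction hb using Submodule.span_induction with
      | mem _ h => obtain ⟨i, rfl⟩ := h; exact hx d a i (ih ha)
      | zero => rw [mul_zero]; exact h0 _
      | add b c _ _ hb hc => rw [mul_add]; exact hadd _ _ _ hb hc
      | smul c b _ hb => rw [mul_smul_comm]; exact hsmul _ _ _ hb
    | add a _ b _ ha hb => exact hadd _ _ _ ha hb

theorem scale_of_mem (ε : ℤ) {d : ℕ} {a : SkewPoly k n} (ha : a ∈ grading k n d) :
    scale ε a = ε ^ d • a := by
  refine pow_induction (P := fun d a => scale ε a = ε ^ d • a) (by simp) (fun d a i h => ?_)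
    (by simp) (fun d a b ha hb => ?_) (fun d c a ha => ?_) ha
  · rw [map_mul, h, scale_x, smul_mul_smul_comm, pow_succ]
  · rw [map_add, ha, hb, smul_add]
  · rw [map_smul, ha, smul_comm]

variable (k n) in
theorem exists_coaction : ∃ ρ : SkewPoly k n →ₐ[k] Polynomial (SkewPoly k n),
    ∀ d, ∀ a ∈ grading k n d, ρ a = Polynomial.monomial d a := by
  obtain ⟨ρ, hρ⟩ := exists_lift (k := k) (D := Polynomial (SkewPoly k n))
    (fun i => Polynomial.monomial 1 (x k n i)) fun i j h => by
      rw [Polynomial.monomial_mul_monomial, Polynomial.monomial_mul_monomial, x_mul_x k n h,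
        map_neg]
  refine ⟨ρ, fun d a ha => ?_⟩
  refine pow_induction (P := fun d a => ρ a = Polynomial.monomial d a) (by simp)
    (fun d a i h => ?_) (by simp) (fun d a b ha hb => ?_) (fun d c a ha => ?_) ha
  · rw [map_mul, h, hρ, Polynomial.monomial_mul_monomial]
  · rw [map_add, ha, hb, map_add]
  · rw [map_smul, ha, Polynomial.smul_monomial]

/-! ### Central squares -/

theorem x_sq_mul (i : Fin n) (a : SkewPoly k n) : x k n i ^ 2 * a = a * x k n i ^ 2 := by
  induction a using SkewPoly.induction with
  | hc c => exact (Algebra.commutes c _).symm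
  | hx j =>
    rcases eq_or_ne i j with rfl | h
    · rw [← pow_succ, ← pow_succ']
    · rw [pow_two, mul_assoc, x_mul_x k n h, mul_neg, ← mul_assoc, x_mul_x k n h, neg_mul, neg_neg,
        mul_assoc]
  | hmul a b ha hb => rw [← mul_assoc, ha, mul_assoc, hb, mul_assoc]
  | hadd a b ha hb => rw [mul_add, add_mul, ha, hb]

variable (k n) in
/-- The homomorphism from the polynomial ring to the skew polynomial ring that sends `X i` to the
central element `x_i ^ 2`. -/
def sq : MvPolynomial (Fin n) k →ₐ[k] SkewPoly k n :=
  (Subalgebra.center k (SkewPoly k n)).val.comp (aeval fun i => ⟨x k n i ^ 2,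
    Subalgebra.mem_center_iff.2 fun a => (x_sq_mul i a).symm⟩)

theorem sq_X (i : Fin n) : sq k n (X i) = x k n i ^ 2 := by
  rw [sq, AlgHom.comp_apply, aeval_X]; rfl

theorem sq_mul_comm (f : MvPolynomial (Fin n) k) (a : SkewPoly k n) :
    sq k n f * a = a * sq k n f :=
  (Subalgebra.mem_center_iff.1 (aeval (fun i => (⟨x k n i ^ 2,
    Subalgebra.mem_center_iff.2 fun a => (x_sq_mul i a).symm⟩ :
      Subalgebra.center k (SkewPoly k n))) f).2 a).symm

theorem perm_sq (σ : Equiv.Perm (Fin n)) (f : MvPolynomial (Fin n) k) :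
    perm k σ (sq k n f) = sq k n (rename σ f) := by
  have : (perm k σ).comp (sq k n) = (sq k n).comp (rename σ) := by
    ext i
    rw [AlgHom.comp_apply, AlgHom.comp_apply, sq_X, map_pow, perm_x, rename_X, sq_X]
  exact AlgHom.congr_fun this f

theorem squareEsymm_eq (m : ℕ) : squareEsymm k n m = sq k n (esymm (Fin n) k m) := by
  rw [squareEsymm, esymm, map_sum]
  refine Finset.sum_congr rfl fun s _ => ?_
  have h : ∏ i ∈ s, (X i : MvPolynomial (Fin n) k) = ((s.sort (· ≤ ·)).map X).prod := by
    conv_lhs => rw [← Finset.sort_toFinset s (· ≤ ·)]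
    exact List.prod_toFinset _ (Finset.sort_nodup s (· ≤ ·))
  rw [h, map_list_prod, List.map_map]
  congr 1
  refine List.map_congr_left fun i _ => ?_
  rw [Function.comp_apply, sq_X]

theorem powerSum_even (m : ℕ) : powerSum k n (2 * m) = sq k n (psum (Fin n) k m) := by
  rw [powerSum, psum, map_sum]
  refine Finset.sum_congr rfl fun i _ => ?_
  rw [map_pow, sq_X, pow_mul]

/-! ### Ordered monomials -/

variable (k) in
/-- The product of the powers `x_i ^ {a_i}` over a list of indices. -/
def listMonomial (a : Fin n → ℕ) (l : List (Fin n)) : SkewPoly k n :=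
  (l.map fun i => x k n i ^ a i).prod

variable (k) in
/-- The ordered monomial `x_1 ^ {a_1} ⋯ x_n ^ {a_n}`. -/
def orderedMonomial (a : Fin n → ℕ) : SkewPoly k n := listMonomial k a (List.finRange n)

theorem x_mul_pow {i j : Fin n} (h : i ≠ j) (m : ℕ) :
    x k n i * x k n j ^ m = (-1 : ℤ) ^ m • (x k n j ^ m * x k n i) := by
  induction m with
  | zero => simp
  | succ m ih =>
    rw [pow_succ, ← mul_assoc, ih, smul_mul_assoc, mul_assoc, x_mul_x k n h, mul_neg, mul_assoc,
      pow_succ, mul_neg_one, neg_smul, smul_neg]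

theorem listMonomial_congr {a b : Fin n → ℕ} {l : List (Fin n)} (h : ∀ i ∈ l, a i = b i) :
    listMonomial k a l = listMonomial k b l := by
  unfold listMonomial
  congr 1
  exact List.map_congr_left fun i hi => by rw [h i hi]

theorem exists_x_mul_listMonomial (a : Fin n → ℕ) (i : Fin n) (l : List (Fin n)) (hl : l.Nodup)
    (hi : i ∈ l) : ∃ m : ℕ, x k n i * listMonomial k a l =
      (-1 : ℤ) ^ m • listMonomial k (a + Pi.single i 1) l := by
  induction l with
  | nil => simp at hi
  | cons j l ih =>
    rw [List.nodup_cons] at hl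
    have hc : ∀ b, listMonomial k b (j :: l) = x k n j ^ b j * listMonomial k b l := fun b => by
      rw [listMonomial, List.map_cons, List.prod_cons]; rfl
    by_cases hij : i = j
    · subst hij
      refine ⟨0, ?_⟩
      rw [pow_zero, one_smul, hc, hc, ← mul_assoc, ← pow_succ',
        listMonomial_congr (b := a + Pi.single i 1) fun m hm => ?_]
      · simp
      · have : m ≠ i := fun h => hl.1 (h ▸ hm)
        simp [this]
    · obtain ⟨m, hm⟩ := ih hl.2 (by simpa [hij] using hi)
      refine ⟨a j + m, ?_⟩
      rw [hc, hc, ← mul_assoc, x_mul_pow hij, smul_mul_assoc, mul_assoc, hm, mul_smul_comm,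
        smul_smul, pow_add]
      have : (a + Pi.single i 1 : Fin n → ℕ) j = a j := by simp [Ne.symm hij]
      rw [this]

theorem exists_x_mul_orderedMonomial (a : Fin n → ℕ) (i : Fin n) : ∃ m : ℕ,
    x k n i * orderedMonomial k a = (-1 : ℤ) ^ m • orderedMonomial k (a + Pi.single i 1) :=
  exists_x_mul_listMonomial a i _ (List.nodup_finRange n) (List.mem_finRange i)

theorem orderedMonomial_zero : orderedMonomial k (0 : Fin n → ℕ) = 1 := by
  unfold orderedMonomial listMonomial
  simp

theorem span_orderedMonomial :
    Submodule.span k (Set.range (orderedMonomial k : (Fin n → ℕ) → SkewPoly k n)) = ⊤ := by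
  rw [eq_top_iff]
  have hx : ∀ (i : Fin n), ∀ b ∈ Submodule.span k (Set.range (orderedMonomial k)),
      x k n i * b ∈ Submodule.span k (Set.range (orderedMonomial k)) := by
    intro i b hb
    induction hb using Submodule.span_induction with
    | mem _ h =>
      obtain ⟨a, rfl⟩ := h
      obtain ⟨m, hm⟩ := exists_x_mul_orderedMonomial (k := k) a i
      rw [hm]
      exact zsmul_mem (Submodule.subset_span (Set.mem_range_self _)) _
    | zero => rw [mul_zero]; exact zero_mem _
    | add a b _ _ ha hb => rw [mul_add]; exact add_mem ha hb
    | smul c a _ ha => rw [mul_smul_comm]; exact Submodule.smul_mem _ _ ha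
  have key : ∀ a b : SkewPoly k n, b ∈ Submodule.span k (Set.range (orderedMonomial k)) →
      a * b ∈ Submodule.span k (Set.range (orderedMonomial k)) := by
    intro a
    induction a using SkewPoly.induction with
    | hc c => intro b hb; rw [← Algebra.smul_def]; exact Submodule.smul_mem _ _ hb
    | hx i => exact hx i
    | hmul a b ha hb => intro c hc; rw [mul_assoc]; exact ha _ (hb _ hc)
    | hadd a b ha hb => intro c hc; rw [add_mul]; exact add_mem (ha _ hc) (hb _ hc)
  intro a _
  rw [← mul_one a]
  refine key a 1 (Submodule.subset_span ?_)
  exact ⟨0, orderedMonomial_zero⟩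

end SkewPoly

/-! ### Sign-twisted multiplication operators -/

namespace SignModel

open MvPolynomial

variable (k : Type u) [Field k] {ι : Type*} (q : ι → ι → ℤ)

/-- The diagonal endomorphism `X j ↦ q i j X j` of the polynomial ring. -/
def twist (i : ι) : MvPolynomial ι k →ₐ[k] MvPolynomial ι k := aeval fun j => q i j • X j

/-- The sign-twisted multiplication by `X i`. -/
def op (i : ι) : Module.End k (MvPolynomial ι k) :=
  LinearMap.mulLeft k (X i) ∘ₗ (twist k q i).toLinearMap

variable {k q}

theorem twist_X (i j : ι) : twist k q i (X j) = q i j • X j := aeval_X _ _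

theorem op_apply (i : ι) (f : MvPolynomial ι k) : op k q i f = X i * twist k q i f := rfl

theorem twist_comm (i j : ι) (f : MvPolynomial ι k) :
    twist k q i (twist k q j f) = twist k q j (twist k q i f) := by
  have : (twist k q i).comp (twist k q j) = (twist k q j).comp (twist k q i) := by
    ext m : 1
    rw [AlgHom.comp_apply, AlgHom.comp_apply, twist_X, twist_X, map_zsmul, map_zsmul, twist_X,
      twist_X, smul_comm]
  exact AlgHom.congr_fun this f

theorem pderiv_twist (i j : ι) (f : MvPolynomial ι k) :
    pderiv j (twist k q i f) = q i j • twist k q i (pderiv j f) := by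
  classical
  induction f using MvPolynomial.induction_on with
  | C a =>
    rw [← algebraMap_eq, AlgHom.commutes, algebraMap_eq, pderiv_C, map_zero, smul_zero]
  | add f g hf hg => rw [map_add, map_add, hf, hg, map_add, map_add, smul_add]
  | mul_X f m hf =>
    have h : pderiv j (q i m • (X m : MvPolynomial ι k)) =
        q i j • twist k q i (pderiv j (X m)) := by
      rw [map_zsmul, pderiv_X]
      rcases eq_or_ne j m with rfl | hjm
      · rw [Pi.single_eq_same, map_one]
      · rw [Pi.single_eq_of_ne (Ne.symm hjm), map_zero, smul_zero, smul_zero]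
    rw [map_mul, Derivation.leibniz, Derivation.leibniz, hf, twist_X, h, map_add, smul_add]
    simp only [smul_eq_mul, map_mul, twist_X, mul_smul_comm, smul_mul_assoc]

variable (hq : ∀ i j, q i j * q i j = 1)
include hq

theorem twist_twist (i : ι) (f : MvPolynomial ι k) : twist k q i (twist k q i f) = f := by
  have : (twist k q i).comp (twist k q i) = AlgHom.id k _ := by
    ext m : 1
    rw [AlgHom.comp_apply, twist_X, map_zsmul, twist_X, smul_smul, hq, one_smul]
    rfl
  exact AlgHom.congr_fun this f

theorem op_mul_op (i j : ι) : op k q i * op k q j = (q i j * q j i) • (op k q j * op k q i) := by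
  refine LinearMap.ext fun f => ?_
  rw [LinearMap.smul_apply, Module.End.mul_apply, Module.End.mul_apply, op_apply, op_apply,
    op_apply, op_apply, map_mul, map_mul, twist_X, twist_X, twist_comm i j]
  rw [smul_mul_assoc, mul_smul_comm, smul_mul_assoc, mul_smul_comm, smul_smul, mul_assoc, hq,
    mul_one, mul_left_comm]

theorem op_sq {i : ι} (hi : q i i = 1) : op k q i ^ 2 = LinearMap.mulLeft k (X i ^ 2) := by
  refine LinearMap.ext fun f => ?_
  rw [pow_two, Module.End.mul_apply, op_apply, op_apply, map_mul, twist_twist hq, twist_X, hi,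
    one_smul, LinearMap.mulLeft_apply, pow_two, mul_assoc]

end SignModel

namespace SkewPoly

open MvPolynomial SignModel

variable {k : Type u} [Field k] {n : ℕ}

/-- The signs in the model of `C`. The variables `inl l` correspond to `x_l`, the variables `inr j`
to the generators of `C`; the sign is `1` unless the second index is smaller than the first. -/
def modelSign (n : ℕ) : Fin n ⊕ Fin (n + 1) → Fin n ⊕ Fin (n + 1) → ℤ
  | .inl a, .inl b => if b < a then -1 else 1
  | .inl _, .inr _ => 1
  | .inr j, .inl _ => if (j : ℕ) + 1 < n then -1 else if (j : ℕ) + 1 = n then 1 else (-1) ^ n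
  | .inr j, .inr i =>
    if i < j then if (j : ℕ) + 1 ≤ n then -1 else if (i : ℕ) + 1 < n then (-1) ^ n else -1 else 1

theorem modelSign_mul_self (i j : Fin n ⊕ Fin (n + 1)) :
    modelSign n i j * modelSign n i j = 1 := by
  rcases i with i | i <;> rcases j with j | j <;> simp only [modelSign] <;>
    (try split_ifs) <;> simp [← mul_pow]

theorem modelSign_self (i : Fin n ⊕ Fin (n + 1)) : modelSign n i i = 1 := by
  rcases i with i | i <;> simp [modelSign]

variable (k n) in
/-- The representation of the skew polynomial ring on the model space. -/
theorem exists_skewRep : ∃ F : SkewPoly k n →ₐ[k] Module.End k (MvPolynomial (Fin n ⊕ Fin (n + 1)) k),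
    ∀ i, F (x k n i) = op k (modelSign n) (.inl i) := by
  refine exists_lift _ fun i j h => ?_
  rw [op_mul_op modelSign_mul_self]
  have : modelSign n (.inl i) (.inl j) * modelSign n (.inl j) (.inl i) = -1 := by
    simp only [modelSign]
    rcases lt_or_gt_of_ne h with h | h
    · rw [if_neg h.not_gt, if_pos h, one_mul]
    · rw [if_neg h.not_gt, if_pos h, mul_one]
  rw [this, neg_smul, one_smul]

variable (k n) in
/-- The representation of the skew polynomial ring on the model space. -/
def skewRep : SkewPoly k n →ₐ[k] Module.End k (MvPolynomial (Fin n ⊕ Fin (n + 1)) k) :=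
  (exists_skewRep k n).choose

theorem skewRep_x (i : Fin n) : skewRep k n (x k n i) = op k (modelSign n) (.inl i) :=
  (exists_skewRep k n).choose_spec i

variable (k n) in
/-- The substitution `X i ↦ X i ^ 2`, into the model space. -/
def squareSubst : MvPolynomial (Fin n) k →ₐ[k] MvPolynomial (Fin n ⊕ Fin (n + 1)) k :=
  aeval fun i => X (.inl i) ^ 2

theorem squareSubst_injective : Function.Injective (squareSubst k n) := by
  have h : squareSubst k n = (rename Sum.inl).comp (expand 2) := by
    ext i : 1
    simp [squareSubst]
  rw [h]
  exact (rename_injective _ Sum.inl_injective).comp (expand_injective (by norm_num))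

theorem skewRep_sq (f : MvPolynomial (Fin n) k) :
    skewRep k n (sq k n f) = LinearMap.mulLeft k (squareSubst k n f) := by
  have : (skewRep k n).comp (sq k n) =
      (Algebra.lmul k (MvPolynomial (Fin n ⊕ Fin (n + 1)) k)).comp (squareSubst k n) := by
    ext i : 1
    rw [AlgHom.comp_apply, AlgHom.comp_apply, sq_X, map_pow, skewRep_x,
      op_sq modelSign_mul_self (modelSign_self _), squareSubst, aeval_X]
    rfl
  exact AlgHom.congr_fun this f

theorem skewRep_listMonomial (a : Fin n → ℕ) (l : List (Fin n)) (hl : l.Pairwise (· < ·)) :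
    skewRep k n (listMonomial k a l) 1 = (l.map fun i => X (Sum.inl i) ^ a i).prod := by
  induction l with
  | nil => simp [listMonomial]
  | cons i l ih =>
    rw [List.pairwise_cons] at hl
    have hfix : twist k (modelSign n) (.inl i) (l.map fun j => X (Sum.inl j) ^ a j).prod =
        (l.map fun j => X (Sum.inl j) ^ a j).prod := by
      rw [map_list_prod, List.map_map]
      congr 1
      refine List.map_congr_left fun j hj => ?_
      rw [Function.comp_apply, map_pow, twist_X]
      simp [modelSign, (hl.1 j hj).not_gt]
    have hpow : ∀ m, (op k (modelSign n) (.inl i) ^ m) (l.map fun j => X (Sum.inl j) ^ a j).prod =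
        X (Sum.inl i) ^ m * (l.map fun j => X (Sum.inl j) ^ a j).prod := by
      intro m
      induction m with
      | zero => simp
      | succ m ihm =>
        rw [pow_succ', Module.End.mul_apply, ihm, op_apply, map_mul, map_pow, twist_X,
          modelSign_self, one_smul, hfix, ← mul_assoc, ← pow_succ']
    have hc : listMonomial k a (i :: l) = x k n i ^ a i * listMonomial k a l := by
      rw [listMonomial, List.map_cons, List.prod_cons]; rfl
    rw [hc, map_mul, Module.End.mul_apply, ih hl.2, map_pow, skewRep_x, hpow, List.map_cons,
      List.prod_cons]

theorem skewRep_orderedMonomial (a : Fin n → ℕ) :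
    skewRep k n (orderedMonomial k a) 1 =
      rename Sum.inl (monomial (Finsupp.equivFunOnFinite.symm a) (1 : k)) := by
  rw [orderedMonomial, skewRep_listMonomial _ _ (List.pairwise_lt_finRange n),
    ← List.ofFn_eq_map, List.prod_ofFn, monomial_eq, map_mul,
    Finsupp.prod_fintype _ _ (fun _ => pow_zero _), map_prod]
  simp

/-- A skew polynomial is determined by its action on the polynomial `1`. -/
theorem eq_zero_of_skewRep_one {a : SkewPoly k n} (h : skewRep k n a 1 = 0) : a = 0 := by
  have ha : a ∈ Submodule.span k (Set.range (orderedMonomial k : (Fin n → ℕ) → SkewPoly k n)) := by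
    rw [span_orderedMonomial]; trivial
  obtain ⟨c, rfl⟩ := (Finsupp.mem_span_range_iff_exists_finsupp).1 ha
  have hc : c = 0 := by
    have h2 : rename (Sum.inl : Fin n → Fin n ⊕ Fin (n + 1))
        (c.sum fun a r => monomial (Finsupp.equivFunOnFinite.symm a) r) = 0 := by
      rw [← h, Finsupp.sum, Finsupp.sum, map_sum, map_sum, LinearMap.sum_apply]
      refine Finset.sum_congr rfl fun a _ => ?_
      rw [map_smul, LinearMap.smul_apply, skewRep_orderedMonomial, ← map_smul, smul_monomial,
        smul_eq_mul, mul_one]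
    have h3 := (map_eq_zero_iff _ (rename_injective _ Sum.inl_injective)).1 h2
    ext a
    have h4 := congrArg (MvPolynomial.coeff (Finsupp.equivFunOnFinite.symm a)) h3
    rw [Finsupp.sum, MvPolynomial.coeff_sum] at h4
    simp only [coeff_monomial, EmbeddingLike.apply_eq_iff_eq, MvPolynomial.coeff_zero] at h4
    rw [Finset.sum_ite_eq'] at h4
    by_contra hne
    rw [if_pos (Finsupp.mem_support_iff.2 hne)] at h4
    exact hne h4
  rw [hc, Finsupp.sum_zero_index]

theorem eq_zero_of_sq_mul {f : MvPolynomial (Fin n) k} (hf : f ≠ 0) {a : SkewPoly k n}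
    (h : sq k n f * a = 0) : a = 0 := by
  have h1 : skewRep k n (sq k n f * a) 1 = 0 := by rw [h, map_zero]; rfl
  rw [map_mul, Module.End.mul_apply, skewRep_sq, LinearMap.mulLeft_apply] at h1
  refine eq_zero_of_skewRep_one ((mul_eq_zero.1 h1).resolve_left fun h2 => hf ?_)
  exact squareSubst_injective (h2.trans (map_zero _).symm)

theorem eq_zero_of_mul_sq {f : MvPolynomial (Fin n) k} (hf : f ≠ 0) {a : SkewPoly k n}
    (h : a * sq k n f = 0) : a = 0 :=
  eq_zero_of_sq_mul hf (by rw [sq_mul_comm, h])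

theorem eq_zero_of_mul_x {i : Fin n} {a : SkewPoly k n} (h : a * x k n i = 0) : a = 0 := by
  refine eq_zero_of_mul_sq (X_ne_zero i) ?_
  rw [sq_X, pow_two, ← mul_assoc, h, zero_mul]

theorem mul_x_cancel {i : Fin n} {a b : SkewPoly k n} (h : a * x k n i = b * x k n i) : a = b :=
  sub_eq_zero.1 (eq_zero_of_mul_x (i := i) (by rw [sub_mul, h, sub_self]))

instance : Nontrivial (SkewPoly k n) :=
  (skewRep k n).toRingHom.domain_nontrivial

end SkewPoly

namespace SkewPoly

open MvPolynomial

variable {k : Type u} [Field k] {n : ℕ}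

/-! ### Products of distinct generators -/

variable (k) in
/-- The product of the generators along a list of indices. -/
def word (l : List (Fin n)) : SkewPoly k n := (l.map (x k n)).prod

theorem word_cons (i : Fin n) (l : List (Fin n)) : word k (i :: l) = x k n i * word k l := by
  rw [word, List.map_cons, List.prod_cons]; rfl

theorem word_append (l l' : List (Fin n)) : word k (l ++ l') = word k l * word k l' := by
  rw [word, List.map_append, List.prod_append]; rfl

theorem word_nil : word k ([] : List (Fin n)) = 1 := rfl

theorem word_mem_grading (l : List (Fin n)) : word k l ∈ grading k n l.length := by
  induction l with
  | nil => exact SetLike.GradedOne.one_mem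
  | cons i l ih =>
    rw [word_cons, List.length_cons, add_comm]
    exact SetLike.mul_mem_graded (x_mem_grading i) ih

theorem word_mul_x {i : Fin n} {l : List (Fin n)} (hi : i ∉ l) :
    word k l * x k n i = (-1 : ℤ) ^ l.length • (x k n i * word k l) := by
  induction l with
  | nil => simp [word_nil]
  | cons j l ih =>
    rw [List.mem_cons, not_or] at hi
    rw [word_cons, mul_assoc, ih hi.2, mul_smul_comm, ← mul_assoc, ← mul_assoc,
      x_mul_x k n (Ne.symm hi.1), neg_mul, List.length_cons, pow_succ, mul_neg_one, neg_smul,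
      smul_neg]

theorem word_mul_x_of_mem {i : Fin n} {l : List (Fin n)} (hl : l.Nodup) (hi : i ∈ l) :
    word k l * x k n i = (-1 : ℤ) ^ (l.length - 1) • (x k n i * word k l) := by
  induction l with
  | nil => simp at hi
  | cons j l ih =>
    rw [List.nodup_cons] at hl
    by_cases hij : i = j
    · subst hij
      rw [word_cons, mul_assoc, word_mul_x hl.1, mul_smul_comm, List.length_cons,
        Nat.add_sub_cancel]
    · have hil : i ∈ l := by simpa [hij] using hi
      have hpos := List.length_pos_of_mem hil
      rw [word_cons, mul_assoc, ih hl.2 hil, mul_smul_comm, ← mul_assoc, ← mul_assoc,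
        x_mul_x k n (Ne.symm hij), neg_mul, List.length_cons, Nat.add_sub_cancel]
      obtain ⟨m, hm⟩ : ∃ m, l.length = m + 1 := ⟨l.length - 1, by omega⟩
      rw [hm, Nat.add_sub_cancel, pow_succ, mul_neg_one, neg_smul, smul_neg]

theorem perm_word (σ : Equiv.Perm (Fin n)) (l : List (Fin n)) :
    perm k σ (word k l) = word k (l.map σ) := by
  rw [word, word, map_list_prod, List.map_map, List.map_map]
  congr 1
  exact List.map_congr_left fun i _ => perm_x σ i

theorem map_swap_of_notMem {i j : Fin n} {l : List (Fin n)} (hi : i ∉ l) (hj : j ∉ l) :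
    l.map (Equiv.swap i j) = l := by
  conv_rhs => rw [← List.map_id l]
  refine List.map_congr_left fun c hc => ?_
  exact Equiv.swap_apply_of_ne_of_ne (fun h => hi (h ▸ hc)) (fun h => hj (h ▸ hc))

theorem x_mul_word_map_swap {i j : Fin n} {l : List (Fin n)} (hl : l.Nodup) (hi : i ∉ l)
    (hj : j ∈ l) : x k n j * word k (l.map (Equiv.swap i j)) = -(x k n i * word k l) := by
  induction l with
  | nil => simp at hj
  | cons c l ih =>
    rw [List.nodup_cons] at hl
    rw [List.mem_cons, not_or] at hi
    by_cases hc : j = c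
    · subst hc
      rw [List.map_cons, Equiv.swap_apply_right, word_cons, word_cons,
        map_swap_of_notMem hi.2 hl.1, ← mul_assoc, ← mul_assoc, x_mul_x k n (Ne.symm hi.1), neg_mul]
    · have hjl : j ∈ l := by simpa [hc] using hj
      rw [List.map_cons, Equiv.swap_apply_of_ne_of_ne (Ne.symm hi.1) (Ne.symm hc), word_cons,
        word_cons, ← mul_assoc, x_mul_x k n hc, neg_mul, mul_assoc, ih hl.2 hi.2 hjl, ← mul_assoc,
        x_mul_x k n hi.1, neg_mul, mul_neg, neg_neg, mul_assoc, neg_neg]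

theorem perm_swap_word {i j : Fin n} (hij : i ≠ j) {l : List (Fin n)} (hl : l.Nodup)
    (hi : i ∈ l) (hj : j ∈ l) : perm k (Equiv.swap i j) (word k l) = -word k l := by
  rw [perm_word]
  induction l with
  | nil => simp at hj
  | cons c l ih =>
    rw [List.nodup_cons] at hl
    rw [List.map_cons, word_cons, word_cons]
    by_cases hci : i = c
    · subst hci
      rw [Equiv.swap_apply_left, x_mul_word_map_swap hl.2 hl.1
        (by simpa [Ne.symm hij] using hj)]
    · have hil : i ∈ l := by simpa [hci] using hi
      by_cases hcj : j = c
      · subst hcj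
        rw [Equiv.swap_apply_right, Equiv.swap_comm, x_mul_word_map_swap hl.2 hl.1 hil]
      · rw [Equiv.swap_apply_of_ne_of_ne (Ne.symm hci) (Ne.symm hcj),
          ih hl.2 hil (by simpa [hcj] using hj), mul_neg]

variable (k n) in
/-- The product `x_1 ⋯ x_n` of all generators. -/
abbrev fullProd : SkewPoly k n := initialProd k n n

theorem fullProd_eq_word : fullProd k n = word k (List.finRange n) := by
  rw [fullProd, initialProd, word, List.take_of_length_le (by simp), List.ofFn_eq_map]

theorem fullProd_mem_grading : fullProd k n ∈ grading k n n := by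
  rw [fullProd_eq_word]
  simpa using word_mem_grading (k := k) (List.finRange n)

theorem fullProd_mul_x (i : Fin n) :
    fullProd k n * x k n i = (-1 : ℤ) ^ (n - 1) • (x k n i * fullProd k n) := by
  rw [fullProd_eq_word, word_mul_x_of_mem (List.nodup_finRange n) (List.mem_finRange i),
    List.length_finRange]

theorem perm_fullProd (σ : Equiv.Perm (Fin n)) :
    perm k σ (fullProd k n) = (Equiv.Perm.sign σ : ℤ) • fullProd k n := by
  induction σ using Equiv.Perm.swap_induction_on with
  | one => simp [perm_one]
  | swap_mul σ i j hij ih =>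
    rw [perm_mul, ih, map_zsmul, fullProd_eq_word,
      perm_swap_word hij (List.nodup_finRange n) (List.mem_finRange i) (List.mem_finRange j),
      Equiv.Perm.sign_mul, Equiv.Perm.sign_swap hij]
    simp

theorem exists_word_sq (l : List (Fin n)) (hl : l.Nodup) :
    word k l * word k l =
      (-1 : ℤ) ^ (l.length * (l.length - 1) / 2) • (l.map fun i => x k n i ^ 2).prod := by
  induction l with
  | nil => simp [word_nil]
  | cons i l ih =>
    rw [List.nodup_cons] at hl
    rw [word_cons, mul_assoc, ← mul_assoc (word k l), word_mul_x hl.1, smul_mul_assoc, mul_assoc,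
      ih hl.2, mul_smul_comm, mul_smul_comm, mul_smul_comm, smul_smul, ← mul_assoc, ← pow_two,
      List.map_cons, List.prod_cons, ← pow_add, List.length_cons, Nat.add_sub_cancel]
    congr 2
    have := Nat.triangle_succ l.length
    rw [Nat.add_sub_cancel] at this
    omega

theorem fullProd_mul_self : fullProd k n * fullProd k n =
    (-1 : ℤ) ^ (n * (n - 1) / 2) • sq k n (∏ i, X i) := by
  rw [fullProd_eq_word, exists_word_sq _ (List.nodup_finRange n), List.length_finRange]
  congr 1
  rw [← List.prod_ofFn, map_list_prod, List.ofFn_eq_map, List.map_map]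
  simp only [Function.comp_def, sq_X]

/-! ### Cofactors -/

theorem exists_cofactor (i : Fin n) :
    ∃ w : SkewPoly k n, w * x k n i = fullProd k n ∧ w ∈ grading k n (n - 1) := by
  obtain ⟨l, l', h⟩ := List.append_of_mem (List.mem_finRange i)
  have hnd := List.nodup_finRange n
  rw [h, List.nodup_append, List.nodup_cons] at hnd
  have hlen : l.length + (l'.length + 1) = n := by
    have := congrArg List.length h
    simpa using this.symm
  refine ⟨(-1 : ℤ) ^ l'.length • (word k (l ++ l')), ?_, ?_⟩
  · rw [fullProd_eq_word, h, smul_mul_assoc, word_append, word_append, word_cons, mul_assoc,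
      word_mul_x hnd.2.1.1, mul_smul_comm, smul_smul, ← mul_pow]
    simp
  · have := word_mem_grading (k := k) (l ++ l')
    rw [List.length_append, show l.length + l'.length = n - 1 by omega] at this
    exact zsmul_mem this _

variable (k) in
/-- The element `w_i` with `w_i x_i = x_1 ⋯ x_n`; up to sign, the product of the other
generators. -/
def cofactor (i : Fin n) : SkewPoly k n := (exists_cofactor i).choose

theorem cofactor_mul_x (i : Fin n) : cofactor k i * x k n i = fullProd k n :=
  (exists_cofactor i).choose_spec.1

theorem cofactor_mem_grading (i : Fin n) : cofactor k i ∈ grading k n (n - 1) :=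
  (exists_cofactor i).choose_spec.2

theorem eq_cofactor {i : Fin n} {w : SkewPoly k n} (h : w * x k n i = fullProd k n) :
    w = cofactor k i :=
  mul_x_cancel (h.trans (cofactor_mul_x i).symm)

theorem perm_cofactor (σ : Equiv.Perm (Fin n)) (i : Fin n) :
    perm k σ (cofactor k i) = (Equiv.Perm.sign σ : ℤ) • cofactor k (σ i) := by
  apply mul_x_cancel (i := σ i)
  rw [smul_mul_assoc, cofactor_mul_x, ← perm_x, ← map_mul, cofactor_mul_x, perm_fullProd]

theorem initialProd_pred (hn : 0 < n) :
    initialProd k n (n - 1) = cofactor k ⟨n - 1, by omega⟩ := by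
  apply eq_cofactor
  rw [fullProd, initialProd, initialProd]
  obtain ⟨m, rfl⟩ : ∃ m, n = m + 1 := ⟨n - 1, by omega⟩
  rw [List.ofFn_succ', List.concat_eq_append]
  rw [List.take_of_length_le (l := _ ++ _) (i := m + 1) (by simp), List.prod_append]
  simp
  rfl

theorem cofactor_mul_x_of_ne {i j : Fin n} (h : i ≠ j) :
    cofactor k i * x k n j = (-1 : ℤ) ^ n • (x k n j * cofactor k i) := by
  apply mul_x_cancel (i := i)
  rw [mul_assoc, x_mul_x k n h.symm, mul_neg, ← mul_assoc, cofactor_mul_x, fullProd_mul_x,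
    smul_mul_assoc, mul_assoc, cofactor_mul_x, ← neg_smul]
  congr 1
  obtain ⟨m, rfl⟩ : ∃ m, n = m + 1 := ⟨n - 1, by have := i.2; omega⟩
  rw [Nat.add_sub_cancel, pow_succ]; ring

theorem x_mul_cofactor (i : Fin n) :
    x k n i * cofactor k i = (-1 : ℤ) ^ (n - 1) • fullProd k n := by
  apply mul_x_cancel (i := i)
  rw [mul_assoc, cofactor_mul_x, smul_mul_assoc, fullProd_mul_x, OreAlg.neg_one_pow_smul_smul]

theorem cofactor_mul_fullProd (i : Fin n) :
    cofactor k i * fullProd k n = (-1 : ℤ) ^ (n - 1) • (fullProd k n * cofactor k i) := by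
  apply mul_x_cancel (i := i)
  rw [mul_assoc, fullProd_mul_x, mul_smul_comm, ← mul_assoc, cofactor_mul_x, smul_mul_assoc,
    mul_assoc, cofactor_mul_x]

theorem cofactor_mul_cofactor_mul {i j : Fin n} : cofactor k i * cofactor k j * (x k n j * x k n i) =
    (-1 : ℤ) ^ (n - 1) • (fullProd k n * fullProd k n) := by
  rw [mul_assoc, ← mul_assoc (cofactor k j), cofactor_mul_x, fullProd_mul_x, mul_smul_comm,
    ← mul_assoc, cofactor_mul_x]

theorem cofactor_anticomm {i j : Fin n} (h : i ≠ j) :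
    cofactor k i * cofactor k j = -(cofactor k j * cofactor k i) := by
  apply mul_x_cancel (i := j)
  apply mul_x_cancel (i := i)
  rw [mul_assoc, cofactor_mul_cofactor_mul, mul_assoc, x_mul_x k n h.symm, neg_mul_neg,
    cofactor_mul_cofactor_mul]

theorem cofactor_mul_self (i : Fin n) : cofactor k i * cofactor k i =
    (-1 : ℤ) ^ ((n - 1) * (n - 2) / 2) • sq k n (∏ j ∈ Finset.univ.erase i, X j) := by
  apply mul_x_cancel (i := i)
  apply mul_x_cancel (i := i)
  rw [mul_assoc, cofactor_mul_cofactor_mul, fullProd_mul_self, smul_smul, smul_mul_assoc,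
    smul_mul_assoc, mul_assoc, ← pow_two, ← sq_X, ← map_mul,
    Finset.prod_erase_mul _ _ (Finset.mem_univ i), ← pow_add]
  congr 1
  obtain ⟨m, rfl⟩ : ∃ m, n = m + 1 := ⟨n - 1, by have := i.2; omega⟩
  rw [Nat.add_sub_cancel]
  cases m with
  | zero => simp
  | succ m =>
    have h1 : (m + 1) + (m + 1 + 1) * (m + 1) / 2 = (m + 1) * m / 2 + 2 * (m + 1) := by
      have h1 := Nat.triangle_succ (m + 1)
      have h2 := Nat.triangle_succ m
      simp only [Nat.add_sub_cancel] at h1 h2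
      omega
    rw [h1, pow_add, pow_mul]
    simp

variable (k n) in
/-- The sum of the cofactors; it is the orbit sum of `x_1 ⋯ x_{n-1}`. -/
def cofactorSum : SkewPoly k n := ∑ i, cofactor k i

theorem cofactorSum_mem_grading : cofactorSum k n ∈ grading k n (n - 1) :=
  sum_mem fun i _ => cofactor_mem_grading i

theorem perm_cofactorSum (σ : Equiv.Perm (Fin n)) :
    perm k σ (cofactorSum k n) = (Equiv.Perm.sign σ : ℤ) • cofactorSum k n := by
  rw [cofactorSum, map_sum, Finset.smul_sum]
  simp only [perm_cofactor]
  exact Equiv.sum_comp σ fun i => (Equiv.Perm.sign σ : ℤ) • cofactor k i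

theorem cofactorSum_mul_fullProd : cofactorSum k n * fullProd k n =
    (-1 : ℤ) ^ (n + 1) • (fullProd k n * cofactorSum k n) := by
  rw [cofactorSum, Finset.sum_mul, Finset.mul_sum, Finset.smul_sum]
  refine Finset.sum_congr rfl fun i _ => ?_
  rw [cofactor_mul_fullProd]
  congr 1
  obtain ⟨m, rfl⟩ : ∃ m, n = m + 1 := ⟨n - 1, by have := i.2; omega⟩
  rw [Nat.add_sub_cancel, pow_succ, pow_succ]; ring

theorem cofactor_mul_odd_pow (i j : Fin n) (m : ℕ) :
    cofactor k i * x k n j ^ (2 * m + 1) = (-1 : ℤ) ^ n • (x k n j ^ (2 * m + 1) * cofactor k i) +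
      if i = j then 2 * sq k n (X i ^ m) * fullProd k n else 0 := by
  have hs : ∀ j, x k n j ^ (2 * m) = sq k n (X j ^ m) := fun j => by rw [map_pow, sq_X, pow_mul]
  rw [pow_succ, hs, ← mul_assoc, ← sq_mul_comm, mul_assoc, mul_assoc]
  split_ifs with h
  · subst h
    rw [cofactor_mul_x, x_mul_cofactor, mul_smul_comm, smul_smul, ← pow_add]
    have : n + (n - 1) = 2 * (n - 1) + 1 := by have := i.2; omega
    rw [this, pow_succ, pow_mul]
    simp
    noncomm_ring
  · rw [cofactor_mul_x_of_ne h, mul_smul_comm, add_zero]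

theorem cofactorSum_mul_powerSum (m : ℕ) : cofactorSum k n * powerSum k n (2 * m + 1) =
    (-1 : ℤ) ^ n • (powerSum k n (2 * m + 1) * cofactorSum k n) +
      2 * sq k n (psum (Fin n) k m) * fullProd k n := by
  have h1 : ∀ i, cofactor k i * powerSum k n (2 * m + 1) =
      (-1 : ℤ) ^ n • (powerSum k n (2 * m + 1) * cofactor k i) +
        2 * sq k n (X i ^ m) * fullProd k n := by
    intro i
    rw [powerSum, Finset.mul_sum, Finset.sum_mul, Finset.smul_sum]
    simp only [cofactor_mul_odd_pow]
    rw [Finset.sum_add_distrib, Finset.sum_ite_eq Finset.univ i, if_pos (Finset.mem_univ i)]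
  rw [cofactorSum, Finset.sum_mul, Finset.mul_sum, Finset.smul_sum, psum, map_sum,
    Finset.mul_sum, Finset.sum_mul, ← Finset.sum_add_distrib]
  exact Finset.sum_congr rfl fun i _ => h1 i

theorem sum_sq_of_anticomm {ι R : Type*} [Ring R] (s : Finset ι) (w : ι → R)
    (h : ∀ i ∈ s, ∀ j ∈ s, i ≠ j → w i * w j = -(w j * w i)) :
    (∑ i ∈ s, w i) * (∑ i ∈ s, w i) = ∑ i ∈ s, w i * w i := by
  classical
  induction s using Finset.induction_on with
  | empty => simp
  | insert a s ha ih =>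
    have h1 : (∑ i ∈ s, w i) * w a = -(w a * ∑ i ∈ s, w i) := by
      rw [Finset.sum_mul, Finset.mul_sum, ← Finset.sum_neg_distrib]
      refine Finset.sum_congr rfl fun i hi => h i (Finset.mem_insert_of_mem hi) a
        (Finset.mem_insert_self a s) fun e => ha (e ▸ hi)
    rw [Finset.sum_insert ha, Finset.sum_insert ha, mul_add, add_mul, add_mul, h1,
      ih fun i hi j hj => h i (Finset.mem_insert_of_mem hi) j (Finset.mem_insert_of_mem hj)]
    abel

theorem cofactorSum_mul_self : cofactorSum k n * cofactorSum k n =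
    (-1 : ℤ) ^ ((n - 1) * (n - 2) / 2) • sq k n (∑ i, ∏ j ∈ Finset.univ.erase i, X j) := by
  rw [cofactorSum, sum_sq_of_anticomm _ _ fun i _ j _ h => cofactor_anticomm h, map_sum,
    Finset.smul_sum]
  exact Finset.sum_congr rfl fun i _ => cofactor_mul_self i

theorem pow_mul_pow_anticomm {i j : Fin n} (h : i ≠ j) (a b : ℕ) :
    x k n i ^ (2 * a + 1) * x k n j ^ (2 * b + 1) =
      -(x k n j ^ (2 * b + 1) * x k n i ^ (2 * a + 1)) := by
  have hs : ∀ (j : Fin n) m, x k n j ^ (2 * m + 1) = sq k n (X j ^ m) * x k n j := fun j m => by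
    rw [map_pow, sq_X, ← pow_mul, pow_succ]
  rw [hs, hs, mul_assoc, ← mul_assoc (x k n i), ← sq_mul_comm, mul_assoc, x_mul_x k n h,
    mul_assoc (sq k n (X j ^ b)), ← mul_assoc (x k n j), ← sq_mul_comm, mul_assoc, mul_neg,
    mul_neg, ← mul_assoc, ← mul_assoc, sq_mul_comm (X i ^ a)]
  simp only [mul_assoc]

theorem powerSum_odd_mul_add (a b : ℕ) : powerSum k n (2 * b + 1) * powerSum k n (2 * a + 1) =
    -(powerSum k n (2 * a + 1) * powerSum k n (2 * b + 1)) +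
      2 * sq k n (psum (Fin n) k (a + b + 1)) := by
  have h : ∀ i j, x k n j ^ (2 * b + 1) * x k n i ^ (2 * a + 1) =
      -(x k n i ^ (2 * a + 1) * x k n j ^ (2 * b + 1)) +
        if i = j then 2 * sq k n (X i ^ (a + b + 1)) else 0 := by
    intro i j
    split_ifs with hij
    · subst hij
      rw [← pow_add, ← pow_add, map_pow, sq_X, ← pow_mul,
        show 2 * b + 1 + (2 * a + 1) = 2 * (a + b + 1) by ring,
        show 2 * a + 1 + (2 * b + 1) = 2 * (a + b + 1) by ring]
      noncomm_ring
    · rw [add_zero, pow_mul_pow_anticomm (Ne.symm hij)]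
  rw [powerSum, powerSum, Finset.sum_mul_sum, Finset.sum_comm, Finset.sum_mul_sum, psum, map_sum,
    Finset.mul_sum, ← Finset.sum_neg_distrib, ← Finset.sum_add_distrib]
  refine Finset.sum_congr rfl fun i _ => ?_
  simp only [h]
  rw [Finset.sum_add_distrib, Finset.sum_ite_eq Finset.univ i, if_pos (Finset.mem_univ i),
    Finset.sum_neg_distrib]

theorem powerSum_odd_sq (a : ℕ) : powerSum k n (2 * a + 1) * powerSum k n (2 * a + 1) =
    sq k n (psum (Fin n) k (2 * a + 1)) := by
  rw [powerSum, sum_sq_of_anticomm _ _ fun i _ j _ h => pow_mul_pow_anticomm h a a, psum, map_sum]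
  refine Finset.sum_congr rfl fun i _ => ?_
  rw [map_pow, sq_X, ← pow_two, ← pow_mul, ← pow_mul, mul_comm]

end SkewPoly

namespace SkewPoly

open MvPolynomial SignModel

variable {k : Type u} [Field k] {n : ℕ}

/-! ### The homomorphism from `C` to the skew polynomial ring -/

theorem powerSum_mem_grading (m : ℕ) : powerSum k n m ∈ grading k n m := by
  refine sum_mem fun i _ => ?_
  have := SetLike.pow_mem_graded m (x_mem_grading (k := k) i)
  rwa [smul_eq_mul, mul_one] at this

theorem fullProd_mul_pow (i : Fin n) (m : ℕ) : fullProd k n * x k n i ^ (2 * m + 1) =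
    (-1 : ℤ) ^ (n - 1) • (x k n i ^ (2 * m + 1) * fullProd k n) := by
  have hs : x k n i ^ (2 * m + 1) = sq k n (X i ^ m) * x k n i := by
    rw [map_pow, sq_X, ← pow_mul, pow_succ]
  rw [hs, ← mul_assoc, ← sq_mul_comm, mul_assoc, mul_assoc, fullProd_mul_x, mul_smul_comm]

theorem fullProd_mul_powerSum (m : ℕ) : fullProd k n * powerSum k n (2 * m + 1) =
    (-1 : ℤ) ^ (n - 1) • (powerSum k n (2 * m + 1) * fullProd k n) := by
  rw [powerSum, Finset.mul_sum, Finset.sum_mul, Finset.smul_sum]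
  exact Finset.sum_congr rfl fun i _ => fullProd_mul_pow i m

variable (k n) in
/-- The images in the skew polynomial ring of the generators of `C`. -/
def gen (i : ℕ) : SkewPoly k n :=
  if i + 1 < n then powerSum k n (2 * i + 1) else if i + 1 = n then fullProd k n
  else cofactorSum k n

theorem gen_of_lt {i : ℕ} (h : i + 1 < n) : gen k n i = powerSum k n (2 * i + 1) := if_pos h

theorem gen_pred (hn : 1 ≤ n) : gen k n (n - 1) = fullProd k n := by
  rw [gen, if_neg (by omega), if_pos (by omega)]

theorem gen_self : gen k n n = cofactorSum k n := by
  rw [gen, if_neg (by omega), if_neg (by omega)]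

variable (k n) in
theorem exists_toSkewPoly : ∃ F : OreAlg k n →ₐ[k] SkewPoly k n,
    (∀ f, F (OreAlg.coeff k n f) = sq k n (esymmMap k n f)) ∧
      ∀ i : Fin (n + 1), F (OreAlg.y k n i) = gen k n i := by
  have h2 : ∀ m, sq k n (esymmMap k n (2 * powerSumPoly k n m)) =
      2 * sq k n (psum (Fin n) k m) := fun m => by
    rw [map_mul, map_mul, esymmMap_powerSumPoly, map_ofNat, map_ofNat]
  refine OreAlg.exists_lift ((sq k n).comp (esymmMap k n)) (fun i => gen k n i)
    (fun f i => sq_mul_comm _ _) fun i j hij => ?_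
  have hij' := Fin.lt_def.1 hij
  simp only [AlgHom.comp_apply, h2]
  split_ifs with h h'
  · rw [gen_of_lt h, gen_of_lt (by omega), powerSum_odd_mul_add, oreSign, if_pos h, neg_smul,
      one_smul]
  · rw [h'.1, gen_self, gen_of_lt h'.2, gen_pred (by omega), cofactorSum_mul_powerSum, oreSign,
      if_neg (by omega), if_neg (by omega), if_pos h'.2]
  · rw [add_zero]
    by_cases hj : (j : ℕ) + 1 = n
    · rw [gen_of_lt (show (i : ℕ) + 1 < n by omega), show (j : ℕ) = n - 1 by omega,
        gen_pred (by omega), fullProd_mul_powerSum, oreSign, if_neg (by omega), if_pos (by omega)]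
    · have hj' : (j : ℕ) = n := by omega
      rw [hj', show (i : ℕ) = n - 1 by omega, gen_self, gen_pred (by omega),
        cofactorSum_mul_fullProd, oreSign, if_neg (by omega), if_neg (by omega),
        if_neg (by omega)]

variable (k n) in
/-- The homomorphism from `C` to the skew polynomial ring. -/
def toSkewPoly : OreAlg k n →ₐ[k] SkewPoly k n := (exists_toSkewPoly k n).choose

theorem toSkewPoly_coeff (f : MvPolynomial (Fin n) k) :
    toSkewPoly k n (OreAlg.coeff k n f) = sq k n (esymmMap k n f) :=
  (exists_toSkewPoly k n).choose_spec.1 f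

theorem toSkewPoly_y (i : Fin (n + 1)) : toSkewPoly k n (OreAlg.y k n i) = gen k n i :=
  (exists_toSkewPoly k n).choose_spec.2 i

/-! ### The model representation of `C` -/

/-- The sign with which `T_j` passes through the generators `x_l`. -/
def passSign (n j : ℕ) : ℤ := if j + 1 < n then -1 else if j + 1 = n then 1 else (-1) ^ n

theorem op_mul_skewRep (j : Fin (n + 1)) (a : SkewPoly k n) :
    op k (modelSign n) (.inr j) * skewRep k n a =
      skewRep k n (scale (passSign n j) a) * op k (modelSign n) (.inr j) := by
  induction a using SkewPoly.induction with
  | hc c => rw [AlgHom.commutes, AlgHom.commutes, AlgHom.commutes, Algebra.commutes]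
  | hx i =>
    rw [scale_x, map_zsmul, skewRep_x, op_mul_op modelSign_mul_self, smul_mul_assoc]
    congr 1
    simp [modelSign, passSign]
  | hmul a b ha hb => rw [map_mul, ← mul_assoc, ha, mul_assoc, hb, map_mul, map_mul, mul_assoc]
  | hadd a b ha hb => rw [map_add, mul_add, ha, hb, map_add, map_add, add_mul]

theorem op_mul_skewRep_of_mem (j : Fin (n + 1)) {d : ℕ} {a : SkewPoly k n}
    (ha : a ∈ grading k n d) : op k (modelSign n) (.inr j) * skewRep k n a =
      passSign n j ^ d • (skewRep k n a * op k (modelSign n) (.inr j)) := by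
  rw [op_mul_skewRep, scale_of_mem _ ha, map_zsmul, smul_mul_assoc]

theorem op_mul_op_of_lt {i j : Fin (n + 1)} (h : i < j) :
    op k (modelSign n) (.inr j) * op k (modelSign n) (.inr i) =
      (if (j : ℕ) + 1 ≤ n then -1 else if (i : ℕ) + 1 < n then (-1 : ℤ) ^ n else -1) •
        (op k (modelSign n) (.inr i) * op k (modelSign n) (.inr j)) := by
  rw [op_mul_op modelSign_mul_self]
  congr 1
  simp only [modelSign]
  rw [if_pos h, if_neg h.not_gt, mul_one]

variable (k n) in
/-- The image of the generator `y j` of `C` under the model representation is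
`modelTail j + modelLead j * T_j`. -/
def modelLead (j : ℕ) : SkewPoly k n := if j + 1 = n then fullProd k n else 1

variable (k n) in
/-- The image of the generator `y j` of `C` under the model representation is
`modelTail j + modelLead j * T_j`. -/
def modelTail (j : ℕ) : Module.End k (MvPolynomial (Fin n ⊕ Fin (n + 1)) k) :=
  if j + 1 < n then skewRep k n (powerSum k n (2 * j + 1)) else if j + 1 = n then 0
  else skewRep k n (cofactorSum k n) * op k (modelSign n) (.inr ⟨n - 1, by omega⟩)

variable (k n) in
/-- The operators by which the generators of `C` act on the model space. -/
def modelGen (j : Fin (n + 1)) : Module.End k (MvPolynomial (Fin n ⊕ Fin (n + 1)) k) :=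
  modelTail k n j + skewRep k n (modelLead k n j) * op k (modelSign n) (.inr j)

theorem modelGen_of_lt {j : Fin (n + 1)} (h : (j : ℕ) + 1 < n) : modelGen k n j =
    skewRep k n (powerSum k n (2 * j + 1)) + op k (modelSign n) (.inr j) := by
  rw [modelGen, modelTail, if_pos h, modelLead, if_neg (by omega), map_one, one_mul]

theorem modelGen_pred (hn : 1 ≤ n) {j : Fin (n + 1)} (h : (j : ℕ) = n - 1) : modelGen k n j =
    skewRep k n (fullProd k n) * op k (modelSign n) (.inr j) := by
  rw [modelGen, modelTail, if_neg (by omega), if_pos (by omega), modelLead, if_pos (by omega),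
    zero_add]

theorem modelGen_last {j : Fin (n + 1)} (h : (j : ℕ) = n) : modelGen k n j =
    skewRep k n (cofactorSum k n) * op k (modelSign n) (.inr ⟨n - 1, by omega⟩) +
      op k (modelSign n) (.inr j) := by
  rw [modelGen, modelTail, if_neg (by omega), if_neg (by omega), modelLead, if_neg (by omega),
    map_one, one_mul]

section Identities

variable {D : Type*} [Ring D]

theorem odd_odd_identity {A B η θ c : D} (h1 : B * A = -(A * B) + c) (h2 : θ * A = -(A * θ))
    (h3 : η * B = -(B * η)) (h4 : θ * η = -(η * θ)) :
    (B + θ) * (A + η) = (-1 : ℤ) • ((A + η) * (B + θ)) + c := by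
  linear_combination (norm := noncomm_ring) h1 + h2 + h3 + h4

theorem full_odd_identity {A U η s : D} {e : ℤ} (he : e = 1 ∨ e = -1)
    (h1 : U * A = e • (A * U)) (h2 : s * A = A * s) (h3 : s * η = -(η * s))
    (h4 : η * U = -(e • (U * η))) : U * s * (A + η) = e • ((A + η) * (U * s)) := by
  rcases he with rfl | rfl
  · linear_combination (norm := noncomm_ring) U * h2 + h1 * s + U * h3 - h4 * s
  · linear_combination (norm := noncomm_ring) U * h2 + h1 * s + U * h3 + h4 * s

theorem cofactor_odd_identity {A U V η s N c : D} {e : ℤ} (he : e = 1 ∨ e = -1)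
    (h1 : V * A = e • (A * V) + c * U) (h2 : s * A = A * s) (h3 : s * η = -(η * s))
    (h4 : η * V = -(e • (V * η))) (h5 : N * A = e • (A * N)) (h6 : N * η = e • (η * N)) :
    (V * s + N) * (A + η) = e • ((A + η) * (V * s + N)) + c * (U * s) := by
  rcases he with rfl | rfl
  · linear_combination (norm := noncomm_ring) V * h2 + h1 * s + V * h3 - h4 * s + h5 + h6
  · linear_combination (norm := noncomm_ring) V * h2 + h1 * s + V * h3 + h4 * s + h5 + h6

theorem cofactor_full_identity {U V s N : D} {e : ℤ} (he : e = 1 ∨ e = -1)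
    (h1 : V * U = e • (U * V)) (h2 : s * U = U * s) (h3 : s * V = V * s)
    (h4 : N * U = -(e • (U * N))) (h5 : N * s = -(s * N)) :
    (V * s + N) * (U * s) = e • (U * s * (V * s + N)) := by
  rcases he with rfl | rfl
  · linear_combination (norm := noncomm_ring) V * h2 * s + h1 * s * s - U * h3 * s + h4 * s - U * h5
  · linear_combination (norm := noncomm_ring) V * h2 * s + h1 * s * s + U * h3 * s + h4 * s + U * h5

end Identities

theorem neg_one_pow_eq (m : ℕ) : (-1 : ℤ) ^ m = 1 ∨ (-1 : ℤ) ^ m = -1 := neg_one_pow_eq_or ℤ m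

theorem neg_one_pow_pred (hn : 1 ≤ n) : (-1 : ℤ) ^ (n - 1) = -(-1) ^ n := by
  obtain ⟨m, rfl⟩ : ∃ m, n = m + 1 := ⟨n - 1, by omega⟩
  rw [Nat.add_sub_cancel, pow_succ]; ring

theorem neg_one_pow_odd (m : ℕ) : (-1 : ℤ) ^ (2 * m + 1) = -1 := by
  rw [pow_succ, pow_mul]; simp

variable (k n) in
theorem exists_model : ∃ F : OreAlg k n →ₐ[k] Module.End k (MvPolynomial (Fin n ⊕ Fin (n + 1)) k),
    (∀ f, F (OreAlg.coeff k n f) = skewRep k n (sq k n (esymmMap k n f))) ∧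
      ∀ j, F (OreAlg.y k n j) = modelGen k n j := by
  have h2 : ∀ m, skewRep k n (sq k n (esymmMap k n (2 * powerSumPoly k n m))) =
      skewRep k n (2 * sq k n (psum (Fin n) k m)) := fun m => by
    rw [map_mul, map_mul, esymmMap_powerSumPoly, map_ofNat, map_ofNat]
  refine OreAlg.exists_lift (((skewRep k n).comp (sq k n)).comp (esymmMap k n)) (modelGen k n)
    (fun f j => ?_) fun i j hij => ?_
  · have hE : ∀ a, skewRep k n (sq k n (esymmMap k n f)) * skewRep k n a =
        skewRep k n a * skewRep k n (sq k n (esymmMap k n f)) := fun a => by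
      rw [← map_mul, ← map_mul, sq_mul_comm]
    have hT : ∀ j, skewRep k n (sq k n (esymmMap k n f)) * op k (modelSign n) (.inr j) =
        op k (modelSign n) (.inr j) * skewRep k n (sq k n (esymmMap k n f)) := fun j => by
      rw [op_mul_skewRep]
      congr 2
      have : (scale (passSign n j)).comp (sq k n) = sq k n := by
        ext i : 1
        rw [AlgHom.comp_apply, sq_X, map_pow, scale_x, smul_pow]
        have : passSign n j ^ 2 = 1 := by
          unfold passSign; split_ifs <;> simp [← pow_mul]
        rw [this, one_smul]
      exact (AlgHom.congr_fun this _).symm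
    change skewRep k n (sq k n (esymmMap k n f)) * _ = _ * skewRep k n (sq k n (esymmMap k n f))
    rw [modelGen, mul_add, add_mul, ← mul_assoc, hE, mul_assoc, hT, mul_assoc]
    congr 1
    rw [modelTail]
    split_ifs
    · rw [hE]
    · rw [mul_zero, zero_mul]
    · rw [← mul_assoc, hE, mul_assoc, hT, mul_assoc]
  have hij' := Fin.lt_def.1 hij
  simp only [AlgHom.comp_apply, h2]
  have hpass : ∀ {j : Fin (n + 1)}, (j : ℕ) + 1 < n → passSign n j = -1 := fun h => if_pos h
  have hpass' : ∀ {j : Fin (n + 1)}, (j : ℕ) + 1 = n → passSign n j = 1 := fun h => by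
    rw [passSign, if_neg (by omega), if_pos h]
  have hpass'' : ∀ {j : Fin (n + 1)}, (j : ℕ) = n → passSign n j = (-1) ^ n := fun h => by
    rw [passSign, if_neg (by omega), if_neg (by omega)]
  have hs := fun (a : SkewPoly k n) d (ha : a ∈ grading k n d) =>
    op_mul_skewRep_of_mem (k := k) (⟨n - 1, by omega⟩ : Fin (n + 1)) ha
  split_ifs with h h'
  · have hi : (i : ℕ) + 1 < n := by omega
    rw [modelGen_of_lt h, modelGen_of_lt hi, oreSign, if_pos h]
    refine odd_odd_identity ?_ ?_ ?_ ?_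
    · rw [← map_mul, powerSum_odd_mul_add, map_add, map_neg, map_mul]
    · rw [op_mul_skewRep_of_mem _ (powerSum_mem_grading _), hpass h, neg_one_pow_odd, neg_smul,
        one_smul]
    · rw [op_mul_skewRep_of_mem _ (powerSum_mem_grading _), hpass hi, neg_one_pow_odd, neg_smul,
        one_smul]
    · rw [op_mul_op_of_lt hij, if_pos (by omega), neg_smul, one_smul]
  · obtain ⟨hj, hi⟩ := h'
    have hs1 : (((⟨n - 1, by omega⟩ : Fin (n + 1)) : ℕ)) + 1 = n := by simp only; omega
    rw [modelGen_last hj, modelGen_of_lt hi, modelGen_pred (by omega) (by simp), oreSign,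
      if_neg (by omega), if_neg (by omega), if_pos hi]
    refine cofactor_odd_identity (neg_one_pow_eq n) ?_ ?_ ?_ ?_ ?_ ?_
    · rw [← map_mul, cofactorSum_mul_powerSum, map_add, map_zsmul, map_mul, map_mul]
    · rw [hs _ _ (powerSum_mem_grading _), hpass' hs1, one_pow, one_smul]
    · rw [op_mul_op_of_lt (Fin.lt_def.2 (by simp; omega)), if_pos (by omega), neg_smul, one_smul]
    · rw [op_mul_skewRep_of_mem _ cofactorSum_mem_grading, hpass hi, neg_one_pow_pred (by omega),
        neg_smul]
    · rw [op_mul_skewRep_of_mem _ (powerSum_mem_grading _), hpass'' hj, ← pow_mul, mul_comm n,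
        pow_mul, neg_one_pow_odd]
    · rw [op_mul_op_of_lt hij, if_neg (by omega), if_pos hi]
  · rw [add_zero]
    by_cases hj : (j : ℕ) + 1 = n
    · have hi : (i : ℕ) + 1 < n := by omega
      rw [modelGen_of_lt hi, modelGen_pred (by omega) (show (j : ℕ) = n - 1 by omega), oreSign,
        if_neg (by omega), if_pos (by omega)]
      refine full_odd_identity (neg_one_pow_eq _) ?_ ?_ ?_ ?_
      · rw [← map_mul, fullProd_mul_powerSum, map_zsmul, map_mul]
      · rw [op_mul_skewRep_of_mem _ (powerSum_mem_grading _), hpass' hj, one_pow, one_smul]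
      · rw [op_mul_op_of_lt hij, if_pos (by omega), neg_smul, one_smul]
      · rw [op_mul_skewRep_of_mem _ fullProd_mem_grading, hpass hi, neg_one_pow_pred (by omega),
          neg_smul, neg_neg]
    · have hj' : (j : ℕ) = n := by omega
      have hi' : i = ⟨n - 1, by omega⟩ := Fin.ext (by simp only; omega)
      have hs1 : (((⟨n - 1, by omega⟩ : Fin (n + 1)) : ℕ)) + 1 = n := by simp only; omega
      rw [modelGen_last hj', modelGen_pred (by omega) (show (i : ℕ) = n - 1 by omega), oreSign,
        if_neg (by omega), if_neg (by omega), if_neg (by omega), hi']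
      refine cofactor_full_identity (neg_one_pow_eq _) ?_ ?_ ?_ ?_ ?_
      · rw [← map_mul, cofactorSum_mul_fullProd, map_zsmul, map_mul]
      · rw [hs _ _ fullProd_mem_grading, hpass' hs1, one_pow, one_smul]
      · rw [hs _ _ cofactorSum_mem_grading, hpass' hs1, one_pow, one_smul]
      · rw [op_mul_skewRep_of_mem _ fullProd_mem_grading, hpass'' hj', pow_succ, mul_neg_one,
          neg_smul, neg_neg]
        congr 1
        rcases neg_one_pow_eq n with h | h
        · rw [h, one_pow]
        · rw [h, h]
      · rw [op_mul_op_of_lt (hi' ▸ hij), if_neg (by omega), if_neg (by simp; omega), neg_smul,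
          one_smul]

variable (k n) in
/-- The representation of `C` on the model space. -/
def model : OreAlg k n →ₐ[k] Module.End k (MvPolynomial (Fin n ⊕ Fin (n + 1)) k) :=
  (exists_model k n).choose

theorem model_coeff (f : MvPolynomial (Fin n) k) :
    model k n (OreAlg.coeff k n f) = skewRep k n (sq k n (esymmMap k n f)) :=
  (exists_model k n).choose_spec.1 f

theorem model_y (j : Fin (n + 1)) : model k n (OreAlg.y k n j) = modelGen k n j :=
  (exists_model k n).choose_spec.2 j

end SkewPoly

/-! ### Ore extensions from skew commutation relations -/

theorem IsOreExtension.exists_evalPowers_of_mem_adjoin {k : Type u} [Field k] {C : Type u} [Ring C]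
    [Algebra k C] {S : Subalgebra k C} {y : C} {G : Set C}
    (hrel : ∀ s ∈ S, ∃ s' ∈ S, ∃ s'' ∈ S, y * s = s' * y + s'') (hG : ∀ g ∈ G, g ∈ S ∨ g = y)
    {t : C} (ht : t ∈ Algebra.adjoin k G) : ∃ f : ℕ →₀ S, t = evalPowers S y f := by
  have hS : ∀ s ∈ S, ∀ f : ℕ →₀ S, ∃ g, s * evalPowers S y f = evalPowers S y g := fun s hs f =>
    ⟨(⟨s, hs⟩ : S) • f, (evalPowers_smul S y ⟨s, hs⟩ f).symm⟩
  have hy : ∀ f : ℕ →₀ S, ∃ g, y * evalPowers S y f = evalPowers S y g := by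
    intro f
    induction f using Finsupp.induction_linear with
    | zero => exact ⟨0, by rw [map_zero, mul_zero]⟩
    | add f g hf hg =>
      obtain ⟨f', hf⟩ := hf
      obtain ⟨g', hg⟩ := hg
      exact ⟨f' + g', by rw [map_add, mul_add, hf, hg, map_add]⟩
    | single i s =>
      obtain ⟨s', hs', s'', hs'', h⟩ := hrel s s.2
      refine ⟨Finsupp.single (i + 1) ⟨s', hs'⟩ + Finsupp.single i ⟨s'', hs''⟩, ?_⟩
      rw [map_add, evalPowers_single, evalPowers_single, evalPowers_single, ← mul_assoc, h, add_mul,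
        mul_assoc, ← pow_succ']
  have key : ∀ f : ℕ →₀ S, ∃ g, t * evalPowers S y f = evalPowers S y g := by
    induction ht using Algebra.adjoin_induction with
    | mem g hg =>
      rcases hG g hg with h | rfl
      · exact hS g h
      · exact hy
    | algebraMap c => exact hS _ (Subalgebra.algebraMap_mem S c)
    | add a b _ _ ha hb =>
      intro f
      obtain ⟨f', hf⟩ := ha f
      obtain ⟨g', hg⟩ := hb f
      exact ⟨f' + g', by rw [add_mul, hf, hg, map_add]⟩
    | mul a b _ _ ha hb =>
      intro f
      obtain ⟨f', hf⟩ := hb f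
      obtain ⟨g', hg⟩ := ha f'
      exact ⟨g', by rw [mul_assoc, hf, hg]⟩
  obtain ⟨g, hg⟩ := key (Finsupp.single 0 1)
  refine ⟨g, ?_⟩
  rw [← hg, evalPowers_single, pow_zero, OneMemClass.coe_one, mul_one, mul_one]

/-! ### Leading terms in Weyl-type relations -/

section Weyl

variable {R : Type*} [Ring R] {D Y γ : R}

theorem pow_succ_mul_of_weyl (h : D * Y = Y * D + γ) (hγ : D * γ = γ * D) (m : ℕ) :
    D ^ (m + 1) * Y = Y * D ^ (m + 1) + (m + 1) • (γ * D ^ m) := by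
  induction m with
  | zero => simp [h]
  | succ m ih =>
    rw [pow_succ' D (m + 1), mul_assoc, ih, mul_add, ← mul_assoc, h, mul_smul_comm, ← mul_assoc D γ,
      hγ, add_mul, mul_assoc, mul_assoc, ← pow_succ' D m, add_assoc, ← succ_nsmul']

variable {k M : Type*} [Field k] [AddCommGroup M] [Module k M] {D Y γ : Module.End k M}

/-- A variant of `D ^ m Y ^ m = m!` for operators with `D Y = Y D + γ`, on the kernel of `D`. -/
theorem weyl_leading (h : D * Y = Y * D + γ) (hγ : D * γ = γ * D) {f : M} (hf : D f = 0) (m : ℕ) :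
    (D ^ m) ((Y ^ m) f) = m.factorial • (γ ^ m) f ∧ (D ^ (m + 1)) ((Y ^ m) f) = 0 := by
  induction m with
  | zero => simpa using hf
  | succ m ih =>
    have h1 : ∀ m g, (D ^ (m + 1)) (Y g) = Y ((D ^ (m + 1)) g) + (m + 1) • γ ((D ^ m) g) :=
      fun m g => by
        have := LinearMap.congr_fun (pow_succ_mul_of_weyl h hγ m) g
        simpa [add_smul] using this
    constructor
    · rw [pow_succ' Y, Module.End.mul_apply, h1, ih.2, map_zero, zero_add, ih.1, map_nsmul,
        smul_smul, Nat.factorial_succ, pow_succ' γ, Module.End.mul_apply]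
    · have h2 : (D ^ (m + 1 + 1)) ((Y ^ m) f) = 0 := by
        rw [pow_succ', Module.End.mul_apply, ih.2, map_zero]
      rw [pow_succ' Y, Module.End.mul_apply, h1, h2, ih.2, map_zero, map_zero, smul_zero, add_zero]

theorem weyl_vanishing (h : D * Y = Y * D + γ) (hγ : D * γ = γ * D) {f : M} (hf : D f = 0)
    {i m : ℕ} (him : i < m) : (D ^ m) ((Y ^ i) f) = 0 := by
  obtain ⟨d, rfl⟩ : ∃ d, m = d + (i + 1) := ⟨m - (i + 1), by omega⟩
  rw [pow_add, Module.End.mul_apply, (weyl_leading h hγ hf i).2, map_zero]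

end Weyl

namespace SkewPoly

open MvPolynomial SignModel

variable {k : Type u} [Field k] {n : ℕ}

variable (k) in
/-- Differentiation of the model space with respect to the variable of the generator `y i`. -/
def modelDeriv (i : Fin (n + 1)) : Module.End k (MvPolynomial (Fin n ⊕ Fin (n + 1)) k) :=
  (pderiv (Sum.inr i)).toLinearMap

theorem modelDeriv_apply (i : Fin (n + 1)) (f : MvPolynomial (Fin n ⊕ Fin (n + 1)) k) :
    modelDeriv k i f = pderiv (Sum.inr i) f := rfl

theorem modelDeriv_mul_op {a : Fin n ⊕ Fin (n + 1)} {i : Fin (n + 1)} (ha : a ≠ Sum.inr i)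
    (hs : modelSign n a (Sum.inr i) = 1) :
    modelDeriv k i * op k (modelSign n) a = op k (modelSign n) a * modelDeriv k i := by
  refine LinearMap.ext fun f => ?_
  rw [Module.End.mul_apply, Module.End.mul_apply, op_apply, op_apply, modelDeriv_apply,
    modelDeriv_apply, Derivation.leibniz, pderiv_X_of_ne ha, smul_zero, add_zero, pderiv_twist, hs,
    one_smul, smul_eq_mul]

theorem modelDeriv_mul_op_self (i : Fin (n + 1)) :
    modelDeriv k i * op k (modelSign n) (.inr i) = op k (modelSign n) (.inr i) * modelDeriv k i +
      (twist k (modelSign n) (.inr i)).toLinearMap := by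
  refine LinearMap.ext fun f => ?_
  rw [LinearMap.add_apply, Module.End.mul_apply, Module.End.mul_apply, op_apply, op_apply,
    modelDeriv_apply, modelDeriv_apply, Derivation.leibniz, pderiv_X_self, pderiv_twist,
    modelSign_self, one_smul, smul_eq_mul, smul_eq_mul, mul_one]
  rfl

theorem modelDeriv_mul_skewRep (i : Fin (n + 1)) (a : SkewPoly k n) :
    modelDeriv k i * skewRep k n a = skewRep k n a * modelDeriv k i := by
  induction a using SkewPoly.induction with
  | hc c => rw [AlgHom.commutes, Algebra.commutes]
  | hx l => rw [skewRep_x, modelDeriv_mul_op (by simp) rfl]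
  | hmul a b ha hb => rw [map_mul, ← mul_assoc, ha, mul_assoc, hb, mul_assoc]
  | hadd a b ha hb => rw [map_add, mul_add, ha, hb, add_mul]

theorem modelDeriv_mul_op_of_lt {i j : Fin (n + 1)} (h : i < j) :
    modelDeriv k j * op k (modelSign n) (.inr i) = op k (modelSign n) (.inr i) * modelDeriv k j :=
  modelDeriv_mul_op (by simpa using h.ne) (by simp [modelSign, h.not_gt])

theorem modelDeriv_mul_tail (hn : 1 ≤ n) {i : Fin (n + 1)} {j : ℕ} (h : j ≤ i) :
    modelDeriv k i * modelTail k n j = modelTail k n j * modelDeriv k i := by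
  rw [modelTail]
  split_ifs with h1 h2
  · exact modelDeriv_mul_skewRep _ _
  · rw [mul_zero, zero_mul]
  · have := i.2
    rw [← mul_assoc, modelDeriv_mul_skewRep, mul_assoc,
      modelDeriv_mul_op_of_lt (Fin.lt_def.2 (by simp only; omega)), mul_assoc]

theorem modelDeriv_mul_gen (hn : 1 ≤ n) {i j : Fin (n + 1)} (h : j < i) :
    modelDeriv k i * modelGen k n j = modelGen k n j * modelDeriv k i := by
  rw [modelGen, mul_add, modelDeriv_mul_tail hn (Fin.le_def.1 h.le), ← mul_assoc,
    modelDeriv_mul_skewRep, mul_assoc, modelDeriv_mul_op_of_lt h, add_mul, mul_assoc]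

theorem modelDeriv_mul_model (hn : 1 ≤ n) {j : ℕ} {i : Fin (n + 1)} (h : j ≤ i) {s : OreAlg k n}
    (hs : s ∈ OreAlg.tower k n j) :
    modelDeriv k i * model k n s = model k n s * modelDeriv k i := by
  induction hs using Algebra.adjoin_induction with
  | mem g hg =>
    rcases hg with ⟨f, rfl⟩ | ⟨m, hm, rfl⟩
    · rw [model_coeff, modelDeriv_mul_skewRep]
    · rw [model_y, modelDeriv_mul_gen hn (Fin.lt_def.2 (lt_of_lt_of_le hm h))]
  | algebraMap c => rw [AlgHom.commutes, Algebra.commutes]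
  | add a b _ _ ha hb => rw [map_add, mul_add, ha, hb, add_mul]
  | mul a b _ _ ha hb => rw [map_mul, ← mul_assoc, ha, mul_assoc, hb, mul_assoc]

theorem twist_mul_skewRep (j : Fin (n + 1)) (a : SkewPoly k n) :
    (twist k (modelSign n) (.inr j)).toLinearMap * skewRep k n a =
      skewRep k n (scale (passSign n j) a) * (twist k (modelSign n) (.inr j)).toLinearMap := by
  induction a using SkewPoly.induction with
  | hc c => rw [AlgHom.commutes, AlgHom.commutes, AlgHom.commutes, Algebra.commutes]
  | hx i =>
    rw [scale_x, map_zsmul, skewRep_x]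
    refine LinearMap.ext fun f => ?_
    rw [smul_mul_assoc, LinearMap.smul_apply, Module.End.mul_apply, Module.End.mul_apply, op_apply,
      op_apply, AlgHom.toLinearMap_apply, AlgHom.toLinearMap_apply, map_mul, twist_X, twist_comm,
      smul_mul_assoc]
    rfl
  | hmul a b ha hb => rw [map_mul, ← mul_assoc, ha, mul_assoc, hb, map_mul, map_mul, mul_assoc]
  | hadd a b ha hb => rw [map_add, mul_add, ha, hb, map_add, map_add, add_mul]

theorem scale_sq (j : ℕ) (f : MvPolynomial (Fin n) k) :
    scale (passSign n j) (sq k n f) = sq k n f := by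
  have : (scale (passSign n j)).comp (sq k n) = sq k n := by
    ext i : 1
    rw [AlgHom.comp_apply, sq_X, map_pow, scale_x, smul_pow]
    have : passSign n j ^ 2 = 1 := by
      unfold passSign; split_ifs <;> simp [← pow_mul]
    rw [this, one_smul]
  exact AlgHom.congr_fun this _

theorem model_mul_skewRep_sq (c : OreAlg k n) (f : MvPolynomial (Fin n) k) :
    model k n c * skewRep k n (sq k n f) = skewRep k n (sq k n f) * model k n c := by
  have hE : ∀ a, skewRep k n a * skewRep k n (sq k n f) =
      skewRep k n (sq k n f) * skewRep k n a := fun a => by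
    rw [← map_mul, ← map_mul, sq_mul_comm]
  have hT : ∀ j, op k (modelSign n) (.inr j) * skewRep k n (sq k n f) =
      skewRep k n (sq k n f) * op k (modelSign n) (.inr j) := fun j => by
    rw [op_mul_skewRep, scale_sq]
  induction c using OreAlg.induction with
  | hc g => rw [model_coeff, hE]
  | hy j =>
    rw [model_y, modelGen, mul_add, add_mul, mul_assoc, hT, ← mul_assoc, hE, mul_assoc]
    congr 1
    rw [modelTail]
    split_ifs
    · rw [hE]
    · rw [mul_zero, zero_mul]
    · rw [mul_assoc, hT, ← mul_assoc, hE, mul_assoc]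
  | hmul a b ha hb => rw [map_mul, mul_assoc, hb, ← mul_assoc, ha, mul_assoc]
  | hadd a b ha hb => rw [map_add, add_mul, ha, hb, mul_add]

/-- The coefficient with which the generator `y j` of `C` raises the degree in its variable. -/
def leadOp (k : Type u) [Field k] {n : ℕ} (j : Fin (n + 1)) :
    Module.End k (MvPolynomial (Fin n ⊕ Fin (n + 1)) k) :=
  skewRep k n (modelLead k n j) * (twist k (modelSign n) (.inr j)).toLinearMap

theorem modelDeriv_mul_modelGen_self (hn : 1 ≤ n) (j : Fin (n + 1)) :
    modelDeriv k j * modelGen k n j = modelGen k n j * modelDeriv k j + leadOp k j := by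
  rw [modelGen, mul_add, modelDeriv_mul_tail hn le_rfl, ← mul_assoc, modelDeriv_mul_skewRep, mul_assoc,
    modelDeriv_mul_op_self, mul_add, add_mul, mul_assoc, add_assoc]
  rfl

theorem modelDeriv_mul_leadOp {i j : Fin (n + 1)} (h : j ≤ i) :
    modelDeriv k i * leadOp k j = leadOp k j * modelDeriv k i := by
  have : modelDeriv k i * (twist k (modelSign n) (.inr j)).toLinearMap =
      (twist k (modelSign n) (.inr j)).toLinearMap * modelDeriv k i := by
    refine LinearMap.ext fun f => ?_
    rw [Module.End.mul_apply, Module.End.mul_apply, modelDeriv_apply, modelDeriv_apply,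
      AlgHom.toLinearMap_apply, AlgHom.toLinearMap_apply, pderiv_twist]
    simp [modelSign, h.not_gt]
  rw [leadOp, ← mul_assoc, modelDeriv_mul_skewRep, mul_assoc, this, mul_assoc]

theorem exists_leadOp_mul_self (j : Fin (n + 1)) :
    ∃ f : MvPolynomial (Fin n) k, f ≠ 0 ∧ leadOp k j * leadOp k j = skewRep k n (sq k n f) := by
  have htt : (twist k (modelSign n) (.inr j)).toLinearMap *
      (twist k (modelSign n) (.inr j)).toLinearMap = 1 :=
    LinearMap.ext fun f => twist_twist modelSign_mul_self _ f
  rw [leadOp, modelLead]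
  split_ifs with h
  · have hp : passSign n j = 1 := by rw [passSign, if_neg (by omega), if_pos h]
    refine ⟨(-1) ^ (n * (n - 1) / 2) * ∏ i, X i,
      mul_ne_zero (pow_ne_zero _ (neg_ne_zero.2 one_ne_zero))
        (Finset.prod_ne_zero_iff.2 fun i _ => X_ne_zero i), ?_⟩
    rw [mul_assoc, ← mul_assoc _ (skewRep k n _), twist_mul_skewRep, scale_of_mem _
      fullProd_mem_grading, hp, one_pow, one_smul, mul_assoc, htt, mul_one, ← map_mul,
      fullProd_mul_self, zsmul_eq_mul, map_mul (sq k n), map_pow, map_neg, map_one]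
    norm_cast
  · refine ⟨1, one_ne_zero, ?_⟩
    rw [map_one, one_mul, htt, map_one, map_one]

/-- The polynomials in the variables of the model space that precede the one of `y j`. -/
def lowerSpace (k : Type u) [Field k] (n j : ℕ) :
    Set (MvPolynomial (Fin n ⊕ Fin (n + 1)) k) :=
  {f | ∀ i : Fin (n + 1), j ≤ i → modelDeriv k i f = 0}

theorem lowerSpace_mono {j j' : ℕ} (h : j ≤ j') : lowerSpace k n j ⊆ lowerSpace k n j' :=
  fun _ hf i hi => hf i (h.trans hi)

theorem leadOp_mem_lowerSpace (j : Fin (n + 1)) {f : MvPolynomial (Fin n ⊕ Fin (n + 1)) k}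
    (hf : f ∈ lowerSpace k n j) (m : ℕ) : (leadOp k j ^ m) f ∈ lowerSpace k n j := by
  induction m with
  | zero => exact hf
  | succ m ih =>
    intro i hi
    rw [pow_succ', Module.End.mul_apply, ← Module.End.mul_apply,
      modelDeriv_mul_leadOp (Fin.le_def.2 hi), Module.End.mul_apply, ih i hi, map_zero]

variable [CharZero k]

/-- If an expression `∑ s_i y_j ^ i` annihilates the polynomials in the lower variables, then so do
all coefficients; their leading terms in the variable of `y_j` are independent. -/
theorem model_coeff_eq_zero (hn : 1 ≤ n) (j : Fin (n + 1)) (c : ℕ →₀ OreAlg.tower k n j)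
    (hfaith : ∀ s ∈ OreAlg.tower k n j, (∀ f ∈ lowerSpace k n j, model k n s f = 0) → s = 0)
    (hc : ∀ f ∈ lowerSpace k n j,
      model k n (IsOreExtension.evalPowers (OreAlg.tower k n j) (OreAlg.y k n j) c) f = 0) :
    c = 0 := by
  by_contra hne
  have hsupp := Finsupp.support_nonempty_iff.2 hne
  let m := c.support.max' hsupp
  have hm : m ∈ c.support := Finset.max'_mem _ _
  have hlt : ∀ i ∈ c.support, i ≠ m → i < m := fun i hi hne =>
    lt_of_le_of_ne (Finset.le_max' _ i hi) hne
  have hY := modelDeriv_mul_modelGen_self hn (k := k) j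
  have hγ := modelDeriv_mul_leadOp (k := k) (le_refl j)
  have h1 : ∀ f ∈ lowerSpace k n j, model k n (c m) ((leadOp k j ^ m) f) = 0 := by
    intro f hf
    have hDf := hf j le_rfl
    have h2 := congrArg (modelDeriv k j ^ m) (hc f hf)
    rw [IsOreExtension.evalPowers_eq, Finsupp.sum, map_sum, LinearMap.sum_apply, map_sum,
      map_zero, Finset.sum_eq_single m] at h2
    · have hcomm : modelDeriv k j ^ m * model k n (c m) = model k n (c m) * modelDeriv k j ^ m :=
        Commute.pow_left (modelDeriv_mul_model hn (Fin.le_def.1 le_rfl) (c m).2) m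
      rw [map_mul, map_pow, model_y, Module.End.mul_apply, ← Module.End.mul_apply, hcomm,
        Module.End.mul_apply, (weyl_leading hY hγ hDf m).1, map_nsmul, ← Nat.cast_smul_eq_nsmul k] at h2
      exact (smul_eq_zero.1 h2).resolve_left (Nat.cast_ne_zero.2 m.factorial_ne_zero)
    · intro i hi hne
      have hcomm : modelDeriv k j ^ m * model k n (c i) = model k n (c i) * modelDeriv k j ^ m :=
        Commute.pow_left (modelDeriv_mul_model hn (Fin.le_def.1 le_rfl) (c i).2) m
      rw [map_mul, map_pow, model_y, Module.End.mul_apply, ← Module.End.mul_apply, hcomm,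
        Module.End.mul_apply, weyl_vanishing hY hγ hDf (hlt i hi hne), map_zero]
    · intro h; exact absurd hm h
  obtain ⟨g, hg, hgg⟩ := exists_leadOp_mul_self (k := k) j
  have h3 : (c m : OreAlg k n) = 0 := by
    refine hfaith _ (c m).2 fun f hf => ?_
    have h4 := h1 _ (leadOp_mem_lowerSpace j hf m)
    have h5 : (leadOp k j ^ m) ((leadOp k j ^ m) f) = skewRep k n (sq k n (g ^ m)) f := by
      rw [← Module.End.mul_apply, ← (Commute.refl (leadOp k j)).mul_pow, hgg, map_pow, map_pow]
    rw [h5, ← Module.End.mul_apply, model_mul_skewRep_sq, Module.End.mul_apply, skewRep_sq,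
      LinearMap.mulLeft_apply] at h4
    refine (mul_eq_zero.1 h4).resolve_left fun h5 => pow_ne_zero m hg ?_
    exact squareSubst_injective (h5.trans (map_zero _).symm)
  exact Finsupp.mem_support_iff.1 hm (Subtype.ext h3)

end SkewPoly

/-! ### The iterated Ore extension -/

namespace OreAlg

open MvPolynomial

variable {k : Type u} [Field k] {n : ℕ}

theorem coeff_mem_tower (j : ℕ) (f : MvPolynomial (Fin n) k) : coeff k n f ∈ tower k n j :=
  Algebra.subset_adjoin (Or.inl ⟨f, rfl⟩)

theorem y_mem_tower {i : Fin (n + 1)} {j : ℕ} (h : (i : ℕ) < j) : y k n i ∈ tower k n j :=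
  Algebra.subset_adjoin (Or.inr ⟨i, h, rfl⟩)

theorem tower_mono {i j : ℕ} (h : i ≤ j) : tower k n i ≤ tower k n j := by
  refine Algebra.adjoin_mono (Set.union_subset_union_right _ (Set.image_mono ?_))
  exact fun l (hl : (l : ℕ) < i) => lt_of_lt_of_le hl h

theorem tower_zero : (tower k n 0 : Set (OreAlg k n)) = Set.range (coeff k n) := by
  have : tower k n 0 = (coeffAlgHom k n).range := by
    refine le_antisymm (Algebra.adjoin_le ?_) ?_
    · rintro _ (⟨f, rfl⟩ | ⟨i, hi, -⟩)
      · exact ⟨f, rfl⟩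
      · exact absurd hi (Nat.not_lt_zero _)
    · rintro _ ⟨f, rfl⟩
      exact coeff_mem_tower 0 f
  rw [this]
  rfl

theorem tower_top : tower k n (n + 1) = ⊤ := by
  rw [eq_top_iff]
  intro c _
  induction c using OreAlg.induction with
  | hc f => exact coeff_mem_tower _ f
  | hy i => exact y_mem_tower i.2
  | hmul a b ha hb => exact mul_mem (ha trivial) (hb trivial)
  | hadd a b ha hb => exact add_mem (ha trivial) (hb trivial)

theorem correction_mem_tower {i j : Fin (n + 1)} (h : i < j) :
    mk k n (oreCorrection k n j i) ∈ tower k n j := by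
  rw [mk_oreCorrection]
  split_ifs with h1 h2
  · exact coeff_mem_tower _ _
  · exact mul_mem (coeff_mem_tower _ _) (y_mem_tower (by
      have := Fin.lt_def.1 h
      simp only; omega))
  · exact zero_mem _

variable (k) in
/-- The automorphism by which `y j` acts on the preceding stage of the tower is the restriction of a
sign automorphism of `C`. -/
theorem exists_twist_of_oreSign (j : Fin (n + 1)) :
    ∃ θ : OreAlg k n ≃ₐ[k] OreAlg k n, (∀ f, θ (coeff k n f) = coeff k n f) ∧
      (∀ i : Fin (n + 1), i < j → θ (y k n i) = oreSign n j i • y k n i) ∧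
      (∀ c, θ (θ c) = c) ∧ ∀ m, ∀ s ∈ tower k n m, θ s ∈ tower k n m := by
  have hpow : ∀ m : ℕ, (-1 : ℤ) ^ m * (-1) ^ m = 1 := fun m => by rw [← mul_pow]; simp
  obtain ⟨ε, ε', h, h', hε⟩ : ∃ ε ε' : ℤ, ε * ε = 1 ∧ ε' * ε' = 1 ∧
      ∀ i : Fin (n + 1), i < j → twistSign n ε ε' i = oreSign n j i := by
    by_cases h1 : (j : ℕ) + 1 < n
    · refine ⟨-1, 1, by norm_num, by norm_num, fun i hi => ?_⟩
      have := Fin.lt_def.1 hi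
      rw [twistSign, if_pos (by omega), oreSign, if_pos h1]
    · by_cases h2 : (j : ℕ) + 1 = n
      · refine ⟨(-1) ^ (n - 1), 1, hpow _, by norm_num, fun i hi => ?_⟩
        have := Fin.lt_def.1 hi
        rw [twistSign, if_pos (by omega), oreSign, if_neg h1, if_pos h2]
      · refine ⟨(-1) ^ n, -1, hpow _, by norm_num, fun i hi => ?_⟩
        have := Fin.lt_def.1 hi
        have := j.2
        by_cases h3 : (i : ℕ) + 1 < n
        · rw [twistSign, if_pos h3, oreSign, if_neg h1, if_neg h2, if_pos h3]
        · rw [twistSign, if_neg h3, if_pos (by omega), oreSign, if_neg h1, if_neg h2, if_neg h3,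
            pow_succ]
  obtain ⟨θ, h1, h2, h3⟩ := exists_twist k n h h'
  refine ⟨θ, h1, fun i hi => by rw [h2, hε i hi], h3, fun m s hs => ?_⟩
  have hle : tower k n m ≤ (tower k n m).comap (θ : OreAlg k n →ₐ[k] OreAlg k n) := by
    refine Algebra.adjoin_le ?_
    rintro _ (⟨f, rfl⟩ | ⟨i, hi, rfl⟩)
    · change θ (coeff k n f) ∈ tower k n m
      rw [h1]
      exact coeff_mem_tower _ _
    · change θ (y k n i) ∈ tower k n m
      rw [h2]
      exact zsmul_mem (y_mem_tower hi) _
  exact hle hs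

theorem y_mul_sub_mem_tower (j : Fin (n + 1)) {θ : OreAlg k n ≃ₐ[k] OreAlg k n}
    (h1 : ∀ f, θ (coeff k n f) = coeff k n f)
    (h2 : ∀ i : Fin (n + 1), i < j → θ (y k n i) = oreSign n j i • y k n i)
    (hθ : ∀ m, ∀ s ∈ tower k n m, θ s ∈ tower k n m) {s : OreAlg k n} (hs : s ∈ tower k n j) :
    y k n j * s - θ s * y k n j ∈ tower k n j := by
  induction hs using Algebra.adjoin_induction with
  | mem g hg =>
    rcases hg with ⟨f, rfl⟩ | ⟨i, hi, rfl⟩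
    · rw [h1, coeff_commutes, sub_self]
      exact zero_mem _
    · have hij : i < j := Fin.lt_def.2 hi
      rw [h2 i hij, y_mul_y hij, smul_mul_assoc, add_sub_cancel_left]
      exact correction_mem_tower hij
  | algebraMap c =>
    rw [AlgEquiv.commutes, Algebra.commutes, sub_self]
    exact zero_mem _
  | add a b _ _ ha hb =>
    rw [mul_add, map_add, add_mul, add_sub_add_comm]
    exact add_mem ha hb
  | mul a b ha' hb' ha hb =>
    have : y k n j * (a * b) - θ (a * b) * y k n j = (y k n j * a - θ a * y k n j) * b +
        θ a * (y k n j * b - θ b * y k n j) := by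
      rw [map_mul]; noncomm_ring
    rw [this]
    exact add_mem (mul_mem ha hb') (mul_mem (hθ _ _ ha') hb)

theorem exists_tower_evalPowers (j : Fin (n + 1)) {t : OreAlg k n} (ht : t ∈ tower k n (j + 1)) :
    ∃ c, t = IsOreExtension.evalPowers (tower k n j) (y k n j) c := by
  obtain ⟨θ, h1, h2, -, h3⟩ := exists_twist_of_oreSign k j
  refine IsOreExtension.exists_evalPowers_of_mem_adjoin (fun s hs => ⟨θ s, h3 _ _ hs, _,
    y_mul_sub_mem_tower j h1 h2 h3 hs, (add_sub_cancel _ _).symm⟩) ?_ ht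
  rintro _ (⟨f, rfl⟩ | ⟨i, hi, rfl⟩)
  · exact Or.inl (coeff_mem_tower _ f)
  · rcases Nat.lt_succ_iff_lt_or_eq.1 hi with h | h
    · exact Or.inl (y_mem_tower h)
    · exact Or.inr (by rw [Fin.ext h])

theorem eq_zero_of_model_coeff_one {f : MvPolynomial (Fin n) k}
    (h : SkewPoly.model k n (coeff k n f) 1 = 0) : f = 0 := by
  rw [SkewPoly.model_coeff, SkewPoly.skewRep_sq, LinearMap.mulLeft_apply, mul_one] at h
  exact esymmMap_injective k n ((SkewPoly.squareSubst_injective (h.trans (map_zero _).symm)).trans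
    (map_zero _).symm)

variable (k n) in
theorem coeff_injective : Function.Injective (coeff k n) := by
  rw [injective_iff_map_eq_zero]
  intro f hf
  apply eq_zero_of_model_coeff_one
  rw [hf, map_zero]; rfl

variable [CharZero k]

/-- The model representation is faithful on each stage of the tower, already on the polynomials in
the variables of that stage. -/
theorem eq_zero_of_model (hn : 1 ≤ n) (j : ℕ) (hj : j ≤ n + 1) : ∀ s ∈ tower k n j,
    (∀ f ∈ SkewPoly.lowerSpace k n j, SkewPoly.model k n s f = 0) → s = 0 := by
  induction j with
  | zero =>
    intro s hs hf
    obtain ⟨f, rfl⟩ : s ∈ Set.range (coeff k n) := by rw [← tower_zero]; exact hs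
    rw [eq_zero_of_model_coeff_one (hf 1 fun i _ => by
      rw [SkewPoly.modelDeriv_apply, Derivation.map_one_eq_zero]), map_zero]
  | succ j ih =>
    intro t ht hf
    obtain ⟨c, rfl⟩ := exists_tower_evalPowers ⟨j, by omega⟩ ht
    rw [SkewPoly.model_coeff_eq_zero hn ⟨j, by omega⟩ c (ih (by omega)) fun f hf' =>
      hf f (SkewPoly.lowerSpace_mono (Nat.le_succ j) hf'), map_zero]

theorem tower_evalPowers_injective (hn : 1 ≤ n) (j : Fin (n + 1)) :
    Function.Injective (IsOreExtension.evalPowers (tower k n j) (y k n j)) := by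
  rw [injective_iff_map_eq_zero]
  intro c hc
  refine SkewPoly.model_coeff_eq_zero hn j c (eq_zero_of_model hn j j.2.le) fun f _ => ?_
  rw [hc, map_zero]; rfl

theorem exists_isOreExtension (hn : 1 ≤ n) (j : Fin (n + 1)) :
    ∃ (τ : tower k n j ≃ₐ[k] tower k n j) (δ : tower k n j →ₗ[k] tower k n j),
    IsOreExtension (tower k n j) (tower k n (j + 1)) (y k n j) τ δ ∧
    (∀ (s : tower k n j) f, (s : OreAlg k n) = coeff k n f → τ s = s ∧ δ s = 0) ∧
    ∀ s : tower k n j, ∀ i < j, (s : OreAlg k n) = y k n i →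
      (τ s : OreAlg k n) = oreSign n j i • y k n i ∧
      (δ s : OreAlg k n) = mk k n (oreCorrection k n j i) := by
  obtain ⟨θ, h1, h2, h3, h4⟩ := exists_twist_of_oreSign k j
  let t : tower k n j →ₐ[k] tower k n j :=
    ((θ : OreAlg k n →ₐ[k] OreAlg k n).comp (tower k n j).val).codRestrict (tower k n j)
      fun s => h4 _ _ s.2
  have htt : t.comp t = AlgHom.id k _ := AlgHom.ext fun s => Subtype.ext (h3 s)
  let τ : tower k n j ≃ₐ[k] tower k n j := AlgEquiv.ofAlgHom t t htt htt
  have hτ : ∀ s, (τ s : OreAlg k n) = θ s := fun s => rfl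
  let d : tower k n j →ₗ[k] OreAlg k n :=
    (LinearMap.mulLeft k (y k n j) - LinearMap.mulRight k (y k n j) ∘ₗ θ.toLinearMap) ∘ₗ
      (tower k n j).val.toLinearMap
  have hd : ∀ s, d s = y k n j * s - θ s * y k n j := fun s => rfl
  let δ : tower k n j →ₗ[k] tower k n j :=
    d.codRestrict (Subalgebra.toSubmodule (tower k n j))
      fun s => y_mul_sub_mem_tower j h1 h2 h4 s.2
  have hδ : ∀ s, (δ s : OreAlg k n) = y k n j * s - θ s * y k n j := fun s => rfl
  refine ⟨τ, δ, ⟨tower_mono (Nat.le_succ _), y_mem_tower (Nat.lt_succ_self _), fun a b => ?_,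
    fun s => ?_, fun c hc => ?_⟩, fun s f hs => ⟨?_, ?_⟩, fun s i hi hs => ⟨?_, ?_⟩⟩
  · ext
    rw [hδ, Subalgebra.coe_add, Subalgebra.coe_mul, Subalgebra.coe_mul, Subalgebra.coe_mul, hδ, hδ,
      hτ, map_mul]
    noncomm_ring
  · rw [hτ, hδ, add_sub_cancel]
  · obtain ⟨f, rfl⟩ := exists_tower_evalPowers j hc
    exact ⟨f, rfl, fun g hg => tower_evalPowers_injective hn j hg.symm⟩
  · ext
    rw [hτ, hs, h1]
  · ext
    rw [hδ, hs, h1, coeff_commutes, sub_self]; rfl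
  · rw [hτ, hs, h2 i hi]
  · rw [hδ, hs, h2 i hi, y_mul_y hi, smul_mul_assoc, add_sub_cancel_left]

theorem isIteratedOreExtension (hn : 1 ≤ n) : IsIteratedOreExtension k n where
  coeff_injective := coeff_injective k n
  tower_zero := tower_zero
  tower_top := tower_top
  step := exists_isOreExtension hn

end OreAlg

/-! ### Two-sided ideals generated by central elements -/

theorem mem_span_iff_mem_seqIdeal {A : Type u} [Ring A] {z : ℕ → A} {m : ℕ}
    (hz : ∀ i < m, ∀ a, a * z i = z i * a) {a : A} :
    a ∈ TwoSidedIdeal.span {b | ∃ i < m, b = z i} ↔ a ∈ seqIdeal z m := by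
  constructor
  · intro ha
    have htwo : (seqIdeal z m).IsTwoSided := ⟨fun {x} b hx => seqIdeal_mul_mem hz hx b⟩
    have hmem : ∀ i < m, ∀ j ≤ m, i < j → z i ∈ seqIdeal z j := by
      intro i _ j hj hij
      induction j with
      | zero => omega
      | succ j ih =>
        rcases Nat.lt_succ_iff_lt_or_eq.1 hij with h | rfl
        · exact mem_seqIdeal_succ.2 ⟨0, by rw [zero_mul, sub_zero]; exact ih (by omega) h⟩
        · exact mem_seqIdeal_succ.2 ⟨1, by rw [one_mul, sub_self]; exact zero_mem _⟩
    have hle : TwoSidedIdeal.span {b | ∃ i < m, b = z i} ≤ (seqIdeal z m).toTwoSided := by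
      rw [TwoSidedIdeal.span_le]
      rintro _ ⟨i, hi, rfl⟩
      exact Ideal.mem_toTwoSided.2 (hmem i hi m le_rfl hi)
    exact Ideal.mem_toTwoSided.1 (hle ha)
  · suffices ∀ j ≤ m, ∀ a, a ∈ seqIdeal z j → a ∈ TwoSidedIdeal.span {b | ∃ i < m, b = z i} from
      this m le_rfl a
    intro j
    induction j with
    | zero =>
      intro _ a ha
      rw [seqIdeal, Ideal.mem_bot] at ha
      rw [ha]
      exact zero_mem _
    | succ j ih =>
      intro hj a ha
      obtain ⟨c, hc⟩ := mem_seqIdeal_succ.1 ha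
      rw [← sub_add_cancel a (c * z j)]
      exact add_mem (ih (by omega) _ hc)
        (TwoSidedIdeal.mul_mem_left _ _ _ (TwoSidedIdeal.subset_span ⟨j, by omega, rfl⟩))

namespace OreAlg

open MvPolynomial

variable {k : Type u} [Field k] {n : ℕ}

/-! ### The regular sequence -/

variable (k n) in
/-- The sequence `r`, extended by zero. -/
def rSeq (i : ℕ) : OreAlg k n := if h : i < n + 1 then r k n ⟨i, h⟩ else 0

theorem rSeq_val (i : Fin (n + 1)) : rSeq k n i = r k n i := dif_pos i.2

theorem rSeq_central (i : ℕ) (a : OreAlg k n) : a * rSeq k n i = rSeq k n i * a := by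
  unfold rSeq
  split_ifs
  · exact Subring.mem_center_iff.1 (r_mem_center _) a
  · rw [mul_zero, zero_mul]

theorem mem_previousIdeal_r_iff (i : Fin (n + 1)) {a : OreAlg k n} :
    a ∈ previousIdeal (r k n) i ↔ a ∈ seqIdeal (rSeq k n) i := by
  rw [← mem_span_iff_mem_seqIdeal fun j _ => rSeq_central j, previousIdeal]
  have : {a | ∃ j < i, a = r k n j} = {b | ∃ j < (i : ℕ), b = rSeq k n j} := by
    ext b
    constructor
    · rintro ⟨j, hj, rfl⟩
      exact ⟨j, hj, (rSeq_val j).symm⟩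
    · rintro ⟨j, hj, rfl⟩
      exact ⟨⟨j, by omega⟩, Fin.lt_def.2 hj, rSeq_val ⟨j, by omega⟩⟩
  rw [this]

theorem rSeq_mem_tower {i j : ℕ} (h : i < j) (hj : j ≤ n + 1) : rSeq k n i ∈ tower k n j := by
  rw [rSeq, dif_pos (by omega)]
  exact sub_mem (pow_mem (y_mem_tower h) 2) (coeff_mem_tower _ _)

theorem isCentralRegularOn_rSeq [CharZero k] (hn : 1 ≤ n) (j : ℕ) (hj : j ≤ n + 1) :
    IsCentralRegularOn (tower k n j) (rSeq k n) j := by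
  induction j with
  | zero => intro i hi; omega
  | succ j ih =>
    obtain ⟨τ, δ, h, -⟩ := exists_isOreExtension (k := k) hn ⟨j, by omega⟩
    exact h.isCentralRegularOn_succ (fun i hi => rSeq_mem_tower hi (by omega)) (ih (by omega))
      (coeff_mem_tower j (squareValue k n j)) (fun a => (coeff_commutes k n _ a).symm)
      (fun i _ => rSeq_central i) (dif_pos (by omega))

theorem isRegularSequence_r [CharZero k] (hn : 1 ≤ n) : IsRegularSequence (r k n) := by
  intro i c
  have hc : c * r k n i = r k n i * c := Subring.mem_center_iff.1 (r_mem_center i) c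
  have key : r k n i * c ∈ previousIdeal (r k n) i → c ∈ previousIdeal (r k n) i := by
    rw [mem_previousIdeal_r_iff, mem_previousIdeal_r_iff,
      ← mem_subalgebraIdeal_top_iff (k := k) fun j _ => rSeq_central j,
      ← mem_subalgebraIdeal_top_iff (k := k) fun j _ => rSeq_central j, ← tower_top (k := k), ← rSeq_val]
    exact isCentralRegularOn_rSeq hn (n + 1) le_rfl i i.2 c (by rw [tower_top]; trivial)
  exact ⟨key, by rw [hc]; exact key⟩

theorem isNormalSequence_r : IsNormalSequence (r k n) := by
  intro i c
  have hc : c * r k n i = r k n i * c := Subring.mem_center_iff.1 (r_mem_center i) c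
  refine ⟨⟨c, ?_⟩, ⟨c, ?_⟩⟩ <;> rw [hc, sub_self] <;> exact zero_mem _

/-! ### Global dimension -/

theorem injectiveDimensionsLE_mvPolynomial (k : Type u) [Field k] (m : ℕ) :
    InjectiveDimensionsLE (MvPolynomial (Fin m) k) m := by
  induction m with
  | zero =>
    exact InjectiveDimensionsLE.of_ringEquiv (isEmptyAlgEquiv k (Fin 0)).symm.toRingEquiv
      (InjectiveDimensionsLE.of_field k)
  | succ m ih =>
    have h : OreData (Polynomial.C : MvPolynomial (Fin m) k →+* _) Polynomial.X (RingHom.id _)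
        (fun _ => 0) := by
      refine ⟨fun b => ?_, fun a => ?_⟩
      · rw [map_zero, add_zero, RingHom.id_apply, Polynomial.X_mul_C]
      · have hco : ∀ (c : ℕ →₀ MvPolynomial (Fin m) k) i,
            (c.sum fun i b => Polynomial.C b * Polynomial.X ^ i).coeff i = c i := by
          intro c i
          rw [Finsupp.sum, Polynomial.finsetSum_coeff]
          simp only [Polynomial.coeff_C_mul_X_pow]
          rw [Finset.sum_ite_eq]
          split_ifs with h
          · rfl
          · exact (Finsupp.notMem_support_iff.1 h).symm
        refine ⟨Finsupp.onFinset a.support a.coeff fun i hi => Polynomial.mem_support_iff.2 hi,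
          Polynomial.ext fun i => ?_, fun c hc => Finsupp.ext fun i => ?_⟩
        · rw [hco]; rfl
        · rw [hc, Finsupp.onFinset_apply, hco]
    exact InjectiveDimensionsLE.of_ringEquiv (finSuccEquiv k m).symm.toRingEquiv
      (h.injectiveDimensionsLE ih)

variable [CharZero k]

theorem injectiveDimensionsLE_tower (hn : 1 ≤ n) (j : ℕ) (hj : j ≤ n + 1) :
    InjectiveDimensionsLE (tower k n j) (n + j) := by
  induction j with
  | zero =>
    let e : MvPolynomial (Fin n) k →+* tower k n 0 :=
      (coeff k n).codRestrict (tower k n 0) (coeff_mem_tower 0)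
    have he : Function.Bijective e := by
      refine ⟨fun f g hfg => coeff_injective k n (congrArg Subtype.val hfg), fun ⟨s, hs⟩ => ?_⟩
      obtain ⟨f, rfl⟩ : s ∈ Set.range (coeff k n) := by rw [← tower_zero]; exact hs
      exact ⟨f, rfl⟩
    exact InjectiveDimensionsLE.of_ringEquiv (RingEquiv.ofBijective e he)
      (injectiveDimensionsLE_mvPolynomial k n)
  | succ j ih =>
    obtain ⟨τ, δ, h, -⟩ := exists_isOreExtension (k := k) hn ⟨j, by omega⟩
    have hd : OreData (Subalgebra.inclusion h.le).toRingHom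
        (⟨y k n ⟨j, by omega⟩, h.mem⟩ : tower k n (j + 1)) (τ : tower k n j →+* tower k n j) δ := by
      have hcoe : ∀ c : ℕ →₀ tower k n j, ((c.sum fun i b => (Subalgebra.inclusion h.le).toRingHom b *
          (⟨y k n ⟨j, by omega⟩, h.mem⟩ : tower k n (j + 1)) ^ i : tower k n (j + 1)) :
            OreAlg k n) = c.sum fun i b => (b : OreAlg k n) * y k n ⟨j, by omega⟩ ^ i := by
        intro c
        rw [Finsupp.sum, Finsupp.sum, AddSubmonoidClass.coe_finsetSum]
        rfl
      refine ⟨fun b => Subtype.ext (h.rel b), fun a => ?_⟩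
      obtain ⟨c, hc, huniq⟩ := h.basis a a.2
      exact ⟨c, Subtype.ext (hc.trans (hcoe c).symm), fun c' hc' => huniq c' (by
        rw [hc']; exact hcoe c')⟩
    exact hd.injectiveDimensionsLE (ih (by omega))

theorem injectiveDimensionsLE (hn : 1 ≤ n) : InjectiveDimensionsLE (OreAlg k n) (2 * n + 1) := by
  have h := injectiveDimensionsLE_tower (k := k) hn (n + 1) le_rfl
  rw [tower_top, show n + (n + 1) = 2 * n + 1 by ring] at h
  exact InjectiveDimensionsLE.of_ringEquiv (Subalgebra.topEquiv (R := k)).toRingEquiv h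

theorem injectiveDimensionsLE_mulOpposite (hn : 1 ≤ n) :
    InjectiveDimensionsLE (OreAlg k n)ᵐᵒᵖ (2 * n + 1) := by
  obtain ⟨e, -⟩ := exists_antiautomorphism (k := k) hn
  exact InjectiveDimensionsLE.of_ringEquiv e.toRingEquiv (injectiveDimensionsLE hn)

omit [CharZero k]

/-! ### Finiteness over a central polynomial ring -/

variable (k n) in
/-- The homomorphism from a polynomial ring onto the central subalgebra generated by the `p_i` and
the squares of the generators. -/
def centralMap : MvPolynomial (Fin n ⊕ Fin (n + 1)) k →ₐ[k] OreAlg k n :=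
  (Subalgebra.center k (OreAlg k n)).val.comp (aeval (Sum.elim
    (fun i => ⟨coeff k n (X i), coeff_mem_center _⟩) fun j => ⟨y k n j ^ 2, y_sq_mem_center j⟩))

theorem centralMap_commutes (f : MvPolynomial (Fin n ⊕ Fin (n + 1)) k) (a : OreAlg k n) :
    centralMap k n f * a = a * centralMap k n f :=
  (Subalgebra.mem_center_iff.1 (aeval (Sum.elim
    (fun i => (⟨coeff k n (X i), coeff_mem_center _⟩ : Subalgebra.center k (OreAlg k n)))
      fun j => ⟨y k n j ^ 2, y_sq_mem_center j⟩) f).2 a).symm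

theorem centralMap_coeff (f : MvPolynomial (Fin n) k) :
    centralMap k n (rename Sum.inl f) = coeff k n f := by
  have : (centralMap k n).comp (rename Sum.inl) = coeffAlgHom k n := by
    ext i : 1
    rw [AlgHom.comp_apply, rename_X, centralMap, AlgHom.comp_apply, aeval_X]
    rfl
  exact AlgHom.congr_fun this f

theorem centralMap_inr (j : Fin (n + 1)) : centralMap k n (X (Sum.inr j)) = y k n j ^ 2 := by
  rw [centralMap, AlgHom.comp_apply, aeval_X]
  rfl

/-- `C` as an algebra over the central polynomial ring. -/
abbrev centralAlgebra (k : Type u) [Field k] (n : ℕ) :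
    Algebra (MvPolynomial (Fin n ⊕ Fin (n + 1)) k) (OreAlg k n) :=
  (centralMap k n).toRingHom.toAlgebra' fun f a => centralMap_commutes f a

theorem finite_centralAlgebra :
    letI := centralAlgebra k n
    Module.Finite (MvPolynomial (Fin n ⊕ Fin (n + 1)) k) (OreAlg k n) := by
  let _ := centralAlgebra k n
  have hsmul : ∀ (f : MvPolynomial (Fin n ⊕ Fin (n + 1)) k) (a : OreAlg k n),
    f • a = centralMap k n f * a := fun f a => rfl
  have key : ∀ j ≤ n + 1, ∃ N : Submodule (MvPolynomial (Fin n ⊕ Fin (n + 1)) k) (OreAlg k n),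
      N.FG ∧ ∀ t ∈ tower k n j, t ∈ N := by
    intro j
    induction j with
    | zero =>
      intro _
      refine ⟨Submodule.span _ {1}, Submodule.fg_span (Set.finite_singleton _), fun t ht => ?_⟩
      obtain ⟨f, rfl⟩ : t ∈ Set.range (coeff k n) := by rw [← tower_zero]; exact ht
      refine Submodule.mem_span_singleton.2 ⟨rename Sum.inl f, ?_⟩
      rw [hsmul, centralMap_coeff, mul_one]
    | succ j ih =>
      intro hj
      obtain ⟨N, hN, hle⟩ := ih (by omega)
      let R : OreAlg k n →ₗ[MvPolynomial (Fin n ⊕ Fin (n + 1)) k] OreAlg k n :=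
        LinearMap.mulRight _ (y k n ⟨j, by omega⟩)
      refine ⟨N ⊔ N.map R, hN.sup (hN.map R), fun t ht => ?_⟩
      obtain ⟨c, rfl⟩ := exists_tower_evalPowers ⟨j, by omega⟩ ht
      refine sum_mem fun i _ => ?_
      change (c i : OreAlg k n) * y k n ⟨j, by omega⟩ ^ i ∈ N ⊔ N.map R
      have hsq : ∀ m, ∀ a ∈ N ⊔ N.map R, a * y k n ⟨j, by omega⟩ ^ (2 * m) ∈ N ⊔ N.map R := by
        intro m a ha
        rw [pow_mul, ← centralMap_inr, ← map_pow, ← centralMap_commutes, ← hsmul]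
        exact Submodule.smul_mem _ _ ha
      rcases Nat.even_or_odd' i with ⟨m, rfl | rfl⟩
      · exact hsq m _ (Submodule.mem_sup_left (hle _ (c _).2))
      · rw [pow_succ', ← mul_assoc]
        exact hsq m _ (Submodule.mem_sup_right ⟨_, hle _ (c _).2, rfl⟩)
  obtain ⟨N, hN, hle⟩ := key (n + 1) le_rfl
  have htop : N = ⊤ := by
    rw [eq_top_iff]
    intro t _
    exact hle t (by rw [tower_top]; trivial)
  exact ⟨htop ▸ hN⟩

theorem isTwoSidedNoetherian : IsTwoSidedNoetherian (OreAlg k n) := by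
  let _ := centralAlgebra k n
  have := finite_centralAlgebra (k := k) (n := n)
  exact isTwoSidedNoetherian_of_finite (MvPolynomial (Fin n ⊕ Fin (n + 1)) k) (OreAlg k n)

theorem gelfandKirillovDim_ne_top : gelfandKirillovDim k (OreAlg k n) ≠ ⊤ := by
  let _ := centralAlgebra k n
  have := finite_centralAlgebra (k := k) (n := n)
  have : IsScalarTower k (MvPolynomial (Fin n ⊕ Fin (n + 1)) k) (OreAlg k n) :=
    IsScalarTower.of_algebraMap_eq fun c => ((centralMap k n).commutes c).symm
  exact gelfandKirillovDim_ne_top_of_finite k (OreAlg k n) (Fin n ⊕ Fin (n + 1))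

end OreAlg

namespace OreAlg

open MvPolynomial

variable {k : Type u} [Field k] {n : ℕ}

/-! ### A central regular sequence with finite-dimensional quotient -/

variable (k n) in
/-- The central sequence `p_1, …, p_n, y_1², …, y_{n-1}², u², v²`. -/
def paramSeq (i : ℕ) : OreAlg k n :=
  if h : i < n then coeff k n (X ⟨i, h⟩)
  else if h : i - n < n + 1 then y k n ⟨i - n, h⟩ ^ 2 else 0

theorem paramSeq_of_lt {i : ℕ} (h : i < n) : paramSeq k n i = coeff k n (X ⟨i, h⟩) := dif_pos h

theorem paramSeq_add {j : ℕ} (h : j < n + 1) : paramSeq k n (n + j) = y k n ⟨j, h⟩ ^ 2 := by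
  rw [paramSeq, dif_neg (by omega), dif_pos (by omega)]
  simp only [Nat.add_sub_cancel_left]

theorem paramSeq_central (i : ℕ) (a : OreAlg k n) : a * paramSeq k n i = paramSeq k n i * a := by
  unfold paramSeq
  split_ifs
  · exact (coeff_commutes k n _ a).symm
  · exact Subring.mem_center_iff.1 (y_sq_mem_center _) a
  · rw [mul_zero, zero_mul]

theorem paramSeq_mem_tower {i j : ℕ} (h : i < n + j) :
    paramSeq k n i ∈ tower k n j := by
  unfold paramSeq
  split_ifs with h1 h2
  · exact coeff_mem_tower _ _
  · exact pow_mem (y_mem_tower (by simp only; omega)) 2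
  · exact zero_mem _

theorem coeff_mem_subalgebraIdeal_zero_iff {i : ℕ} (hi : i ≤ n) {f : MvPolynomial (Fin n) k} :
    coeff k n f ∈ subalgebraIdeal (tower k n 0) (paramSeq k n) i ↔
      f ∈ Ideal.span (X '' {j : Fin n | (j : ℕ) < i}) := by
  induction i generalizing f with
  | zero =>
    have h0 : (X '' {j : Fin n | (j : ℕ) < 0} : Set (MvPolynomial (Fin n) k)) = ∅ := by simp
    rw [h0, Ideal.span_empty, subalgebraIdeal, Submodule.mem_bot, Ideal.mem_bot,
      map_eq_zero_iff _ (coeff_injective k n)]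
  | succ i ih =>
    have hset : (X '' {j : Fin n | (j : ℕ) < i + 1} : Set (MvPolynomial (Fin n) k)) =
        insert (X ⟨i, by omega⟩) (X '' {j : Fin n | (j : ℕ) < i}) := by
      rw [← Set.image_insert_eq]
      congr 1
      ext j
      simp only [Set.mem_ofPred_eq, Set.mem_insert_iff, Fin.ext_iff]
      omega
    rw [hset, Ideal.mem_span_insert, mem_subalgebraIdeal_succ]
    constructor
    · rintro ⟨t, ht, h⟩
      obtain ⟨g, rfl⟩ : t ∈ Set.range (coeff k n) := by rw [← tower_zero]; exact ht
      rw [paramSeq_of_lt (by omega), ← map_mul, ← map_sub, ih (by omega)] at h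
      exact ⟨g, _, h, by ring⟩
    · rintro ⟨g, z, hz, rfl⟩
      refine ⟨coeff k n g, coeff_mem_tower _ _, ?_⟩
      rw [paramSeq_of_lt (by omega), ← map_mul, ← map_sub, ih (by omega)]
      convert hz using 1
      ring

theorem isCentralRegularOn_paramSeq_zero :
    IsCentralRegularOn (tower k n 0) (paramSeq k n) n := by
  intro i hi t ht h
  obtain ⟨f, rfl⟩ : t ∈ Set.range (coeff k n) := by rw [← tower_zero]; exact ht
  rw [paramSeq_of_lt hi, ← map_mul, coeff_mem_subalgebraIdeal_zero_iff hi.le,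
    mem_ideal_span_X_image] at h
  rw [coeff_mem_subalgebraIdeal_zero_iff hi.le, mem_ideal_span_X_image]
  intro m hm
  obtain ⟨j, hj, hmj⟩ := h (Finsupp.single ⟨i, hi⟩ 1 + m) (by
    rw [mem_support_iff, coeff_X_mul]
    exact mem_support_iff.1 hm)
  refine ⟨j, hj, ?_⟩
  have hne : (⟨i, hi⟩ : Fin n) ≠ j := fun e => by
    have : (j : ℕ) < i := hj
    rw [← e] at this
    exact lt_irrefl _ this
  rwa [Finsupp.add_apply, Finsupp.single_eq_of_ne hne.symm, zero_add] at hmj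

variable (k n) in
/-- The ideal generated by the sequence `paramSeq`. -/
def paramIdeal : Ideal (OreAlg k n) := seqIdeal (paramSeq k n) (2 * n + 1)

instance : (paramIdeal k n).IsTwoSided :=
  ⟨fun {_} b h => seqIdeal_mul_mem (fun i _ => paramSeq_central i) h b⟩

theorem mem_paramIdeal_iff {a : OreAlg k n} :
    a ∈ paramIdeal k n ↔ a ∈ subalgebraIdeal (tower k n (n + 1)) (paramSeq k n) (n + (n + 1)) := by
  rw [paramIdeal, ← mem_subalgebraIdeal_top_iff (k := k) fun i _ => paramSeq_central i, tower_top,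
    show 2 * n + 1 = n + (n + 1) by ring]

variable (k n) in
/-- The quotient map by `paramIdeal`. -/
abbrev paramMk : OreAlg k n →+* OreAlg k n ⧸ paramIdeal k n := Ideal.Quotient.mk (paramIdeal k n)

theorem paramMk_eq_zero {a : OreAlg k n} : paramMk k n a = 0 ↔ a ∈ paramIdeal k n :=
  Ideal.Quotient.eq_zero_iff_mem

theorem paramMk_coeff {f : MvPolynomial (Fin n) k} (hf : constantCoeff f = 0) :
    paramMk k n (coeff k n f) = 0 := by
  rw [paramMk_eq_zero, mem_paramIdeal_iff]
  have h1 : f ∈ Ideal.span (X '' {j : Fin n | (j : ℕ) < n}) := by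
    rw [mem_ideal_span_X_image]
    intro m hm
    by_contra! h
    have hm0 : m = 0 := by
      ext j
      exact h j j.2
    subst hm0
    exact mem_support_iff.1 hm hf
  exact subalgebraIdeal_mono_left (tower_mono (Nat.zero_le _)) _ _
    (subalgebraIdeal_mono_right _ _ (by omega) ((coeff_mem_subalgebraIdeal_zero_iff le_rfl).2 h1))

theorem paramMk_y_mul_self (i : Fin (n + 1)) :
    paramMk k n (y k n i) * paramMk k n (y k n i) = 0 := by
  rw [← map_mul, paramMk_eq_zero, mem_paramIdeal_iff, ← pow_two, ← paramSeq_add i.2, ← mul_one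
    (paramSeq k n _)]
  exact mul_mem_subalgebraIdeal (by have := i.2; omega) (one_mem _)

theorem paramMk_one_ne_zero : paramMk k n 1 ≠ 0 := by
  intro h
  rw [paramMk_eq_zero] at h
  obtain ⟨F, h1, h2⟩ := exists_augmentation k n
  have : ∀ i, ∀ a ∈ seqIdeal (paramSeq k n) i, F a = 0 := by
    intro i
    induction i with
    | zero =>
      intro a ha
      rw [seqIdeal, Ideal.mem_bot] at ha
      rw [ha, map_zero]
    | succ i ih =>
      intro a ha
      obtain ⟨c, hc⟩ := mem_seqIdeal_succ.1 ha
      have hz : F (paramSeq k n i) = 0 := by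
        unfold paramSeq
        split_ifs
        · rw [h1, constantCoeff_X]
        · rw [map_pow, h2, zero_pow two_ne_zero]
        · rw [map_zero]
      have := ih _ hc
      rwa [map_sub, map_mul, hz, mul_zero, sub_zero] at this
  have h3 := this _ _ h
  rw [map_one] at h3
  exact one_ne_zero h3

/-- The product of the first `j` of the generators `y_1, …, y_{n-1}, u, v`. -/
def topProd (k : Type u) [Field k] (n : ℕ) : ℕ → OreAlg k n
  | 0 => 1
  | j + 1 => topProd k n j * if h : j < n + 1 then y k n ⟨j, h⟩ else 1

theorem topProd_succ (j : Fin (n + 1)) : topProd k n (j + 1) = topProd k n j * y k n j := by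
  rw [topProd, dif_pos j.2]

theorem topProd_mem_tower (j : ℕ) (hj : j ≤ n + 1) : topProd k n j ∈ tower k n j := by
  induction j with
  | zero => exact one_mem _
  | succ j ih =>
    rw [topProd_succ ⟨j, by omega⟩]
    exact mul_mem (tower_mono (Nat.le_succ j) (ih (by omega))) (y_mem_tower (Nat.lt_succ_self j))

theorem paramMk_y_mul_y {i j : Fin (n + 1)} (h : i < j) (hj : (j : ℕ) < n) :
    paramMk k n (y k n j) * paramMk k n (y k n i) =
      oreSign n j i • (paramMk k n (y k n i) * paramMk k n (y k n j)) := by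
  rw [← map_mul, y_mul_y h, map_add, map_zsmul, map_mul, mk_oreCorrection]
  have : constantCoeff (2 * powerSumPoly k n (i + j + 1)) = 0 := by
    rw [map_mul, constantCoeff_powerSumPoly k n (Nat.succ_pos _), mul_zero]
  rw [if_neg (c := (j : ℕ) = n ∧ _) (by omega)]
  split_ifs
  · rw [paramMk_coeff this, add_zero]
  · rw [map_zero, add_zero]

theorem exists_paramMk_y_mul_topProd_of_lt {j : Fin (n + 1)} (hj : (j : ℕ) < n) (m : ℕ)
    (hm : m ≤ j) : ∃ ε : ℤ, ε * ε = 1 ∧ paramMk k n (y k n j) * paramMk k n (topProd k n m) =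
      ε • (paramMk k n (topProd k n m) * paramMk k n (y k n j)) := by
  induction m with
  | zero => exact ⟨1, by norm_num, by simp [topProd]⟩
  | succ m ih =>
    obtain ⟨ε, h1, h2⟩ := ih (by omega)
    refine ⟨ε * oreSign n j m, by rw [mul_mul_mul_comm, h1, oreSign_mul_self, one_mul], ?_⟩
    rw [topProd_succ ⟨m, by omega⟩, map_mul, ← mul_assoc, h2, smul_mul_assoc, mul_assoc,
      paramMk_y_mul_y (Fin.lt_def.2 (by simp only; omega)) hj, mul_smul_comm, smul_smul, mul_assoc]

theorem exists_paramMk_v_mul_topProd (m : ℕ) (hm : m + 1 ≤ n) : ∃ (ε : ℤ) (g : _), ε * ε = 1 ∧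
    paramMk k n (y k n (Fin.last n)) * paramMk k n (topProd k n m) =
      ε • (paramMk k n (topProd k n m) * paramMk k n (y k n (Fin.last n))) +
        g * paramMk k n (y k n ⟨n - 1, by omega⟩) := by
  induction m with
  | zero => exact ⟨1, 0, by norm_num, by simp [topProd]⟩
  | succ m ih =>
    obtain ⟨ε, g, h1, h2⟩ := ih (by omega)
    have hlt : (⟨m, by omega⟩ : Fin (n + 1)) < Fin.last n := Fin.lt_def.2 (by simp; omega)
    have h3 := y_mul_y (k := k) hlt
    rw [mk_oreCorrection, if_neg (by simp), if_pos ⟨rfl, by simp only; omega⟩] at h3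
    refine ⟨ε * oreSign n n m, ε • paramMk k n (topProd k n m) *
      paramMk k n (coeff k n (2 * powerSumPoly k n m)) +
        (-1 : ℤ) ^ (n - 1) • (g * paramMk k n (y k n ⟨m, by omega⟩)),
      by rw [mul_mul_mul_comm, h1, oreSign_mul_self, one_mul], ?_⟩
    rw [topProd_succ ⟨m, by omega⟩, map_mul, ← mul_assoc, h2, add_mul, smul_mul_assoc, mul_assoc,
      mul_assoc g, ← map_mul (paramMk k n) (y k n (Fin.last n)), h3,
      ← map_mul (paramMk k n) (y k n ⟨n - 1, _⟩), u_mul_y (by simp only; omega), map_add,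
      map_zsmul, map_zsmul, map_mul, map_mul, map_mul, mul_add, smul_add, mul_smul_comm, smul_smul,
      mul_smul_comm, add_mul, smul_mul_assoc, smul_mul_assoc, smul_mul_assoc, add_assoc, mul_assoc,
      mul_assoc, mul_assoc]
    rfl

theorem exists_paramMk_y_mul_topProd (hn : 1 ≤ n) (j : Fin (n + 1)) : ∃ ε : ℤ, ε * ε = 1 ∧
    paramMk k n (y k n j) * paramMk k n (topProd k n j) =
      ε • (paramMk k n (topProd k n j) * paramMk k n (y k n j)) := by
  by_cases hj : (j : ℕ) < n
  · exact exists_paramMk_y_mul_topProd_of_lt hj j le_rfl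
  obtain rfl : j = Fin.last n := Fin.ext (by have := j.2; simp; omega)
  obtain ⟨ε, g, h1, h2⟩ := exists_paramMk_v_mul_topProd (k := k) (n - 1) (n := n) (by omega)
  have h3 : topProd k n n = topProd k n (n - 1) * y k n ⟨n - 1, by omega⟩ := by
    rw [← topProd_succ ⟨n - 1, by omega⟩]
    congr 1
    simp only
    omega
  refine ⟨ε * (-1) ^ (n + 1), by
    rw [mul_mul_mul_comm, h1, ← mul_pow]; simp, ?_⟩
  rw [Fin.val_last, h3, map_mul, ← mul_assoc, h2, add_mul, mul_assoc g, paramMk_y_mul_self,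
    mul_zero, add_zero, smul_mul_assoc, mul_assoc, ← map_mul _ (y k n (Fin.last n)), v_mul_u hn,
    map_zsmul, mul_smul_comm, smul_smul, map_mul, mul_assoc]

variable [CharZero k]

theorem isCentralRegularOn_paramSeq (hn : 1 ≤ n) (j : ℕ) (hj : j ≤ n + 1) :
    IsCentralRegularOn (tower k n j) (paramSeq k n) (n + j) := by
  induction j with
  | zero => exact isCentralRegularOn_paramSeq_zero
  | succ j ih =>
    obtain ⟨τ, δ, h, -⟩ := exists_isOreExtension (k := k) hn ⟨j, by omega⟩
    exact h.isCentralRegularOn_succ (fun i hi => paramSeq_mem_tower hi) (ih (by omega))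
      (zero_mem _) (fun a => by rw [mul_zero, zero_mul]) (fun i _ => paramSeq_central i)
      ((paramSeq_add (by omega)).trans (sub_zero _).symm)

theorem mem_of_add_mul_mem_paramIdeal (hn : 1 ≤ n) (j : Fin (n + 1)) {s₀ s₁ : OreAlg k n}
    (h₀ : s₀ ∈ tower k n j) (h₁ : s₁ ∈ tower k n j)
    (h : s₀ + s₁ * y k n j ∈ subalgebraIdeal (tower k n (j + 1)) (paramSeq k n) (n + j + 1)) :
    s₀ ∈ subalgebraIdeal (tower k n j) (paramSeq k n) (n + j) ∧
      s₁ ∈ subalgebraIdeal (tower k n j) (paramSeq k n) (n + j) := by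
  obtain ⟨τ, δ, hO, -⟩ := exists_isOreExtension (k := k) hn j
  exact hO.mem_of_add_mul_mem (fun i hi => paramSeq_mem_tower hi) (fun i _ => paramSeq_central i)
    (paramSeq_add j.2) h₀ h₁ h

theorem mem_subalgebraIdeal_of_mem_paramIdeal (hn : 1 ≤ n) (d : ℕ) {j : ℕ} (hj : j + d = n + 1)
    {s : OreAlg k n} (hs : s ∈ tower k n j) (h : s ∈ paramIdeal k n) :
    s ∈ subalgebraIdeal (tower k n j) (paramSeq k n) (n + j) := by
  induction d generalizing j with
  | zero =>
    obtain rfl : j = n + 1 := hj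
    exact mem_paramIdeal_iff.1 h
  | succ d ih =>
    refine (mem_of_add_mul_mem_paramIdeal hn ⟨j, by omega⟩ hs (zero_mem _) ?_).1
    rw [zero_mul, add_zero]
    exact ih (j := j + 1) (by omega) (tower_mono (Nat.le_succ j) hs)

omit [CharZero k] in
theorem subalgebraIdeal_le_paramIdeal {j : ℕ} (hj : j ≤ n + 1) {s : OreAlg k n}
    (h : s ∈ subalgebraIdeal (tower k n j) (paramSeq k n) (n + j)) : s ∈ paramIdeal k n :=
  mem_paramIdeal_iff.2 (subalgebraIdeal_mono_left (tower_mono hj) _ _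
    (subalgebraIdeal_mono_right _ _ (by omega) h))

/-- Modulo `paramIdeal`, the elements `1` and `y j` are independent over the stage before `y j`. -/
theorem paramMk_add_mul_eq_zero (hn : 1 ≤ n) (j : Fin (n + 1)) {s₀ s₁ : OreAlg k n}
    (h₀ : s₀ ∈ tower k n j) (h₁ : s₁ ∈ tower k n j)
    (h : paramMk k n s₀ + paramMk k n s₁ * paramMk k n (y k n j) = 0) :
    paramMk k n s₀ = 0 ∧ paramMk k n s₁ = 0 := by
  rw [← map_mul, ← map_add, paramMk_eq_zero] at h
  have h' := mem_subalgebraIdeal_of_mem_paramIdeal hn (n - j) (j := j + 1) (by have := j.2; omega)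
    (add_mem (tower_mono (Nat.le_succ j) h₀)
      (mul_mem (tower_mono (Nat.le_succ j) h₁) (y_mem_tower (Nat.lt_succ_self j)))) h
  obtain ⟨h2, h3⟩ := mem_of_add_mul_mem_paramIdeal hn j h₀ h₁ h'
  rw [paramMk_eq_zero, paramMk_eq_zero]
  exact ⟨subalgebraIdeal_le_paramIdeal j.2.le h2, subalgebraIdeal_le_paramIdeal j.2.le h3⟩

omit [CharZero k] in
theorem exists_paramMk_eq (j : Fin (n + 1)) {s : OreAlg k n} (hs : s ∈ tower k n (j + 1)) :
    ∃ s₀ ∈ tower k n j, ∃ s₁ ∈ tower k n j,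
      paramMk k n s = paramMk k n s₀ + paramMk k n s₁ * paramMk k n (y k n j) := by
  obtain ⟨c, rfl⟩ := exists_tower_evalPowers j hs
  refine ⟨c 0, (c 0).2, c 1, (c 1).2, ?_⟩
  clear hs
  induction c using Finsupp.induction_linear with
  | zero => simp
  | add f g hf hg =>
    rw [map_add, map_add, hf, hg, Finsupp.add_apply, Finsupp.add_apply, Subalgebra.coe_add,
      Subalgebra.coe_add, map_add, map_add, add_mul]
    abel
  | single i s =>
    rw [IsOreExtension.evalPowers_single, map_mul, map_pow]
    match i with
    | 0 => simp
    | 1 => simp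
    | i + 2 =>
      rw [pow_add, pow_two, paramMk_y_mul_self]
      simp

theorem paramMk_topProd_ne_zero (hn : 1 ≤ n) (j : ℕ) (hj : j ≤ n + 1) :
    paramMk k n (topProd k n j) ≠ 0 := by
  induction j with
  | zero => exact paramMk_one_ne_zero
  | succ j ih =>
    intro h
    rw [topProd_succ ⟨j, by omega⟩, map_mul, ← zero_add (_ * _), ← map_zero (paramMk k n)] at h
    exact ih (by omega) (paramMk_add_mul_eq_zero hn ⟨j, by omega⟩ (zero_mem _)
      (topProd_mem_tower j (by omega)) h).2

/-- The elements of a stage of the tower that are annihilated, modulo `paramIdeal`, by the generators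
of that stage are the multiples of the product of these generators. -/
theorem exists_eq_smul_topProd (hn : 1 ≤ n) (j : ℕ) (hj : j ≤ n + 1) : ∀ s ∈ tower k n j,
    (∀ i : Fin (n + 1), (i : ℕ) < j → paramMk k n (y k n i) * paramMk k n s = 0) →
    ∃ c : k, paramMk k n s = paramMk k n (c • topProd k n j) := by
  induction j with
  | zero =>
    intro s hs _
    obtain ⟨f, rfl⟩ : s ∈ Set.range (coeff k n) := by rw [← tower_zero]; exact hs
    refine ⟨constantCoeff f, sub_eq_zero.1 ?_⟩
    rw [topProd, ← Algebra.algebraMap_eq_smul_one, algebraMap_eq, ← map_sub, ← map_sub]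
    exact paramMk_coeff (by rw [map_sub, constantCoeff_C, sub_self])
  | succ j ih =>
    intro s hs hann
    let J : Fin (n + 1) := ⟨j, by omega⟩
    obtain ⟨s₀, h₀, s₁, h₁, hs01⟩ := exists_paramMk_eq J hs
    have hann' : ∀ i : Fin (n + 1), (i : ℕ) < j → paramMk k n (y k n i) * paramMk k n s₀ = 0 ∧
        paramMk k n (y k n i) * paramMk k n s₁ = 0 := by
      intro i hi
      have h := hann i (by omega)
      rw [hs01, mul_add, ← mul_assoc, ← map_mul, ← map_mul] at h
      rw [← map_mul, ← map_mul]
      exact paramMk_add_mul_eq_zero hn J (mul_mem (y_mem_tower hi) h₀)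
        (mul_mem (y_mem_tower hi) h₁) h
    obtain ⟨a, ha⟩ := ih (by omega) s₀ h₀ fun i hi => (hann' i hi).1
    obtain ⟨b, hb⟩ := ih (by omega) s₁ h₁ fun i hi => (hann' i hi).2
    have hcen : ∀ c : k, ∀ t, paramMk k n (c • t) = paramMk k n (algebraMap k _ c) * paramMk k n t :=
      fun c t => by rw [Algebra.smul_def, map_mul]
    have hcen' : ∀ c : k, ∀ t, paramMk k n t * paramMk k n (algebraMap k _ c) =
        paramMk k n (algebraMap k _ c) * paramMk k n t := fun c t => by
      rw [← map_mul, ← map_mul, Algebra.commutes]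
    obtain ⟨ε, hε, hεt⟩ := exists_paramMk_y_mul_topProd (k := k) hn J
    have h := hann J (Nat.lt_succ_self j)
    rw [hs01, ha, hb, hcen, hcen, mul_add, ← mul_assoc, hcen', mul_assoc, hεt, ← mul_assoc,
      ← mul_assoc, hcen', mul_assoc _ _ (paramMk k n (topProd k n j)), hεt, mul_assoc _ _
      (paramMk k n (y k n J)), smul_mul_assoc, mul_assoc (paramMk k n (topProd k n J)),
      paramMk_y_mul_self, mul_zero, smul_zero, mul_zero, add_zero, mul_smul_comm, ← mul_assoc,
      ← hcen, ← smul_mul_assoc, ← map_zsmul, ← zero_add (_ * _), ← map_zero (paramMk k n)] at h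
    have h2 := (paramMk_add_mul_eq_zero hn J (zero_mem _) (zsmul_mem (Subalgebra.smul_mem _
      (topProd_mem_tower j (by omega)) a) ε) h).2
    have h3 : paramMk k n s₀ = 0 := by
      have h4 := congrArg (ε • ·) h2
      rw [map_zsmul, smul_smul, hε, one_smul, smul_zero] at h4
      rw [ha]
      exact h4
    refine ⟨b, ?_⟩
    rw [hs01, h3, zero_add, hb, topProd_succ J, ← map_mul, smul_mul_assoc]

/-- The Gorenstein property of the quotient of `C` by the central sequence `paramSeq`: its socle is
spanned by the product of all generators. -/
theorem isGorensteinSequence (hn : 2 ≤ n) : IsGorensteinSequence k (grading k n) (paramSeq k n)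
    (2 * n + 1) (topProd k n (n + 1)) := by
  have hy_top : ∀ i, paramMk k n (y k n i) * paramMk k n (topProd k n (n + 1)) = 0 := by
    intro i
    suffices ∀ m, (i : ℕ) + 1 + m ≤ n + 1 →
        paramMk k n (y k n i) * paramMk k n (topProd k n (i + 1 + m)) = 0 by
      have := this (n - i) (by have := i.2; omega)
      rwa [show (i : ℕ) + 1 + (n - i) = n + 1 by have := i.2; omega] at this
    intro m
    induction m with
    | zero =>
      intro _
      obtain ⟨ε, hε, h⟩ := exists_paramMk_y_mul_topProd (k := k) (show 1 ≤ n by omega) i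
      rw [add_zero, topProd_succ, map_mul, ← mul_assoc, h, smul_mul_assoc, mul_assoc,
        paramMk_y_mul_self, mul_zero, smul_zero]
    | succ m ih =>
      intro hm
      rw [← add_assoc, topProd_succ ⟨i + 1 + m, by omega⟩, map_mul, ← mul_assoc, ih (by omega),
        zero_mul]
  have htop_y : ∀ i, paramMk k n (topProd k n (n + 1)) * paramMk k n (y k n i) = 0 := by
    intro i
    obtain ⟨c, hc⟩ := exists_eq_smul_topProd (k := k) (n := n) (by omega) (n + 1) le_rfl
      (topProd k n (n + 1) * y k n i) (by rw [tower_top]; trivial) fun j _ => by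
        rw [map_mul, ← mul_assoc, hy_top, zero_mul]
    rw [map_mul] at hc
    -- The scalar `c` vanishes because `y i` has square zero.
    have h2 := congrArg (· * paramMk k n (y k n i)) hc
    rw [mul_assoc, paramMk_y_mul_self, mul_zero, Algebra.smul_def, map_mul, mul_assoc, hc,
      ← map_mul, ← Algebra.smul_def, smul_smul] at h2
    rcases eq_or_ne c 0 with rfl | hc0
    · rw [hc, zero_smul, map_zero]
    · exfalso
      refine paramMk_topProd_ne_zero (k := k) (n := n) (by omega) (n + 1) le_rfl ?_
      have h3 := congrArg (paramMk k n (algebraMap k _ (c * c)⁻¹) * ·) h2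
      rwa [mul_zero, ← map_mul, ← Algebra.smul_def, smul_smul,
        inv_mul_cancel₀ (mul_ne_zero hc0 hc0), one_smul, eq_comm] at h3
  have hgen : ∀ i, 0 < i → ∀ a ∈ grading k n i,
      paramMk k n a * paramMk k n (topProd k n (n + 1)) = 0 ∧
        paramMk k n (topProd k n (n + 1)) * paramMk k n a = 0 := by
    intro i hi a ha
    rw [grading_eq_span] at ha
    induction ha using Submodule.span_induction with
    | mem _ h =>
      obtain ⟨m, l, hd, rfl⟩ := h
      have hcomm : paramMk k n (coeff k n (monomial m 1)) * paramMk k n (l.map (y k n)).prod =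
          paramMk k n (l.map (y k n)).prod * paramMk k n (coeff k n (monomial m 1)) := by
        rw [← map_mul, coeff_commutes, map_mul]
      rcases List.eq_nil_or_concat l with rfl | ⟨l', j, hl⟩
      · have hm : m ≠ 0 := by
          rintro rfl
          simp at hd
          omega
        have : paramMk k n (coeff k n (monomial m 1)) = 0 :=
          paramMk_coeff (by
            classical
            rw [constantCoeff_eq, coeff_monomial, if_neg hm])
        rw [map_mul, this, zero_mul, zero_mul, mul_zero]
        exact ⟨rfl, rfl⟩
      · constructor
        · rw [map_mul, mul_assoc, hl, List.concat_eq_append, List.map_append, List.prod_append,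
            List.map_singleton, List.prod_singleton, map_mul, mul_assoc, hy_top, mul_zero, mul_zero]
        · cases l with
          | nil => simp at hl
          | cons j l =>
            rw [map_mul, hcomm, List.map_cons, List.prod_cons, map_mul, mul_assoc, ← mul_assoc,
              htop_y, zero_mul]
    | zero => simp
    | add a b _ _ ha hb =>
      rw [map_add, add_mul, mul_add, ha.1, hb.1, ha.2, hb.2, add_zero]
      exact ⟨rfl, rfl⟩
    | smul c a _ ha =>
      have : paramMk k n (c • a) = paramMk k n (algebraMap k _ c) * paramMk k n a := by
        rw [Algebra.smul_def, map_mul]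
      have h2 : paramMk k n (c • a) = paramMk k n a * paramMk k n (algebraMap k _ c) := by
        rw [Algebra.smul_def, Algebra.commutes, map_mul]
      refine ⟨by rw [this, mul_assoc, ha.1, mul_zero], by rw [h2, ← mul_assoc, ha.2, zero_mul]⟩
  exact
  { central := fun i _ => paramSeq_central i
    mem_positivePart := fun i hi => by
      unfold paramSeq
      split_ifs with h1 h2
      · exact Ideal.subset_span ⟨_, Nat.mul_pos two_pos (Nat.succ_pos i),
          coeff_mem_grading (weightCoaction_X k n ⟨i, h1⟩)⟩
      · exact Ideal.subset_span ⟨_, Nat.mul_pos two_pos (weight_pos hn _), y_sq_mem_grading _⟩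
      · exact zero_mem _
    regular := fun i hi a ha => by
      rw [← mem_subalgebraIdeal_top_iff (k := k) fun i _ => paramSeq_central i,
        ← tower_top (k := k)] at ha ⊢
      exact isCentralRegularOn_paramSeq (by omega) (n + 1) le_rfl i (by omega) a
        (by rw [tower_top]; trivial) ha
    top_notMem := fun h => paramMk_topProd_ne_zero (k := k) (n := n) (by omega) (n + 1) le_rfl
      (paramMk_eq_zero.2 h)
    mul_top := fun i hi a ha => by
      have := (hgen i hi a ha).1
      rwa [← map_mul, paramMk_eq_zero] at this
    top_mul := fun i hi a ha => by
      have := (hgen i hi a ha).2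
      rwa [← map_mul, paramMk_eq_zero] at this
    socle := fun s hs => by
      obtain ⟨c, hc⟩ := exists_eq_smul_topProd (k := k) (n := n) (by omega) (n + 1) le_rfl s
        (by rw [tower_top]; trivial) fun i _ => by
          rw [← map_mul, paramMk_eq_zero]
          exact hs _ (weight_pos hn i) _ (y_mem_grading i)
      refine ⟨c, ?_⟩
      rw [← sub_eq_zero, ← map_sub, paramMk_eq_zero] at hc
      exact hc }

theorem isASRegular (hn : 2 ≤ n) : IsASRegular k (grading k n) (2 * n + 1) where
  isConnectedGraded := isConnectedGraded hn
  isASGorenstein := by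
    have h := isGorensteinSequence (k := k) hn
    obtain ⟨e, h1, h2, h3⟩ := exists_antiautomorphism (k := k) (n := n) (by omega)
    exact ⟨h.isLeftASGorenstein (injectiveDimensionsLE (by omega)),
      (h.map e (mem_grading_iff_of_antiautomorphism h1 h2 h3)).isLeftASGorenstein
        (injectiveDimensionsLE_mulOpposite (by omega))⟩
  globalDimension_left := (injectiveDimensionsLE (by omega)).hasFiniteGlobalDimension
  globalDimension_right := (injectiveDimensionsLE_mulOpposite (by omega)).hasFiniteGlobalDimension
  gelfandKirillovDim_ne_top := gelfandKirillovDim_ne_top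

end OreAlg

namespace SkewPoly

open MvPolynomial

variable {k : Type u} [Field k] {n : ℕ}

/-! ### Symmetrization -/

variable (k n) in
/-- The sum over all permutations of the variables. -/
def symmetrize : SkewPoly k n →ₗ[k] SkewPoly k n :=
  ∑ σ : Equiv.Perm (Fin n), (perm k σ).toLinearMap

variable (k n) in
/-- The signed sum over all permutations of the variables. -/
def antisymmetrize : SkewPoly k n →ₗ[k] SkewPoly k n :=
  ∑ σ : Equiv.Perm (Fin n), (Equiv.Perm.sign σ : ℤ) • (perm k σ).toLinearMap

theorem symmetrize_apply (a : SkewPoly k n) :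
    symmetrize k n a = ∑ σ : Equiv.Perm (Fin n), perm k σ a := by
  rw [symmetrize, LinearMap.sum_apply]; rfl

theorem antisymmetrize_apply (a : SkewPoly k n) : antisymmetrize k n a =
    ∑ σ : Equiv.Perm (Fin n), (Equiv.Perm.sign σ : ℤ) • perm k σ a := by
  rw [antisymmetrize, LinearMap.sum_apply]; rfl

theorem symmetrize_perm (τ : Equiv.Perm (Fin n)) (a : SkewPoly k n) :
    symmetrize k n (perm k τ a) = symmetrize k n a := by
  rw [symmetrize_apply, symmetrize_apply, ← Equiv.sum_comp (Equiv.mulRight τ) fun σ =>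
    perm k σ a]
  exact Finset.sum_congr rfl fun σ _ => (perm_mul σ τ a).symm

theorem antisymmetrize_perm (τ : Equiv.Perm (Fin n)) (a : SkewPoly k n) :
    antisymmetrize k n (perm k τ a) = (Equiv.Perm.sign τ : ℤ) • antisymmetrize k n a := by
  rw [antisymmetrize_apply, antisymmetrize_apply, ← Equiv.sum_comp (Equiv.mulRight τ) fun σ =>
    (Equiv.Perm.sign σ : ℤ) • perm k σ a, Finset.smul_sum]
  refine Finset.sum_congr rfl fun σ _ => ?_
  rw [Equiv.coe_mulRight, perm_mul, Equiv.Perm.sign_mul, Units.val_mul, smul_smul]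
  congr 1
  rw [mul_left_comm, ← Units.val_mul, Int.units_mul_self]
  simp

theorem symmetrize_mul {e : SkewPoly k n} (he : ∀ σ, perm k σ e = e) (a : SkewPoly k n) :
    symmetrize k n (e * a) = e * symmetrize k n a := by
  rw [symmetrize_apply, symmetrize_apply, Finset.mul_sum]
  exact Finset.sum_congr rfl fun σ _ => by rw [map_mul, he]

theorem antisymmetrize_mul {e : SkewPoly k n}
    (he : ∀ σ, perm k σ e = (Equiv.Perm.sign σ : ℤ) • e) (a : SkewPoly k n) :
    antisymmetrize k n (e * a) = e * symmetrize k n a := by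
  rw [symmetrize_apply, antisymmetrize_apply, Finset.mul_sum]
  refine Finset.sum_congr rfl fun σ _ => ?_
  rw [map_mul, he, smul_mul_assoc, smul_smul, ← Units.val_mul, Int.units_mul_self, Units.val_one,
    one_smul]

theorem perm_powerSum (σ : Equiv.Perm (Fin n)) (m : ℕ) :
    perm k σ (powerSum k n m) = powerSum k n m := by
  rw [powerSum, map_sum]
  simp only [map_pow, perm_x]
  exact Equiv.sum_comp σ fun i => x k n i ^ m

/-! ### Subalgebras generated by some of the variables -/

variable (k) in
/-- The subalgebra generated by the variables in `S`. -/
def varAlg (S : Finset (Fin n)) : Subalgebra k (SkewPoly k n) :=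
  Algebra.adjoin k (x k n '' S)

theorem x_mem_varAlg {S : Finset (Fin n)} {i : Fin n} (hi : i ∈ S) : x k n i ∈ varAlg k S :=
  Algebra.subset_adjoin ⟨i, hi, rfl⟩

theorem mem_varAlg_univ (a : SkewPoly k n) : a ∈ varAlg k (Finset.univ : Finset (Fin n)) := by
  induction a using SkewPoly.induction with
  | hc c => exact Subalgebra.algebraMap_mem _ c
  | hx i => exact x_mem_varAlg (Finset.mem_univ i)
  | hmul a b ha hb => exact mul_mem ha hb
  | hadd a b ha hb => exact add_mem ha hb

theorem perm_eq_self_of_mem_varAlg {S : Finset (Fin n)} {σ : Equiv.Perm (Fin n)}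
    (hσ : ∀ i ∈ S, σ i = i) {a : SkewPoly k n} (ha : a ∈ varAlg k S) : perm k σ a = a := by
  induction ha using Algebra.adjoin_induction with
  | mem _ h => obtain ⟨i, hi, rfl⟩ := h; rw [perm_x, hσ i hi]
  | algebraMap c => rw [AlgHom.commutes]
  | add a b _ _ ha hb => rw [map_add, ha, hb]
  | mul a b _ _ ha hb => rw [map_mul, ha, hb]

theorem swap_eq_self_of_mem_varAlg {S : Finset (Fin n)} {i j : Fin n} (hi : i ∉ S) (hj : j ∉ S)
    {a : SkewPoly k n} (ha : a ∈ varAlg k S) : perm k (Equiv.swap i j) a = a :=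
  perm_eq_self_of_mem_varAlg (fun l hl => Equiv.swap_apply_of_ne_of_ne (by rintro rfl; exact hi hl)
    (by rintro rfl; exact hj hl)) ha

theorem mem_span_of_mem_varAlg_insert {S : Finset (Fin n)} {l : Fin n} (hl : l ∉ S)
    {a : SkewPoly k n} (ha : a ∈ varAlg k (insert l S)) :
    a ∈ Submodule.span k {c | ∃ (b : ℕ), ∃ e ∈ varAlg k S, c = x k n l ^ b * e} := by
  set N := Submodule.span k {c | ∃ (b : ℕ), ∃ e ∈ varAlg k S, c = x k n l ^ b * e}
  have hx : ∀ i ∈ insert l S, ∀ c ∈ N, x k n i * c ∈ N := by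
    intro i hi c hc
    induction hc using Submodule.span_induction with
    | mem _ h =>
      obtain ⟨b, e, he, rfl⟩ := h
      rcases Finset.mem_insert.1 hi with rfl | hiS
      · exact Submodule.subset_span ⟨b + 1, e, he, by rw [← mul_assoc, ← pow_succ']⟩
      · have hil : i ≠ l := by rintro rfl; exact hl hiS
        rw [← mul_assoc, x_mul_pow hil, smul_mul_assoc, mul_assoc]
        have h1 : x k n l ^ b * (x k n i * e) ∈ N :=
          Submodule.subset_span ⟨b, x k n i * e, mul_mem (x_mem_varAlg hiS) he, rfl⟩
        exact zsmul_mem h1 _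
    | zero => rw [mul_zero]; exact zero_mem _
    | add a b _ _ ha hb => rw [mul_add]; exact add_mem ha hb
    | smul r a _ ha => rw [mul_smul_comm]; exact Submodule.smul_mem _ _ ha
  have key : ∀ c ∈ N, a * c ∈ N := by
    induction ha using Algebra.adjoin_induction with
    | mem _ h => obtain ⟨i, hi, rfl⟩ := h; exact hx i hi
    | algebraMap r => intro c hc; rw [← Algebra.smul_def]; exact Submodule.smul_mem _ _ hc
    | add a b _ _ ha hb => intro c hc; rw [add_mul]; exact add_mem (ha c hc) (hb c hc)
    | mul a b _ _ ha hb => intro c hc; rw [mul_assoc]; exact ha _ (hb c hc)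
  rw [← mul_one a]
  exact key 1 (Submodule.subset_span ⟨0, 1, one_mem _, by simp⟩)

theorem orderedMonomial_mem_varAlg {a : Fin n → ℕ} {S : Finset (Fin n)}
    (ha : ∀ i, i ∉ S → a i = 0) : orderedMonomial k a ∈ varAlg k S := by
  refine Subalgebra.list_prod_mem _ fun c hc => ?_
  obtain ⟨i, -, rfl⟩ := List.mem_map.1 hc
  by_cases hi : i ∈ S
  · exact pow_mem (x_mem_varAlg hi) _
  · rw [ha i hi, pow_zero]
    exact one_mem _

theorem exists_word_mul_orderedMonomial (l : List (Fin n)) (a : Fin n → ℕ) : ∃ m : ℕ,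
    word k l * orderedMonomial k a = (-1 : ℤ) ^ m •
      orderedMonomial k (a + (l.map fun i => Pi.single i 1).sum) := by
  induction l with
  | nil => exact ⟨0, by simp [word_nil]⟩
  | cons i l ih =>
    obtain ⟨m, hm⟩ := ih
    obtain ⟨m', hm'⟩ := exists_x_mul_orderedMonomial (k := k)
      (a + (l.map fun i => Pi.single i 1).sum) i
    refine ⟨m + m', ?_⟩
    rw [word_cons, mul_assoc, hm, mul_smul_comm, hm', smul_smul, pow_add, List.map_cons,
      List.sum_cons, add_assoc, add_comm (List.sum _)]

/-- An ordered monomial in which all variables occur is divisible by their product. -/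
theorem exists_orderedMonomial_eq_fullProd_mul {a : Fin n → ℕ} (ha : ∀ i, a i ≠ 0) : ∃ m : ℕ,
    orderedMonomial k a = (-1 : ℤ) ^ m • (fullProd k n * orderedMonomial k fun i => a i - 1) := by
  obtain ⟨m, hm⟩ := exists_word_mul_orderedMonomial (k := k) (List.finRange n) fun i => a i - 1
  have h1 : (fun i => a i - 1) + ((List.finRange n).map fun i => Pi.single i 1).sum = a := by
    ext i
    have h2 : ((List.finRange n).map fun i => (Pi.single i 1 : Fin n → ℕ)).sum i = 1 := by
      rw [← List.ofFn_eq_map, List.sum_ofFn, Finset.sum_apply]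
      simp [Pi.single_apply]
    rw [Pi.add_apply, h2]
    have := ha i
    omega
  refine ⟨m, ?_⟩
  rw [fullProd_eq_word, hm, OreAlg.neg_one_pow_smul_smul, h1]

theorem x_mul_cancel {i : Fin n} {a b : SkewPoly k n} (h : x k n i * a = x k n i * b) : a = b := by
  refine sub_eq_zero.1 (eq_zero_of_sq_mul (X_ne_zero i) ?_)
  rw [sq_X, pow_two, mul_assoc, mul_sub, h, sub_self, mul_zero]

/-- An ordered monomial in which all variables but one occur is divisible by the corresponding
cofactor. -/
theorem exists_orderedMonomial_eq_cofactor_mul {a : Fin n → ℕ} {l : Fin n} (hl : a l = 0)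
    (ha : ∀ i, i ≠ l → a i ≠ 0) : ∃ m : ℕ, orderedMonomial k a =
      (-1 : ℤ) ^ m • (cofactor k l * orderedMonomial k fun i => a i - 1) := by
  obtain ⟨m, hm⟩ := exists_x_mul_orderedMonomial (k := k) a l
  obtain ⟨m', hm'⟩ := exists_orderedMonomial_eq_fullProd_mul (k := k) (a := a + Pi.single l 1)
    fun i => by
      rcases eq_or_ne i l with rfl | h
      · simp
      · simpa [h] using ha i h
  have h1 : (fun i => (a + Pi.single l 1 : Fin n → ℕ) i - 1) = fun i => a i - 1 := by
    ext i
    rcases eq_or_ne i l with rfl | h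
    · simp [hl]
    · simp [h]
  have h2 : fullProd k n = (-1 : ℤ) ^ (n - 1) • (x k n l * cofactor k l) := by
    rw [x_mul_cofactor, OreAlg.neg_one_pow_smul_smul]
  refine ⟨m + (m' + (n - 1)), x_mul_cancel (i := l) ?_⟩
  rw [hm, hm', h1, h2, smul_mul_assoc, smul_smul, smul_smul, mul_smul_comm, mul_assoc, mul_assoc,
    pow_add, pow_add]

end SkewPoly

namespace SkewPoly

open MvPolynomial

variable {k : Type u} [Field k] {n : ℕ}

/-! ### Invariants lie in the subalgebra generated by the images of the generators -/

variable (k) in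
/-- Every variable is a root of the polynomial with the elementary symmetric polynomials as
coefficients. -/
theorem sum_esymm_mul_pow (l : Fin n) :
    ∑ i ∈ Finset.range (n + 1), (-1) ^ i * esymm (Fin n) k i * X l ^ (n - i) = 0 := by
  have h := congrArg (Polynomial.eval (-X l)) (prod_C_add_X_eq_sum_esymm k (Fin n))
  rw [Polynomial.eval_prod, Finset.prod_eq_zero (Finset.mem_univ l) (by simp),
    Polynomial.eval_finsetSum, Fintype.card_fin] at h
  have h2 : (-1) ^ n * ∑ i ∈ Finset.range (n + 1), Polynomial.eval (-X l)
      (Polynomial.C (esymm (Fin n) k i) * Polynomial.X ^ (n - i)) = 0 := by rw [← h, mul_zero]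
  rw [Finset.mul_sum] at h2
  rw [← h2]
  refine Finset.sum_congr rfl fun i hi => ?_
  obtain ⟨c, hc⟩ := Nat.exists_eq_add_of_le (Nat.lt_succ_iff.1 (Finset.mem_range.1 hi))
  rw [Polynomial.eval_mul, Polynomial.eval_C, Polynomial.eval_pow, Polynomial.eval_X,
    show n - i = c by omega, neg_pow (X l : MvPolynomial (Fin n) k)]
  have : ((-1 : MvPolynomial (Fin n) k) ^ c) * (-1) ^ c = 1 := by
    rw [← mul_pow]; simp
  have hs : (-1 : MvPolynomial (Fin n) k) ^ n = (-1) ^ i * (-1) ^ c := by rw [hc, pow_add]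
  rw [hs]
  linear_combination (-(-1) ^ i * esymm (Fin n) k i * X l ^ c) * this

theorem sq_mem_range {f : MvPolynomial (Fin n) k} (hf : f.IsSymmetric) :
    sq k n f ∈ (toSkewPoly k n).range := by
  refine ⟨OreAlg.coeff k n ((esymmAlgEquiv (Fin n) k (Fintype.card_fin n)).symm ⟨f, hf⟩), ?_⟩
  change toSkewPoly k n _ = _
  rw [toSkewPoly_coeff]
  congr 1
  change ((esymmAlgEquiv (Fin n) k (Fintype.card_fin n)) _ : MvPolynomial (Fin n) k) = _
  rw [AlgEquiv.apply_symm_apply]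

theorem gen_mem_range (i : Fin (n + 1)) : gen k n i ∈ (toSkewPoly k n).range :=
  ⟨OreAlg.y k n i, toSkewPoly_y i⟩

theorem fullProd_mem_range (hn : 1 ≤ n) : fullProd k n ∈ (toSkewPoly k n).range := by
  rw [← gen_pred hn]
  exact gen_mem_range ⟨n - 1, by omega⟩

theorem cofactorSum_mem_range : cofactorSum k n ∈ (toSkewPoly k n).range := by
  rw [← gen_self]
  exact gen_mem_range (Fin.last n)

theorem sum_sq_mul_pow_mul_x (c : MvPolynomial (Fin n) k) (m : ℕ) :
    ∑ l, sq k n (c * X l ^ m) * x k n l = sq k n c * powerSum k n (2 * m + 1) := by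
  rw [powerSum, Finset.mul_sum]
  refine Finset.sum_congr rfl fun l _ => ?_
  rw [map_mul, map_pow, sq_X, ← pow_mul, mul_assoc, ← pow_succ]

theorem signed_esymm_isSymmetric (i : ℕ) : ((-1) ^ i * esymm (Fin n) k i).IsSymmetric := by
  refine IsSymmetric.mul (fun σ => ?_) (esymm_isSymmetric _ _ _)
  rw [map_pow, map_neg, map_one]

/-- The product `u v` expresses the power sum of degree `2 n - 1` through the lower ones, since
`u` times the `l`-th cofactor is `x_l` times a symmetric expression in the squares and `x_l`. -/
theorem sum_sq_esymm_mul_powerSum_mem_range (hn : 1 ≤ n) :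
    ∑ i ∈ Finset.range n, sq k n ((-1) ^ i * esymm (Fin n) k i) *
      powerSum k n (2 * (n - 1 - i) + 1) ∈ (toSkewPoly k n).range := by
  have key : ∀ l, sq k n (∑ i ∈ Finset.range n,
      (-1) ^ i * esymm (Fin n) k i * X l ^ (n - 1 - i)) * x k n l =
        (-(-1 : ℤ) ^ n * (-1) ^ (n * (n - 1) / 2)) • (fullProd k n * cofactor k l) := by
    intro l
    apply mul_x_cancel (i := l)
    have h1 := sum_esymm_mul_pow k l
    have h2 : esymm (Fin n) k n = ∏ i, X i := by
      have h3 := Finset.powersetCard_self (Finset.univ : Finset (Fin n))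
      rw [Finset.card_univ, Fintype.card_fin] at h3
      rw [esymm, h3, Finset.sum_singleton]
    rw [Finset.sum_range_succ, Nat.sub_self, pow_zero, mul_one, h2] at h1
    have h4 : (∑ i ∈ Finset.range n, (-1) ^ i * esymm (Fin n) k i * X l ^ (n - 1 - i)) * X l =
        (-(-1 : ℤ) ^ n) • ∏ i, X i := by
      rw [zsmul_eq_mul, Finset.sum_mul, ← sub_eq_zero, ← h1, sub_eq_add_neg]
      congr 1
      · refine Finset.sum_congr rfl fun i hi => ?_
        have := Finset.mem_range.1 hi
        rw [mul_assoc, ← pow_succ, show n - 1 - i + 1 = n - i by omega]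
      · push_cast; ring
    rw [mul_assoc, ← pow_two, ← sq_X, ← map_mul, h4, smul_mul_assoc, mul_assoc, cofactor_mul_x,
      fullProd_mul_self, smul_smul, map_zsmul, mul_assoc, ← pow_add, ← two_mul, pow_mul]
    simp
  have h5 : ∑ i ∈ Finset.range n, sq k n ((-1) ^ i * esymm (Fin n) k i) *
      powerSum k n (2 * (n - 1 - i) + 1) =
        (-(-1 : ℤ) ^ n * (-1) ^ (n * (n - 1) / 2)) • (fullProd k n * cofactorSum k n) := by
    simp only [← sum_sq_mul_pow_mul_x]
    rw [Finset.sum_comm, cofactorSum, Finset.mul_sum, Finset.smul_sum]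
    refine Finset.sum_congr rfl fun l _ => ?_
    rw [← key, map_sum, Finset.sum_mul]
  rw [h5]
  exact zsmul_mem (mul_mem (fullProd_mem_range hn) cofactorSum_mem_range) _

theorem sum_sq_esymm_mul_powerSum_add (j : ℕ) :
    ∑ i ∈ Finset.range (n + 1), sq k n ((-1) ^ i * esymm (Fin n) k i) *
      powerSum k n (2 * (n - i + j) + 1) = 0 := by
  simp only [← sum_sq_mul_pow_mul_x]
  rw [Finset.sum_comm]
  refine Finset.sum_eq_zero fun l _ => ?_
  rw [← Finset.sum_mul, ← map_sum]
  simp only [pow_add, ← mul_assoc]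
  rw [← Finset.sum_mul, sum_esymm_mul_pow, zero_mul, map_zero, zero_mul]

/-- The odd power sums of degree at least `2 n + 1` reduce to lower ones because every variable is a
root of the characteristic polynomial of all of them. -/
theorem powerSum_odd_mem_range (hn : 1 ≤ n) (m : ℕ) :
    powerSum k n (2 * m + 1) ∈ (toSkewPoly k n).range := by
  induction m using Nat.strong_induction_on with
  | _ m ih =>
  rcases lt_trichotomy (m + 1) n with h | h | h
  · rw [← gen_of_lt h]
    exact gen_mem_range ⟨m, by omega⟩
  · have h1 := sum_sq_esymm_mul_powerSum_mem_range (k := k) hn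
    rw [← h, Finset.sum_range_succ', h] at h1
    rw [pow_zero, esymm_zero, one_mul, map_one, one_mul, show n - 1 - 0 = m by omega] at h1
    refine (add_mem_cancel_left (sum_mem fun i hi => mul_mem
      (sq_mem_range (signed_esymm_isSymmetric _)) (ih _ ?_))).1 h1
    have := Finset.mem_range.1 hi
    omega
  · obtain ⟨j, rfl⟩ : ∃ j, m = n + j := ⟨m - n, by omega⟩
    have h1 := sum_sq_esymm_mul_powerSum_add (k := k) (n := n) j
    rw [Finset.sum_range_succ', pow_zero, esymm_zero, one_mul, map_one, one_mul, Nat.sub_zero] at h1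
    rw [eq_neg_of_add_eq_zero_right h1]
    refine neg_mem (sum_mem fun i hi => mul_mem (sq_mem_range (signed_esymm_isSymmetric _))
      (ih _ ?_))
    have := Finset.mem_range.1 hi
    omega

theorem powerSum_mem_range (hn : 1 ≤ n) (m : ℕ) :
    powerSum k n m ∈ (toSkewPoly k n).range := by
  rcases Nat.even_or_odd' m with ⟨c, rfl | rfl⟩
  · rw [powerSum_even]
    exact sq_mem_range (psum_isSymmetric _ _ _)
  · exact powerSum_odd_mem_range hn c

theorem mem_of_nsmul_mem [CharZero k] {N : Submodule k (SkewPoly k n)} {m : ℕ} (hm : m ≠ 0)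
    {a : SkewPoly k n} (h : m • a ∈ N) : a ∈ N := by
  have h1 := N.smul_mem (m : k)⁻¹ h
  rwa [← Nat.cast_smul_eq_nsmul k, smul_smul, inv_mul_cancel₀ (Nat.cast_ne_zero.2 hm),
    one_smul] at h1

/-- Symmetrized elements are expressed through the power sums: in the product of a power sum with the
symmetrization of an element in the variables of `S`, the terms with a new variable are all equal,
and the other ones involve only the variables of `S`. -/
theorem symmetrize_mem_range [CharZero k] (hn : 1 ≤ n) {S : Finset (Fin n)} {a : SkewPoly k n}
    (ha : a ∈ varAlg k S) : symmetrize k n a ∈ (toSkewPoly k n).range := by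
  induction S using Finset.induction_on generalizing a with
  | empty =>
    rw [varAlg, Finset.coe_empty, Set.image_empty, Algebra.adjoin_empty, Algebra.mem_bot] at ha
    obtain ⟨c, rfl⟩ := ha
    rw [symmetrize_apply]
    exact sum_mem fun σ _ => by rw [AlgHom.commutes]; exact Subalgebra.algebraMap_mem _ c
  | insert l S hl ih =>
    have h1 : a ∈ ((toSkewPoly k n).range.toSubmodule).comap (symmetrize k n) := by
      refine Submodule.span_le.2 ?_ (mem_span_of_mem_varAlg_insert hl ha)
      rintro _ ⟨b, e, he, rfl⟩
      have h2 : powerSum k n b * symmetrize k n e =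
          ∑ l', symmetrize k n (x k n l' ^ b * e) := by
        rw [← symmetrize_mul fun σ => perm_powerSum σ b, powerSum, Finset.sum_mul, map_sum]
      have h3 : ∀ l' ∈ Finset.univ \ S, symmetrize k n (x k n l' ^ b * e) =
          symmetrize k n (x k n l ^ b * e) := fun l' hl' => by
        rw [← symmetrize_perm (Equiv.swap l l') (x k n l ^ b * e), map_mul (perm k _),
          map_pow (perm k _), perm_x, Equiv.swap_apply_left, swap_eq_self_of_mem_varAlg hl (Finset.mem_sdiff.1 hl').2 he]
      rw [← Finset.sum_sdiff (Finset.subset_univ S), Finset.sum_congr rfl h3, Finset.sum_const] at h2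
      have h4 := mul_mem (powerSum_mem_range hn b) (ih he)
      rw [h2] at h4
      change symmetrize k n (x k n l ^ b * e) ∈ (toSkewPoly k n).range
      refine mem_of_nsmul_mem (N := (toSkewPoly k n).range.toSubmodule) (m := (Finset.univ \ S).card) ?_ ((add_mem_cancel_right ?_).1 h4)
      · exact (Finset.card_pos.2 ⟨l, by simpa using hl⟩).ne'
      · refine sum_mem fun l' hl' => ih (mul_mem (pow_mem (x_mem_varAlg hl') b) he)
    exact h1

/-- The analogue of `symmetrize_mem_range` for antisymmetrized multiples of the cofactors, with the sum
`v` of the cofactors in place of a power sum. -/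
theorem antisymmetrize_cofactor_mul_mem_range [CharZero k] (hn : 1 ≤ n) {S : Finset (Fin n)}
    {a : SkewPoly k n} (ha : a ∈ varAlg k S) {l : Fin n} (hl : l ∉ S) :
    antisymmetrize k n (cofactor k l * a) ∈ (toSkewPoly k n).range := by
  induction S using Finset.strongInduction generalizing a l with
  | H S ih =>
  have h2 : cofactorSum k n * symmetrize k n a =
      ∑ l', antisymmetrize k n (cofactor k l' * a) := by
    rw [← antisymmetrize_mul perm_cofactorSum, cofactorSum, Finset.sum_mul, map_sum]
  have h3 : ∀ l' ∈ Finset.univ \ S, antisymmetrize k n (cofactor k l' * a) =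
      antisymmetrize k n (cofactor k l * a) := fun l' hl' => by
    have h := antisymmetrize_perm (Equiv.swap l l') (cofactor k l * a)
    rw [map_mul, perm_cofactor, Equiv.swap_apply_left,
      swap_eq_self_of_mem_varAlg hl (Finset.mem_sdiff.1 hl').2 ha, smul_mul_assoc, map_zsmul] at h
    rw [← one_smul ℤ (antisymmetrize k n (cofactor k l' * a)),
      ← one_smul ℤ (antisymmetrize k n (cofactor k l * a)), ← Units.val_one,
      ← Int.units_mul_self (Equiv.Perm.sign (Equiv.swap l l')), Units.val_mul, mul_smul, mul_smul, h]
  rw [← Finset.sum_sdiff (Finset.subset_univ S), Finset.sum_congr rfl h3, Finset.sum_const] at h2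
  have h4 := mul_mem cofactorSum_mem_range (symmetrize_mem_range hn ha)
  rw [h2] at h4
  refine mem_of_nsmul_mem (N := (toSkewPoly k n).range.toSubmodule)
    (m := (Finset.univ \ S).card) ?_ ((add_mem_cancel_right ?_).1 h4)
  · exact (Finset.card_pos.2 ⟨l, by simpa using hl⟩).ne'
  refine sum_mem fun l' hl' => ?_
  have h5 : a ∈ ((toSkewPoly k n).range.toSubmodule).comap
      (antisymmetrize k n ∘ₗ LinearMap.mulLeft k (cofactor k l')) := by
    rw [← Finset.insert_erase hl'] at ha
    refine Submodule.span_le.2 ?_ (mem_span_of_mem_varAlg_insert (Finset.notMem_erase l' S) ha)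
    rintro _ ⟨b, e, he, rfl⟩
    change antisymmetrize k n (cofactor k l' * (x k n l' ^ b * e)) ∈ (toSkewPoly k n).range
    cases b with
    | zero =>
      rw [pow_zero, one_mul]
      exact ih _ (Finset.erase_ssubset hl') he (Finset.notMem_erase l' S)
    | succ b =>
      rw [pow_succ', mul_assoc (x k n l'), ← mul_assoc, cofactor_mul_x,
        antisymmetrize_mul perm_fullProd]
      exact mul_mem (fullProd_mem_range hn) (symmetrize_mem_range hn (mem_varAlg_univ _))
  exact h5

/-- A monomial from which two variables are absent is fixed by a transposition, so that its
antisymmetrization vanishes; the other monomials are multiples of a cofactor or of the product of all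
variables. -/
theorem antisymmetrize_mem_range [CharZero k] (hn : 1 ≤ n) (a : SkewPoly k n) :
    antisymmetrize k n a ∈ (toSkewPoly k n).range := by
  have h1 : a ∈ ((toSkewPoly k n).range.toSubmodule).comap (antisymmetrize k n) := by
    have h0 : a ∈ (⊤ : Submodule k (SkewPoly k n)) := trivial
    rw [← span_orderedMonomial] at h0
    refine Submodule.span_le.2 ?_ h0
    rintro _ ⟨d, rfl⟩
    change antisymmetrize k n (orderedMonomial k d) ∈ (toSkewPoly k n).range
    by_cases hd : ∀ i, d i ≠ 0
    · obtain ⟨m, hm⟩ := exists_orderedMonomial_eq_fullProd_mul (k := k) hd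
      rw [hm, map_zsmul, antisymmetrize_mul perm_fullProd]
      exact zsmul_mem (mul_mem (fullProd_mem_range hn)
        (symmetrize_mem_range hn (mem_varAlg_univ _))) _
    push Not at hd
    obtain ⟨l, hl⟩ := hd
    by_cases hd : ∀ i, i ≠ l → d i ≠ 0
    · obtain ⟨m, hm⟩ := exists_orderedMonomial_eq_cofactor_mul (k := k) hl hd
      rw [hm, map_zsmul]
      refine zsmul_mem (antisymmetrize_cofactor_mul_mem_range hn (S := Finset.univ.erase l)
        (orderedMonomial_mem_varAlg fun i hi => ?_) (Finset.notMem_erase l _)) _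
      obtain rfl : i = l := by simpa using hi
      rw [hl]
    · push Not at hd
      obtain ⟨l', hne, hl'⟩ := hd
      have h2 : antisymmetrize k n (orderedMonomial k d) = 0 := by
        have h := antisymmetrize_perm (Equiv.swap l l') (orderedMonomial k d)
        rw [swap_eq_self_of_mem_varAlg (S := {i | d i ≠ 0}) (by simpa using hl) (by simpa using hl')
          (orderedMonomial_mem_varAlg fun i hi => by simpa using hi),
          Equiv.Perm.sign_swap hne.symm] at h
        rw [Units.val_neg, Units.val_one, neg_one_smul] at h
        have h' : (2 : ℕ) • antisymmetrize k n (orderedMonomial k d) ∈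
            (⊥ : Submodule k (SkewPoly k n)) := by
          rw [Submodule.mem_bot, two_nsmul]
          nth_rw 1 [h]
          exact neg_add_cancel _
        exact mem_of_nsmul_mem two_ne_zero h'
      rw [h2]
      exact zero_mem _
  exact h1

theorem mem_range_of_mem_invariants [CharZero k] (hn : 1 ≤ n) {a : SkewPoly k n}
    (ha : a ∈ invariants k (alternatingGroup (Fin n))) : a ∈ (toSkewPoly k n).range := by
  have h1 : symmetrize k n a + antisymmetrize k n a =
      (∑ σ : Equiv.Perm (Fin n), if Equiv.Perm.sign σ = 1 then 2 else 0) • a := by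
    rw [symmetrize_apply, antisymmetrize_apply, ← Finset.sum_add_distrib, Finset.sum_smul]
    refine Finset.sum_congr rfl fun σ _ => ?_
    rcases Int.units_eq_one_or (Equiv.Perm.sign σ) with h | h
    · rw [if_pos h, h, Units.val_one, one_smul, ha σ (Equiv.Perm.mem_alternatingGroup.2 h),
        two_nsmul]
    · rw [if_neg (by rw [h]; decide), h, Units.val_neg, Units.val_one, neg_one_smul, zero_smul,
        add_neg_cancel]
  refine mem_of_nsmul_mem (N := (toSkewPoly k n).range.toSubmodule)
    (m := ∑ σ : Equiv.Perm (Fin n), if Equiv.Perm.sign σ = 1 then 2 else 0) ?_ ?_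
  · exact (Finset.sum_pos' (fun _ _ => Nat.zero_le _)
      ⟨1, Finset.mem_univ _, by simp⟩).ne'
  · rw [← h1]
    exact add_mem (symmetrize_mem_range hn (mem_varAlg_univ a)) (antisymmetrize_mem_range hn a)

end SkewPoly

namespace SkewPoly

open MvPolynomial

variable {k : Type u} [Field k] {n : ℕ}

/-! ### The kernel of the map to the skew polynomial ring -/

theorem esymm_card : esymm (Fin n) k n = ∏ i, X i := by
  have h := Finset.powersetCard_self (Finset.univ : Finset (Fin n))
  rw [Finset.card_univ, Fintype.card_fin] at h
  rw [esymm, h, Finset.sum_singleton]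

theorem esymm_card_pred (hn : 1 ≤ n) :
    esymm (Fin n) k (n - 1) = ∑ i, ∏ j ∈ Finset.univ.erase i, X j := by
  rw [esymm]
  symm
  refine Finset.sum_bij (fun i _ => Finset.univ.erase i) (fun i _ => ?_) (fun i _ j _ h => ?_)
    (fun s hs => ?_) fun _ _ => rfl
  · simp [Finset.mem_powersetCard]
  · by_contra hne
    have : i ∈ Finset.univ.erase j := Finset.mem_erase.2 ⟨hne, Finset.mem_univ i⟩
    rw [← h] at this
    exact Finset.notMem_erase i _ this
  · have h1 := (Finset.mem_powersetCard.1 hs).2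
    have h2 : sᶜ.card = 1 := by rw [Finset.card_compl, h1, Fintype.card_fin]; omega
    obtain ⟨i, hi⟩ := Finset.card_eq_one.1 h2
    refine ⟨i, Finset.mem_univ i, ?_⟩
    rw [← compl_compl s, hi, ← Finset.sdiff_singleton_eq_erase, Finset.compl_eq_univ_sdiff]

theorem gen_sq (hn : 2 ≤ n) (i : Fin (n + 1)) :
    gen k n i ^ 2 = sq k n (esymmMap k n (OreAlg.squareValue k n i)) := by
  rw [pow_two]
  by_cases h : (i : ℕ) + 1 < n
  · rw [gen_of_lt h, powerSum_odd_sq, OreAlg.squareValue_of_lt h, esymmMap_powerSumPoly]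
  rcases OreAlg.eq_pred_or_last h with h | rfl
  · rw [h, gen_pred (by omega), fullProd_mul_self, OreAlg.squareValue_pred (by omega), map_mul,
      esymmMap_X, map_pow, map_neg, map_one, ← esymm_card]
    rw [Nat.sub_add_cancel (by omega : 1 ≤ n), map_mul, map_pow, map_neg, map_one, zsmul_eq_mul]
    push_cast
    rfl
  · rw [Fin.val_last, gen_self, cofactorSum_mul_self, OreAlg.squareValue_last hn, map_mul,
      esymmMap_X, map_pow, map_neg, map_one, ← esymm_card_pred (by omega)]
    rw [show n - 2 + 1 = n - 1 by omega, map_mul, map_pow, map_neg, map_one, zsmul_eq_mul]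
    push_cast
    rfl

theorem toSkewPoly_r (hn : 2 ≤ n) (i : Fin (n + 1)) : toSkewPoly k n (OreAlg.r k n i) = 0 := by
  rw [OreAlg.r, map_sub, map_pow, toSkewPoly_y, toSkewPoly_coeff, gen_sq hn, sub_self]

theorem toSkewPoly_eq_zero_of_mem_span (hn : 2 ≤ n) {c : OreAlg k n}
    (hc : c ∈ TwoSidedIdeal.span (Set.range (OreAlg.r k n))) : toSkewPoly k n c = 0 := by
  refine (TwoSidedIdeal.mem_ker (toSkewPoly k n)).1 (TwoSidedIdeal.span_le.2 ?_ hc)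
  rintro _ ⟨i, rfl⟩
  exact (TwoSidedIdeal.mem_ker (toSkewPoly k n)).2 (toSkewPoly_r hn i)

variable (k n) in
/-- The Vandermonde matrix `(X_l ^ i)`, with rows indexed by the exponents. -/
def powerMatrix : Matrix (Fin n) (Fin n) (MvPolynomial (Fin n) k) :=
  (Matrix.vandermonde X).transpose

theorem det_powerMatrix_ne_zero : (powerMatrix k n).det ≠ 0 := by
  rw [powerMatrix, Matrix.det_transpose]
  exact Matrix.det_vandermonde_ne_zero_iff.2 (X_injective (R := k))

theorem sum_pow_mul_adjugate (i j : Fin n) :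
    ∑ l, X l ^ (i : ℕ) * (powerMatrix k n).adjugate l j =
      if i = j then (powerMatrix k n).det else 0 := by
  have h := congrFun (congrFun (Matrix.mul_adjugate (powerMatrix k n)) i) j
  rw [Matrix.mul_apply, Matrix.smul_apply, Matrix.one_apply] at h
  rw [smul_eq_mul, mul_ite, mul_one, mul_zero] at h
  exact h

theorem sum_sq_mul_x_mul_powerSum (c : Fin n → MvPolynomial (Fin n) k) (i : ℕ) :
    (∑ l, sq k n (c l) * x k n l) * powerSum k n (2 * i + 1) =
      -(powerSum k n (2 * i + 1) * ∑ l, sq k n (c l) * x k n l) +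
        sq k n (2 * ∑ l, X l ^ (i + 1) * c l) := by
  have h : ∀ l, x k n l * powerSum k n (2 * i + 1) =
      -(powerSum k n (2 * i + 1) * x k n l) + sq k n (2 * X l ^ (i + 1)) := by
    intro l
    have h1 : ∀ m, x k n l * x k n m ^ (2 * i + 1) = -(x k n m ^ (2 * i + 1) * x k n l) +
        if l = m then sq k n (2 * X l ^ (i + 1)) else 0 := by
      intro m
      rcases eq_or_ne l m with rfl | hne
      · rw [if_pos rfl, map_mul, map_ofNat, map_pow, sq_X, ← pow_succ, ← pow_succ', ← pow_mul,
          show 2 * (i + 1) = 2 * i + 1 + 1 by ring, two_mul (x k n l ^ _)]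
        abel
      · have := pow_mul_pow_anticomm (k := k) hne 0 i
        rw [if_neg hne, add_zero]
        simpa using this
    rw [powerSum, Finset.mul_sum, Finset.sum_mul, Finset.sum_congr rfl fun m _ => h1 m,
      Finset.sum_add_distrib, Finset.sum_neg_distrib, Finset.sum_ite_eq]
    simp
  rw [Finset.sum_mul, Finset.mul_sum Finset.univ _ (powerSum k n (2 * i + 1)),
    ← Finset.sum_neg_distrib, Finset.mul_sum, map_sum, ← Finset.sum_add_distrib]
  refine Finset.sum_congr rfl fun l _ => ?_
  rw [mul_assoc, h, mul_add, mul_neg, ← map_mul, ← mul_assoc, sq_mul_comm, mul_assoc,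
    sq_mul_comm _ (x k n l), mul_left_comm, mul_comm (c l)]

theorem cofactorSum_mul_sum_sq_mul_x (c : Fin n → MvPolynomial (Fin n) k) :
    cofactorSum k n * (∑ l, sq k n (c l) * x k n l) =
      (-1 : ℤ) ^ n • ((∑ l, sq k n (c l) * x k n l) * cofactorSum k n) +
        sq k n (2 * ∑ l, c l) * fullProd k n := by
  have h : ∀ l, cofactorSum k n * x k n l = (-1 : ℤ) ^ n • (x k n l * cofactorSum k n) +
      2 * fullProd k n := by
    intro l
    have h1 : ∀ i, cofactor k i * x k n l = (-1 : ℤ) ^ n • (x k n l * cofactor k i) +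
        if i = l then 2 * fullProd k n else 0 := fun i => by
      simpa using cofactor_mul_odd_pow (k := k) i l 0
    rw [cofactorSum, Finset.sum_mul, Finset.mul_sum, Finset.smul_sum,
      Finset.sum_congr rfl fun i _ => h1 i, Finset.sum_add_distrib, Finset.sum_ite_eq']
    simp
  rw [Finset.mul_sum, Finset.sum_mul, Finset.smul_sum, Finset.mul_sum, map_sum, Finset.sum_mul,
    ← Finset.sum_add_distrib]
  refine Finset.sum_congr rfl fun l _ => ?_
  rw [← mul_assoc, ← sq_mul_comm, mul_assoc, h, mul_add, mul_smul_comm, mul_assoc, ← mul_assoc,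
    ← map_ofNat (sq k n) 2, ← mul_assoc, ← map_mul (sq k n), mul_comm (c l)]

variable (k) in
/-- A combination of the variables, with coefficients polynomials in their squares, that is dual to
the `j`-th power sum: up to sign it commutes with the other generators, and its anticommutator with
the `j`-th one is a nonzero polynomial in the squares. -/
def dualElement (j : Fin n) : SkewPoly k n :=
  ∑ l, sq k n ((powerMatrix k n).adjugate l j) * x k n l

theorem dualElement_mul_powerSum_add (j : Fin n) (i : ℕ) :
    dualElement k j * powerSum k n (2 * i + 1) =
      -(powerSum k n (2 * i + 1) * dualElement k j) +
        sq k n (2 * ∑ l, X l ^ (i + 1) * (powerMatrix k n).adjugate l j) :=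
  sum_sq_mul_x_mul_powerSum (fun l => (powerMatrix k n).adjugate l j) i

theorem dualElement_mul_powerSum_of_ne {j : Fin n} {i : ℕ} (hi : i + 1 < n) (hij : (j : ℕ) ≠ i + 1) :
    dualElement k j * powerSum k n (2 * i + 1) =
      -(powerSum k n (2 * i + 1) * dualElement k j) := by
  have h := sum_pow_mul_adjugate (k := k) ⟨i + 1, hi⟩ j
  rw [if_neg fun h => hij (by rw [← h])] at h
  rw [dualElement_mul_powerSum_add, h, mul_zero, map_zero, add_zero]

theorem dualElement_mul_powerSum_self {i : ℕ} (hi : i + 1 < n) :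
    dualElement k ⟨i + 1, hi⟩ * powerSum k n (2 * i + 1) =
      -(powerSum k n (2 * i + 1) * dualElement k ⟨i + 1, hi⟩) +
        sq k n (2 * (powerMatrix k n).det) := by
  have h := sum_pow_mul_adjugate (k := k) ⟨i + 1, hi⟩ ⟨i + 1, hi⟩
  rw [if_pos rfl] at h
  rw [dualElement_mul_powerSum_add, h]

theorem fullProd_mul_dualElement (j : Fin n) :
    fullProd k n * dualElement k j = (-1 : ℤ) ^ (n - 1) • (dualElement k j * fullProd k n) := by
  rw [dualElement, Finset.sum_mul, Finset.mul_sum, Finset.smul_sum]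
  refine Finset.sum_congr rfl fun l _ => ?_
  rw [← mul_assoc, ← sq_mul_comm, mul_assoc, fullProd_mul_x, mul_smul_comm, mul_assoc]

theorem cofactorSum_mul_dualElement (hn : 1 ≤ n) :
    cofactorSum k n * dualElement k (⟨0, hn⟩ : Fin n) =
      (-1 : ℤ) ^ n • (dualElement k ⟨0, hn⟩ * cofactorSum k n) +
        sq k n (2 * (powerMatrix k n).det) * fullProd k n := by
  have hd := sum_pow_mul_adjugate (k := k) (⟨0, hn⟩ : Fin n) ⟨0, hn⟩
  rw [if_pos rfl] at hd
  simp only [pow_zero, one_mul] at hd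
  rw [← hd]
  exact cofactorSum_mul_sum_sq_mul_x fun l => (powerMatrix k n).adjugate l ⟨0, hn⟩

end SkewPoly

namespace SkewPoly

open MvPolynomial

variable {k : Type u} [Field k] {n : ℕ}

theorem scale_scale (a : SkewPoly k n) : scale (-1) (scale (-1) a) = a := by
  have : (scale (-1)).comp (scale (-1)) = AlgHom.id k (SkewPoly k n) :=
    algHom_ext fun i => by simp [scale_x]
  exact DFunLike.congr_fun this a

theorem scale_neg_one_sq (f : MvPolynomial (Fin n) k) : scale (-1) (sq k n f) = sq k n f := by
  have : (scale (-1)).comp (sq k n) = sq k n := by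
    ext i
    rw [AlgHom.comp_apply, sq_X, map_pow, scale_x, neg_one_smul, neg_sq]
  exact DFunLike.congr_fun this f

/-- If `z` commutes with `a₀` and `a₁` up to the automorphism changing the signs of the variables
and anticommutes with `p` up to a nonzero polynomial in the squares, then `a₀ + a₁ p` vanishes only
for `a₀ = a₁ = 0`. -/
theorem eq_zero_of_add_mul_eq_zero {a₀ a₁ p z : SkewPoly k n} {d : MvPolynomial (Fin n) k}
    (hd : d ≠ 0) (h₀ : z * a₀ = scale (-1) a₀ * z) (h₁ : z * a₁ = scale (-1) a₁ * z)
    (hp : scale (-1) p = -p) (hzp : z * p = -(p * z) + sq k n d) (h : a₀ + a₁ * p = 0) :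
    a₀ = 0 ∧ a₁ = 0 := by
  have h2 : scale (-1) a₀ - scale (-1) a₁ * p = 0 := by
    have := congrArg (scale (-1)) h
    rwa [map_add, map_mul, hp, mul_neg, map_zero, ← sub_eq_add_neg] at this
  have h3 : scale (-1) a₁ * sq k n d = 0 := by
    have h4 : z * (a₀ + a₁ * p) = 0 := by rw [h, mul_zero]
    rw [mul_add, ← mul_assoc, h₀, h₁, mul_assoc, hzp] at h4
    calc scale (-1) a₁ * sq k n d =
        (scale (-1) a₀ * z + scale (-1) a₁ * (-(p * z) + sq k n d)) -
          (scale (-1) a₀ - scale (-1) a₁ * p) * z := by noncomm_ring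
      _ = 0 := by rw [h4, h2, zero_mul, sub_zero]
  have h5 : a₁ = 0 := by
    rw [← scale_scale a₁, eq_zero_of_mul_sq hd h3, map_zero]
  rw [h5, zero_mul, add_zero] at h
  exact ⟨h, h5⟩

theorem scale_powerSum_odd (m : ℕ) :
    scale (-1) (powerSum k n (2 * m + 1)) = -powerSum k n (2 * m + 1) := by
  rw [scale_of_mem _ (powerSum_mem_grading _), neg_one_pow_odd, neg_one_smul]

theorem toSkewPoly_mem_adjoin_of_mem_tower {j : ℕ} {s : OreAlg k n} (hs : s ∈ OreAlg.tower k n j) :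
    toSkewPoly k n s ∈ Algebra.adjoin k
      (Set.range (fun f => sq k n (esymmMap k n f)) ∪ (gen k n '' {i | i < j})) := by
  have h : (OreAlg.tower k n j).map (toSkewPoly k n) ≤ Algebra.adjoin k
      (Set.range (fun f => sq k n (esymmMap k n f)) ∪ (gen k n '' {i | i < j})) := by
    rw [OreAlg.tower, AlgHom.map_adjoin]
    refine Algebra.adjoin_mono ?_
    rintro _ ⟨_, ⟨f, rfl⟩ | ⟨i, hi, rfl⟩, rfl⟩
    · exact Or.inl ⟨f, (toSkewPoly_coeff f).symm⟩
    · exact Or.inr ⟨i, hi, (toSkewPoly_y i).symm⟩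
  exact h ⟨s, hs, rfl⟩

theorem dualElement_mul_toSkewPoly {j : Fin n} {m : ℕ} (hm : m + 1 ≤ n)
    (hj : ∀ i < m, (j : ℕ) ≠ i + 1) {s : OreAlg k n} (hs : s ∈ OreAlg.tower k n m) :
    dualElement k j * toSkewPoly k n s =
      scale (-1) (toSkewPoly k n s) * dualElement k j := by
  have h := toSkewPoly_mem_adjoin_of_mem_tower hs
  generalize toSkewPoly k n s = t at h
  induction h using Algebra.adjoin_induction with
  | mem _ h =>
    obtain ⟨f, rfl⟩ | ⟨i, hi, rfl⟩ := h
    · rw [scale_neg_one_sq, sq_mul_comm]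
    · have hi' : i + 1 < n := by have : i < m := hi; omega
      rw [gen_of_lt hi', scale_powerSum_odd, neg_mul,
        dualElement_mul_powerSum_of_ne hi' (hj i hi)]
  | algebraMap c => rw [AlgHom.commutes, Algebra.commutes]
  | add a b _ _ ha hb => rw [mul_add, map_add, add_mul, ha, hb]
  | mul a b _ _ ha hb => rw [map_mul, ← mul_assoc, ha, mul_assoc, hb, mul_assoc]

theorem perm_toSkewPoly_of_mem_tower (σ : Equiv.Perm (Fin n)) {m : ℕ} (hm : m + 1 ≤ n)
    {s : OreAlg k n} (hs : s ∈ OreAlg.tower k n m) :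
    perm k σ (toSkewPoly k n s) = toSkewPoly k n s := by
  have h := toSkewPoly_mem_adjoin_of_mem_tower hs
  generalize toSkewPoly k n s = t at h
  induction h using Algebra.adjoin_induction with
  | mem _ h =>
    obtain ⟨f, rfl⟩ | ⟨i, hi, rfl⟩ := h
    · rw [perm_sq]
      exact congrArg _ ((esymmAlgEquiv (Fin n) k (Fintype.card_fin n) f).2 σ)
    · have hi' : i + 1 < n := by have : i < m := hi; omega
      rw [gen_of_lt hi', perm_powerSum]
  | algebraMap c => rw [AlgHom.commutes]
  | add a b _ _ ha hb => rw [map_add, ha, hb]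
  | mul a b _ _ ha hb => rw [map_mul, ha, hb]

end SkewPoly

namespace OreAlg

open MvPolynomial SkewPoly

variable {k : Type u} [Field k] {n : ℕ}

variable (k n) in
/-- The ideal generated by the elements `r i`. -/
abbrev relIdeal : TwoSidedIdeal (OreAlg k n) := TwoSidedIdeal.span (Set.range (r k n))

variable (k n) in
/-- The quotient map modulo the elements `r i`. -/
abbrev relMk : OreAlg k n →+* (relIdeal k n).ringCon.Quotient := (relIdeal k n).ringCon.mk'

theorem relMk_eq_zero {a : OreAlg k n} : relMk k n a = 0 ↔ a ∈ relIdeal k n := by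
  rw [← TwoSidedIdeal.mem_ker, TwoSidedIdeal.ker_ringCon_mk']

theorem relMk_y_sq (i : Fin (n + 1)) :
    relMk k n (y k n i) ^ 2 = relMk k n (coeff k n (squareValue k n i)) := by
  rw [← map_pow, ← sub_eq_zero, ← map_sub, relMk_eq_zero]
  exact TwoSidedIdeal.subset_span ⟨i, rfl⟩

/-- Modulo the elements `r i`, every stage of the tower is spanned by `1` and the last generator over
the stage before. -/
theorem exists_relMk_eq (j : Fin (n + 1)) {s : OreAlg k n} (hs : s ∈ tower k n (j + 1)) :
    ∃ s₀ ∈ tower k n j, ∃ s₁ ∈ tower k n j,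
      relMk k n s = relMk k n (s₀ + s₁ * y k n j) := by
  have hpow : ∀ i : ℕ, ∃ s₀ ∈ tower k n j, ∃ s₁ ∈ tower k n j,
      relMk k n (y k n j ^ i) = relMk k n (s₀ + s₁ * y k n j) := by
    intro i
    induction i with
    | zero => exact ⟨1, one_mem _, 0, zero_mem _, by simp⟩
    | succ i ih =>
      obtain ⟨s₀, h₀, s₁, h₁, h⟩ := ih
      refine ⟨s₁ * coeff k n (squareValue k n j), mul_mem h₁ (coeff_mem_tower _ _), s₀, h₀, ?_⟩
      rw [pow_succ, map_mul, h, ← map_mul, add_mul, mul_assoc, ← pow_two, map_add, map_add,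
        map_mul _ s₁, map_pow, relMk_y_sq, ← map_mul, add_comm]
  obtain ⟨c, rfl⟩ := exists_tower_evalPowers j hs
  clear hs
  induction c using Finsupp.induction_linear with
  | zero => exact ⟨0, zero_mem _, 0, zero_mem _, by simp⟩
  | add f g hf hg =>
    obtain ⟨s₀, h₀, s₁, h₁, h⟩ := hf
    obtain ⟨t₀, h₀', t₁, h₁', h'⟩ := hg
    refine ⟨s₀ + t₀, add_mem h₀ h₀', s₁ + t₁, add_mem h₁ h₁', ?_⟩
    rw [map_add, map_add, h, h', ← map_add]
    congr 1
    noncomm_ring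
  | single i c =>
    obtain ⟨s₀, h₀, s₁, h₁, h⟩ := hpow i
    refine ⟨c * s₀, mul_mem c.2 h₀, c * s₁, mul_mem c.2 h₁, ?_⟩
    rw [IsOreExtension.evalPowers_single, map_mul, h, ← map_mul, mul_add, mul_assoc]

theorem toSkewPoly_eq_of_relMk_eq (hn : 2 ≤ n) {a b : OreAlg k n} (h : relMk k n a = relMk k n b) :
    toSkewPoly k n a = toSkewPoly k n b := by
  rw [← sub_eq_zero, ← map_sub]
  apply toSkewPoly_eq_zero_of_mem_span hn
  rw [← relMk_eq_zero, map_sub, h, sub_self]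

theorem two_mul_det_ne_zero [CharZero k] : 2 * (powerMatrix k n).det ≠ 0 :=
  mul_ne_zero two_ne_zero det_powerMatrix_ne_zero

/-- The homomorphism to the skew polynomial ring is injective modulo the elements `r i` on the stages
of the tower before `u`, since the dual elements separate the power sums. -/
theorem relMk_eq_zero_of_mem_tower [CharZero k] (hn : 2 ≤ n) (m : ℕ) (hm : m + 1 ≤ n)
    {s : OreAlg k n} (hs : s ∈ tower k n m) (h : toSkewPoly k n s = 0) : relMk k n s = 0 := by
  induction m generalizing s with
  | zero =>
    obtain ⟨f, rfl⟩ : s ∈ Set.range (coeff k n) := by rw [← tower_zero]; exact hs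
    rw [toSkewPoly_coeff] at h
    have hf : esymmMap k n f = 0 := by
      by_contra hf
      exact one_ne_zero (eq_zero_of_sq_mul hf (a := (1 : SkewPoly k n)) (by rw [h, zero_mul]))
    rw [esymmMap_injective k n (hf.trans (map_zero _).symm), map_zero, map_zero]
  | succ m ih =>
    obtain ⟨s₀, h₀, s₁, h₁, hs01⟩ := exists_relMk_eq ⟨m, by omega⟩ hs
    rw [toSkewPoly_eq_of_relMk_eq hn hs01, map_add, map_mul, toSkewPoly_y,
      gen_of_lt (by omega : m + 1 < n)] at h
    have hj : ∀ i < m, ((⟨m + 1, by omega⟩ : Fin n) : ℕ) ≠ i + 1 := fun i hi => by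
      change m + 1 ≠ i + 1
      omega
    obtain ⟨h2, h3⟩ := eq_zero_of_add_mul_eq_zero two_mul_det_ne_zero
      (dualElement_mul_toSkewPoly (by omega) hj h₀) (dualElement_mul_toSkewPoly (by omega) hj h₁)
      (scale_powerSum_odd m) (dualElement_mul_powerSum_self (by omega)) h
    rw [hs01, map_add, map_mul, ih (by omega) h₀ h2, ih (by omega) h₁ h3, zero_mul, add_zero]

/-- The square of `v` is a nonzero polynomial in the `p_i`. -/
theorem exists_cofactorSum_sq (hn : 2 ≤ n) : ∃ f : MvPolynomial (Fin n) k, f ≠ 0 ∧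
    cofactorSum k n ^ 2 = toSkewPoly k n (coeff k n f) := by
  refine ⟨squareValue k n n, ?_, ?_⟩
  · rw [squareValue_last hn]
    exact mul_ne_zero (pow_ne_zero _ (neg_ne_zero.2 one_ne_zero)) (X_ne_zero _)
  · rw [← gen_self, toSkewPoly_coeff]
    exact gen_sq hn (Fin.last n)

theorem dualElement_mul_fullProd_mul_cofactorSum (hn : 1 ≤ n) :
    ∃ d : MvPolynomial (Fin n) k, (d = 2 * (powerMatrix k n).det * ∏ i, X i ∨
      d = -(2 * (powerMatrix k n).det * ∏ i, X i)) ∧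
    dualElement k ⟨0, hn⟩ * (fullProd k n * cofactorSum k n) =
      -(fullProd k n * cofactorSum k n * dualElement k ⟨0, hn⟩) + sq k n d := by
  have hV := cofactorSum_mul_dualElement (k := k) hn
  have hU := fullProd_mul_dualElement (k := k) (⟨0, hn⟩ : Fin n)
  have hUU := fullProd_mul_self (k := k) (n := n)
  have hs := sq_mul_comm (2 * (powerMatrix k n).det) (fullProd k n)
  have h1 : dualElement k ⟨0, hn⟩ * (fullProd k n * cofactorSum k n) =
      -(fullProd k n * cofactorSum k n * dualElement k ⟨0, hn⟩) +
        sq k n (2 * (powerMatrix k n).det) * (fullProd k n * fullProd k n) := by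
    rw [neg_one_pow_pred hn] at hU
    rw [mul_assoc, hV]
    rcases neg_one_pow_eq n with h | h <;> rw [h] at hU ⊢
    · linear_combination (norm := noncomm_ring) hU * cofactorSum k n - hs * fullProd k n
    · linear_combination (norm := noncomm_ring) -hU * cofactorSum k n - hs * fullProd k n
  rw [hUU] at h1
  rcases neg_one_pow_eq (n * (n - 1) / 2) with h | h
  · exact ⟨_, Or.inl rfl, by rw [h1, h, one_smul, ← map_mul]⟩
  · exact ⟨_, Or.inr rfl, by rw [h1, h, neg_one_smul, mul_neg, ← map_mul, ← map_neg]⟩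

/-- The two halves of an element `a₀ + a₁ u + a₂ v + a₃ u v` of the kernel vanish separately, because
an odd permutation changes the signs of `u` and `v`. -/
theorem eq_zero_of_odd_even [CharZero k] {a₀ a₁ a₂ a₃ U V : SkewPoly k n}
    {σ : Equiv.Perm (Fin n)}
    (h₀ : perm k σ a₀ = a₀) (h₁ : perm k σ a₁ = a₁) (h₂ : perm k σ a₂ = a₂)
    (h₃ : perm k σ a₃ = a₃) (hU : perm k σ U = -U) (hV : perm k σ V = -V)
    (h : a₀ + a₁ * U + (a₂ + a₃ * U) * V = 0) :
    a₀ + a₃ * (U * V) = 0 ∧ a₁ * U + a₂ * V = 0 := by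
  have h' := congrArg (perm k σ) h
  simp only [map_add, map_mul, h₀, h₁, h₂, h₃, hU, hV, map_zero] at h'
  have h2 : ∀ b : SkewPoly k n, b + b = 0 → b = 0 := fun b hb => by
    rw [← two_smul k] at hb
    exact (smul_eq_zero.1 hb).resolve_left two_ne_zero
  constructor
  · apply h2
    linear_combination (norm := noncomm_ring) h + h'
  · apply h2
    linear_combination (norm := noncomm_ring) h - h'

/-- The elements `1` and `u v` are independent over the stage before `u`, by the dual element with index
`0`; multiplying `a₁ u + a₂ v` by `v` reduces this case to the former. -/
theorem relMk_eq_zero_of_toSkewPoly [CharZero k] (hn : 2 ≤ n) {s : OreAlg k n}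
    (h : toSkewPoly k n s = 0) : relMk k n s = 0 := by
  have htop : s ∈ tower k n ((Fin.last n : Fin (n + 1)) + 1) := by
    rw [Fin.val_last, tower_top]; trivial
  obtain ⟨b₀, hb₀, b₁, hb₁, hb⟩ := exists_relMk_eq (Fin.last n) htop
  let J : Fin (n + 1) := ⟨n - 1, by omega⟩
  have hJ : tower k n (Fin.last n : Fin (n + 1)) = tower k n (J + 1) := by
    rw [Fin.val_last]
    change tower k n n = tower k n (n - 1 + 1)
    rw [Nat.sub_add_cancel (by omega)]
  rw [hJ] at hb₀ hb₁
  obtain ⟨a₀, h₀, a₁, h₁, ha⟩ := exists_relMk_eq J hb₀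
  obtain ⟨a₂, h₂, a₃, h₃, ha'⟩ := exists_relMk_eq J hb₁
  have hs : relMk k n s =
      relMk k n (a₀ + a₁ * y k n J + (a₂ + a₃ * y k n J) * y k n (Fin.last n)) := by
    rw [hb, map_add, map_mul, ha, ha', ← map_mul, ← map_add]
  rw [toSkewPoly_eq_of_relMk_eq hn hs] at h
  have hU : toSkewPoly k n (y k n J) = fullProd k n := by
    rw [toSkewPoly_y]; exact gen_pred (by omega)
  have hV : toSkewPoly k n (y k n (Fin.last n)) = cofactorSum k n := by
    rw [toSkewPoly_y, Fin.val_last, gen_self]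
  simp only [map_add, map_mul, hU, hV] at h
  have hm : n - 1 + 1 ≤ n := by omega
  obtain ⟨σ, hσ⟩ : ∃ σ : Equiv.Perm (Fin n), Equiv.Perm.sign σ = -1 :=
    ⟨Equiv.swap ⟨0, by omega⟩ ⟨1, by omega⟩, Equiv.Perm.sign_swap (by simp)⟩
  obtain ⟨h5, h6⟩ := eq_zero_of_odd_even (perm_toSkewPoly_of_mem_tower σ hm h₀)
    (perm_toSkewPoly_of_mem_tower σ hm h₁) (perm_toSkewPoly_of_mem_tower σ hm h₂)
    (perm_toSkewPoly_of_mem_tower σ hm h₃) (by rw [perm_fullProd, hσ]; simp)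
    (by rw [perm_cofactorSum, hσ]; simp) h
  have hj : ∀ i < n - 1, ((⟨0, by omega⟩ : Fin n) : ℕ) ≠ i + 1 := fun i _ => by simp
  obtain ⟨d, hd, hz⟩ := dualElement_mul_fullProd_mul_cofactorSum (k := k) (n := n) (by omega)
  have hd0 : d ≠ 0 := by
    have h8 : 2 * (powerMatrix k n).det * ∏ i, X i ≠ 0 :=
      mul_ne_zero two_mul_det_ne_zero (Finset.prod_ne_zero_iff.2 fun i _ => X_ne_zero i)
    rcases hd with rfl | rfl
    · exact h8
    · exact neg_ne_zero.2 h8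
  have hp : scale (-1) (fullProd k n * cofactorSum k n) =
      -(fullProd k n * cofactorSum k n) := by
    rw [scale_of_mem _ (SetLike.mul_mem_graded fullProd_mem_grading cofactorSum_mem_grading),
      show n + (n - 1) = 2 * (n - 1) + 1 by omega, neg_one_pow_odd, neg_one_smul]
  -- independence of `1` and `u v` over the part of the tower before `u`
  have key : ∀ {c c' : OreAlg k n}, c ∈ tower k n (n - 1) → c' ∈ tower k n (n - 1) →
      toSkewPoly k n c + toSkewPoly k n c' * (fullProd k n * cofactorSum k n) = 0 →
      relMk k n c = 0 ∧ relMk k n c' = 0 := by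
    intro c c' hc hc' hcc
    obtain ⟨h9, h10⟩ := eq_zero_of_add_mul_eq_zero hd0 (dualElement_mul_toSkewPoly hm hj hc)
      (dualElement_mul_toSkewPoly hm hj hc') hp hz hcc
    exact ⟨relMk_eq_zero_of_mem_tower hn _ hm hc h9, relMk_eq_zero_of_mem_tower hn _ hm hc' h10⟩
  obtain ⟨f, hf0, hf⟩ := exists_cofactorSum_sq (k := k) hn
  obtain ⟨r₀, r₃⟩ := key h₀ h₃ h5
  obtain ⟨r₂, r₁⟩ := key (mul_mem h₂ (coeff_mem_tower _ f)) h₁ (by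
    rw [map_mul, ← hf, pow_two]
    calc _ = (toSkewPoly k n a₁ * fullProd k n + toSkewPoly k n a₂ * cofactorSum k n) *
          cofactorSum k n := by noncomm_ring
      _ = 0 := by rw [h6, zero_mul])
  have r₂' : relMk k n a₂ = 0 := by
    refine relMk_eq_zero_of_mem_tower hn _ hm h₂ ?_
    have h11 : toSkewPoly k n (a₂ * coeff k n f) = 0 :=
      toSkewPoly_eq_zero_of_mem_span hn (relMk_eq_zero.1 r₂)
    rw [map_mul, toSkewPoly_coeff] at h11
    refine eq_zero_of_mul_sq (fun h12 => hf0 (esymmMap_injective k n ?_)) h11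
    rw [h12, map_zero]
  rw [hs]
  simp only [map_add, map_mul, r₀, r₁, r₂', r₃]
  simp

theorem toSkewPoly_eq_zero_iff [CharZero k] (hn : 2 ≤ n) (c : OreAlg k n) :
    toSkewPoly k n c = 0 ↔ c ∈ relIdeal k n :=
  ⟨fun h => relMk_eq_zero.1 (relMk_eq_zero_of_toSkewPoly hn h), toSkewPoly_eq_zero_of_mem_span hn⟩

end OreAlg

namespace SkewPoly

open MvPolynomial

variable {k : Type u} [Field k] {n : ℕ}

/-! ### The isomorphism with the fixed subring -/

theorem cofactor_injective [CharZero k] : Function.Injective (cofactor k : Fin n → SkewPoly k n) := by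
  intro i j h
  by_contra hij
  have h1 := cofactor_anticomm (k := k) hij
  rw [← h, cofactor_mul_self, eq_neg_iff_add_eq_zero, ← two_smul k, smul_eq_zero,
    or_iff_right two_ne_zero] at h1
  have h2 : sq k n (∏ j ∈ Finset.univ.erase i, X j) * 1 = 0 := by
    rw [mul_one]
    rcases neg_one_pow_eq ((n - 1) * (n - 2) / 2) with h3 | h3
    · rwa [h3, one_smul] at h1
    · rwa [h3, neg_one_smul, neg_eq_zero] at h1
  exact one_ne_zero (eq_zero_of_sq_mul (Finset.prod_ne_zero_iff.2 fun j _ => X_ne_zero j) h2)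

/-- The signs with which an even permutation acts on the cofactors are trivial and the alternating
group is transitive, so that the orbit of one cofactor consists of all of them. -/
theorem orbitSum_initialProd [CharZero k] (hn : 3 ≤ n) :
    orbitSum k (alternatingGroup (Fin n)) (initialProd k n (n - 1)) = cofactorSum k n := by
  classical
  set l₀ : Fin n := ⟨n - 1, by omega⟩
  have hp : ∀ g : alternatingGroup (Fin n), perm k (g : Equiv.Perm (Fin n)) (cofactor k l₀) =
      cofactor k ((g : Equiv.Perm (Fin n)) l₀) := fun g => by
    rw [perm_cofactor, Equiv.Perm.mem_alternatingGroup.1 g.2, Units.val_one, one_smul]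
  rw [orbitSum, initialProd_pred (by omega)]
  have hcard : ∀ l : Fin n, (Finset.univ.filter fun g : alternatingGroup (Fin n) =>
      (g : Equiv.Perm (Fin n)) l₀ = l).card =
      Nat.card {g : alternatingGroup (Fin n) //
        perm k (g : Equiv.Perm (Fin n)) (cofactor k l₀) = cofactor k l₀} := by
    intro l
    have : MulAction.IsPretransitive (alternatingGroup (Fin n)) (Fin n) :=
      alternatingGroup.isPretransitive_of_three_le_card _ (by rwa [Nat.card_fin])
    obtain ⟨h, hh⟩ := MulAction.exists_smul_eq (alternatingGroup (Fin n)) l l₀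
    have hh' : (h : Equiv.Perm (Fin n)) l = l₀ := hh
    rw [Nat.card_eq_fintype_card, Fintype.card_subtype]
    refine Finset.card_bij (fun g _ => h * g) (fun g hg => ?_) (fun g _ g' _ he => ?_)
      fun g hg => ⟨h⁻¹ * g, ?_, ?_⟩
    · rw [Finset.mem_filter_univ] at hg ⊢
      rw [hp, Subgroup.coe_mul, Equiv.Perm.mul_apply, hg, hh']
    · exact mul_left_cancel he
    · rw [Finset.mem_filter_univ] at hg ⊢
      rw [hp] at hg
      rw [Subgroup.coe_mul, Equiv.Perm.mul_apply, cofactor_injective hg, Subgroup.coe_inv,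
        Equiv.Perm.inv_eq_iff_eq, hh']
    · rw [mul_inv_cancel_left]
  have hpos : Nat.card {g : alternatingGroup (Fin n) //
      perm k (g : Equiv.Perm (Fin n)) (cofactor k l₀) = cofactor k l₀} ≠ 0 := by
    rw [← hcard l₀]
    exact (Finset.card_pos.2 ⟨1, by simp⟩).ne'
  rw [Finset.sum_congr rfl fun g _ => hp g, ← Finset.sum_fiberwise (s := Finset.univ)
    (g := fun g : alternatingGroup (Fin n) => (g : Equiv.Perm (Fin n)) l₀)]
  have hsum : ∀ l : Fin n, ∑ g ∈ Finset.univ.filter (fun g : alternatingGroup (Fin n) =>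
      (g : Equiv.Perm (Fin n)) l₀ = l), cofactor k ((g : Equiv.Perm (Fin n)) l₀) =
      Nat.card {g : alternatingGroup (Fin n) //
        perm k (g : Equiv.Perm (Fin n)) (cofactor k l₀) = cofactor k l₀} • cofactor k l := by
    intro l
    rw [← hcard l, ← Finset.sum_const]
    exact Finset.sum_congr rfl fun g hg => congrArg _ (Finset.mem_filter.1 hg).2
  rw [Finset.sum_congr rfl fun l _ => hsum l, ← Finset.smul_sum, ← Nat.cast_smul_eq_nsmul k,
    smul_smul, inv_mul_cancel₀ (Nat.cast_ne_zero.2 hpos), one_smul]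
  rfl

theorem toSkewPoly_mem_invariants (c : OreAlg k n) :
    toSkewPoly k n c ∈ invariants k (alternatingGroup (Fin n)) := by
  intro σ hσ
  induction c using OreAlg.induction with
  | hc f =>
    rw [toSkewPoly_coeff, perm_sq]
    exact congrArg _ ((esymmAlgEquiv (Fin n) k (Fintype.card_fin n) f).2 σ)
  | hy i =>
    rw [toSkewPoly_y, gen]
    have hs : Equiv.Perm.sign σ = 1 := Equiv.Perm.mem_alternatingGroup.1 hσ
    split_ifs
    · exact perm_powerSum σ _
    · rw [perm_fullProd, hs, Units.val_one, one_smul]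
    · rw [perm_cofactorSum, hs, Units.val_one, one_smul]
  | hmul a b ha hb => rw [map_mul, map_mul, ha, hb]
  | hadd a b ha hb => rw [map_add, map_add, ha, hb]

variable (k n) in
/-- The homomorphism from `C` onto the fixed subring. -/
def toInvariants : OreAlg k n →ₐ[k] invariants k (alternatingGroup (Fin n)) :=
  (toSkewPoly k n).codRestrict _ toSkewPoly_mem_invariants

theorem coe_toInvariants (c : OreAlg k n) :
    (toInvariants k n c : SkewPoly k n) = toSkewPoly k n c := rfl

theorem toInvariants_surjective [CharZero k] (hn : 1 ≤ n) :
    Function.Surjective (toInvariants k n) := by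
  intro a
  obtain ⟨c, hc⟩ := mem_range_of_mem_invariants hn a.2
  exact ⟨c, Subtype.ext hc⟩

theorem sq_esymm_mem_grading (m : ℕ) : sq k n (esymm (Fin n) k m) ∈ grading k n (2 * m) := by
  have h : ∀ t : Finset (Fin n), sq k n (∏ i ∈ t, X i) ∈ grading k n (2 * t.card) := by
    intro t
    induction t using Finset.induction_on with
    | empty =>
      rw [Finset.prod_empty, map_one, Finset.card_empty, mul_zero]
      exact SetLike.GradedOne.one_mem
    | insert i t hi ih =>
      rw [Finset.prod_insert hi, map_mul, Finset.card_insert_of_notMem hi, mul_add, mul_one,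
        add_comm, sq_X, pow_two]
      exact SetLike.mul_mem_graded (SetLike.mul_mem_graded (x_mem_grading i) (x_mem_grading i)) ih
  rw [esymm, map_sum]
  refine sum_mem fun t ht => ?_
  rw [← (Finset.mem_powersetCard.1 ht).2]
  exact h t

theorem sq_esymmMap_monomial_mem_grading (m : Fin n →₀ ℕ) :
    sq k n (esymmMap k n (monomial m 1)) ∈
      grading k n (m.sum fun i e => e * (2 * ((i : ℕ) + 1))) := by
  induction m using Finsupp.induction_linear with
  | zero =>
    rw [Finsupp.sum_zero_index, ← C_apply, C_1, map_one, map_one]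
    exact SetLike.GradedOne.one_mem
  | add f g hf hg =>
    rw [Finsupp.sum_add_index' (fun _ => zero_mul _) (fun _ _ _ => add_mul _ _ _),
      ← one_mul (1 : k), ← monomial_mul, map_mul, map_mul]
    exact SetLike.mul_mem_graded hf hg
  | single i e =>
    rw [Finsupp.sum_single_index (zero_mul _), ← X_pow_eq_monomial, map_pow, map_pow, esymmMap_X]
    exact SetLike.pow_mem_graded e (sq_esymm_mem_grading _)

theorem gen_mem_grading (i : Fin (n + 1)) :
    gen k n i ∈ grading k n (OreAlg.weight n i) := by
  by_cases h : (i : ℕ) + 1 < n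
  · rw [gen_of_lt h, OreAlg.weight_of_lt h]
    exact powerSum_mem_grading _
  rw [gen, OreAlg.weight, if_neg h, if_neg h]
  split_ifs
  · exact fullProd_mem_grading
  · exact cofactorSum_mem_grading

theorem toSkewPoly_mem_grading {d : ℕ} {c : OreAlg k n} (hc : c ∈ OreAlg.grading k n d) :
    toSkewPoly k n c ∈ grading k n d := by
  have h : OreAlg.grading k n d ≤ (grading k n d).comap (toSkewPoly k n).toLinearMap := by
    rw [OreAlg.grading_eq_span]
    refine Submodule.span_le.2 ?_
    rintro _ ⟨m, l, rfl, rfl⟩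
    change toSkewPoly k n _ ∈ grading k n _
    rw [map_mul, toSkewPoly_coeff, map_list_prod, List.map_map]
    refine SetLike.mul_mem_graded (sq_esymmMap_monomial_mem_grading m) ?_
    exact SetLike.list_prod_map_mem_graded l (fun i : Fin (n + 1) => OreAlg.weight n (i : ℕ)) _ fun i _ => by
      rw [Function.comp_apply, toSkewPoly_y]
      exact gen_mem_grading i
  exact h hc

instance (G : Subgroup (Equiv.Perm (Fin n))) : SetLike.GradedMonoid (invariantsGrading k G) where
  one_mem := SetLike.GradedOne.one_mem (A := grading k n)
  mul_mem _ _ _ _ ha hb := SetLike.mul_mem_graded (A := grading k n) ha hb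

/-- The invariants are the sum of their homogeneous parts because they are the image of `C`. -/
theorem isConnectedGraded_invariants [CharZero k] (hn : 1 ≤ n) :
    IsConnectedGraded k (invariantsGrading k (alternatingGroup (Fin n))) where
  nontrivial := inferInstance
  gradedMonoid := inferInstance
  isInternal := by
    obtain ⟨ρ, hρ⟩ := exists_coaction k n
    have key : ∀ x : DirectSum ℕ fun d => invariantsGrading k (alternatingGroup (Fin n)) d, ∀ d,
        (ρ (DirectSum.coeAddMonoidHom (invariantsGrading k (alternatingGroup (Fin n))) x :
          invariants k (alternatingGroup (Fin n)))).coeff d =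
          ((x d : invariants k (alternatingGroup (Fin n))) : SkewPoly k n) := by
      intro x d
      induction x using DirectSum.induction_on with
      | zero => simp
      | of i a =>
        rw [DirectSum.coeAddMonoidHom_of, hρ i (a : invariants k (alternatingGroup (Fin n))) a.2, Polynomial.coeff_monomial,
          DirectSum.coe_of_apply]
        split_ifs <;> rfl
      | add x y hx hy =>
        rw [map_add, Subalgebra.coe_add, map_add, Polynomial.coeff_add, hx, hy]; rfl
    constructor
    · refine (injective_iff_map_eq_zero _).2 fun x hx => ?_
      ext d
      rw [← key x d, hx, ZeroMemClass.coe_zero, map_zero]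
      rfl
    · intro a
      obtain ⟨c, rfl⟩ := toInvariants_surjective hn a
      change _ ∈ AddMonoidHom.mrange (DirectSum.coeAddMonoidHom _)
      induction OreAlg.mem_iSup_grading c using Submodule.iSup_induction' with
      | mem i c hc =>
        exact ⟨DirectSum.of (fun d => invariantsGrading k (alternatingGroup (Fin n)) d) i
          ⟨toInvariants k n c, toSkewPoly_mem_grading hc⟩, DirectSum.coeAddMonoidHom_of _ _ _⟩
      | zero => rw [map_zero]; exact zero_mem _
      | add x y _ _ hx hy => rw [map_add]; exact add_mem hx hy
  zero_eq := by
    ext a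
    rw [Submodule.mem_one, invariantsGrading, Submodule.mem_comap, grading, pow_zero,
      Submodule.mem_one]
    exact exists_congr fun c => ⟨fun h => Subtype.ext h, fun h => congrArg Subtype.val h⟩

theorem isTwoSidedNoetherian_invariants [CharZero k] (hn : 1 ≤ n) :
    IsTwoSidedNoetherian (invariants k (alternatingGroup (Fin n))) := by
  have h := OreAlg.isTwoSidedNoetherian (k := k) (n := n)
  have := h.1
  have := h.2
  refine ⟨isNoetherianRing_of_surjective _ _ (toInvariants k n).toRingHom
    (toInvariants_surjective hn), isNoetherianRing_of_surjective _ _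
      (RingHom.op (toInvariants k n).toRingHom) fun a => ?_⟩
  obtain ⟨c, hc⟩ := toInvariants_surjective hn a.unop
  exact ⟨MulOpposite.op c, congrArg MulOpposite.op hc⟩

theorem inducesGradedIso_toInvariants [CharZero k] (hn : 2 ≤ n) :
    InducesGradedIso k (OreAlg.grading k n)
      (invariantsGrading k (alternatingGroup (Fin n))) (OreAlg.r k n) (toInvariants k n) where
  map_mem _ _ hc := toSkewPoly_mem_grading hc
  surjective := toInvariants_surjective (by omega)
  ker_eq c := by
    rw [← OreAlg.toSkewPoly_eq_zero_iff hn]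
    exact Subtype.ext_iff

end SkewPoly

end

theorem theorem4p15 {k : Type u} [Field k] [CharZero k] (n : ℕ) (hn : 3 ≤ n) :
    IsCCI k (SkewPoly.invariantsGrading k (alternatingGroup (Fin n))) ∧
    OreAlg.IsIteratedOreExtension k n ∧
    IsConnectedGraded k (OreAlg.grading k n) ∧
    IsTwoSidedNoetherian (OreAlg k n) ∧
    IsASRegular k (OreAlg.grading k n) (2 * n + 1) ∧
    (∀ i, OreAlg.r k n i ∈ Subring.center (OreAlg k n)) ∧
    (∀ i : Fin (n + 1), OreAlg.r k n i ∈ OreAlg.grading k n (2 * OreAlg.weight n i)) ∧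
    IsRegularSequence (OreAlg.r k n) ∧
    ∃ φ : OreAlg k n →ₐ[k] SkewPoly.invariants k (alternatingGroup (Fin n)),
      InducesGradedIso k (OreAlg.grading k n)
        (SkewPoly.invariantsGrading k (alternatingGroup (Fin n))) (OreAlg.r k n) φ ∧
      (∀ i : Fin n, (φ (OreAlg.coeff k n (MvPolynomial.X i)) : SkewPoly k n) =
        SkewPoly.squareEsymm k n (i + 1)) ∧
      (∀ i : Fin (n + 1), (i : ℕ) + 1 < n →
        (φ (OreAlg.y k n i) : SkewPoly k n) = SkewPoly.powerSum k n (2 * i + 1)) ∧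
      (φ (OreAlg.y k n ⟨n - 1, by omega⟩) : SkewPoly k n) = SkewPoly.initialProd k n n ∧
      (φ (OreAlg.y k n ⟨n, by omega⟩) : SkewPoly k n) =
        SkewPoly.orbitSum k (alternatingGroup (Fin n)) (SkewPoly.initialProd k n (n - 1)) := by
  have h2 : 2 ≤ n := by omega
  have h1 : 1 ≤ n := by omega
  refine ⟨⟨SkewPoly.isConnectedGraded_invariants h1, SkewPoly.isTwoSidedNoetherian_invariants h1,
      OreAlg k n, inferInstance, inferInstance, OreAlg.grading k n, n + 1, OreAlg.r k n,
      OreAlg.isConnectedGraded h2, OreAlg.isTwoSidedNoetherian, ⟨_, OreAlg.isASRegular h2⟩,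
      fun i => ⟨2 * OreAlg.weight n i, Nat.mul_pos two_pos (OreAlg.weight_pos h2 i),
        OreAlg.r_mem_grading h2 i⟩, OreAlg.isRegularSequence_r h1, OreAlg.isNormalSequence_r,
      SkewPoly.toInvariants k n, SkewPoly.inducesGradedIso_toInvariants h2⟩,
    OreAlg.isIteratedOreExtension h1, OreAlg.isConnectedGraded h2, OreAlg.isTwoSidedNoetherian,
    OreAlg.isASRegular h2, OreAlg.r_mem_center, OreAlg.r_mem_grading h2,
    OreAlg.isRegularSequence_r h1, SkewPoly.toInvariants k n,
    SkewPoly.inducesGradedIso_toInvariants h2, fun i => ?_, fun i hi => ?_, ?_, ?_⟩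
  · rw [SkewPoly.coe_toInvariants, SkewPoly.toSkewPoly_coeff, esymmMap_X, SkewPoly.squareEsymm_eq]
  · rw [SkewPoly.coe_toInvariants, SkewPoly.toSkewPoly_y, SkewPoly.gen_of_lt hi]
  · rw [SkewPoly.coe_toInvariants, SkewPoly.toSkewPoly_y]
    exact SkewPoly.gen_pred h1
  · rw [SkewPoly.coe_toInvariants, SkewPoly.toSkewPoly_y, SkewPoly.orbitSum_initialProd hn]
    exact SkewPoly.gen_self
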